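/- **Definitions.** A *p.m.p. groupoid* is a groupoid $\mathscr G$ with a standard Borel structure, with Borel unit space $\mathscr G^0$ and Borel source map $\mathfrak s$, range map $\mathfrak r$, multiplication and inversion, with $\mathfrak s^{-1}(x)$ countable for every $x\in\mathscr G^0$, together with a Borel probability measure $\mu$ on $\mathscr G^0$ such that $\int|\mathfrak s^{-1}(x)\cap B|\,d\mu(x)=\int|\mathfrak r^{-1}(x)\cap B|\,d\mu(x)$ for every Borel $B\subseteq\mathscr G$; this common value defines a measure on $\mathscr G$, also written $\mu$. For a Borel set $B\subseteq\mathscr G$ on which $\mathfrak s$ and $\mathfrak r$ are injective, $s_B$ is the partial isometry on $L^2(\mathscr G,\mu)$ with $(s_B\xi)(x)=\xi(y^{-1})$ if $y$ satisfies $\mathfrak r(y)=\mathfrak s(x)$ and $xy\in B$, and $(s_B\xi)(x)=0$ if there is no such $y$. Let $I_{\mathscr G}$ be the set of all $s_B$, which is closed under products and adjoints, let $[I_{\mathscr G}]$ be its complex linear span, and let $\tau(a)=\langle a1_{\mathscr G^0},1_{\mathscr G^0}\rangle$. For $d\in\mathbb N$ let $\mathrm{tr}$ be the normalized trace on $M_d(\mathbb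 C)$, $\|a\|_2=\mathrm{tr}(a^*a)^{1/2}$, and $I_d\subseteq M_d(\mathbb C)$ the set of partial permutation matrices. For a finite set $F\subseteq I_{\mathscr G}$, $n\in\mathbb N$ and $\delta>0$, let $\mathrm{SA}(F,n,\delta,d)$ be the set of linear maps $\varphi:[I_{\mathscr G}]\to M_d(\mathbb C)$ such that for all $1\le k\le n$ and $s_1,\dots,s_k\in F\cup F^*$ $$\|\varphi(s_1\cdots s_k)-\varphi(s_1)\cdots\varphi(s_k)\|_2<\delta,\qquad \varphi(s_1\cdots s_k)\in I_d,\qquad |\mathrm{tr}\,\varphi(s_1\cdots s_k)-\tau(s_1\cdots s_k)|<\delta .$$ For a set $E\subseteq I_{\mathscr G}$ write $|\mathrm{SA}(F,n,\delta,d)|_E$ for the (possibly infinite) number of distinct restrictions $\varphi|_E$ with $\varphi\in\mathrm{SA}(F,n,\delta,d)$. The *sofic dimension* of $\mathscr G$ is $$s(\mathscr G)=\sup_E\,\inf_F\,\inf_{n\in\mathbb N}\,\inf_{\delta>0}\,\limsup_{d\to\infty}\frac{\log|\mathrm{SA}(F,n,\delta,d)|_E}{d\log d}\in[-\infty,\infty],$$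 where $E$ and $F$ range over the finite subsets of $I_{\mathscr G}$, $\log 0=-\infty$ and $\log\infty=\infty$. The *lower sofic dimension* $\underline s(\mathscr G)$ is defined in the same way with $\liminf$ in place of $\limsup$. A countable discrete group $G$ is a p.m.p. groupoid with one unit, and this defines $s(G)$ and $\underline s(G)$. For a measure-preserving action of $G$ on a standard probability space $(X,\mu)$, $s(G,X)$ and $\underline s(G,X)$ denote the sofic dimension and lower sofic dimension of the p.m.p. groupoid $G\times X$ of the action, in which $(g,x)$ is an arrow from $x$ to $gx$, with product $(g,hx)(h,x)=(gh,x)$. **Theorem.** Let $G$ be a countable discrete group, let $(Y,\nu)$ be a probability space with $Y$ finite (all subsets of $Y$ being measurable), and let $G\curvearrowright(X,\mu)=(Y,\nu)^G$ be the Bernoulli action, $(gx)_t=x_{g^{-1}t}$. Then $$s(G,X)=s(G)\qquad\text{and}\qquad\underline s(G,X)=\underline s(G).$$ -/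

import Mathlib

open MeasureTheory Filter
open scoped ENNReal

noncomputable section

namespace SoficDim

/-- A probability-measure-preserving groupoid with space of arrows `A` and space of units `X`,
both standard Borel. The product `mul x y` is only meaningful when `src x = rng y`; all the laws
and the measurability of the product are about such composable pairs. The units sit in `A` through
`one`. The measure `vol` on the space of arrows is the one determined by the probability measure
`unitMeasure` on the units: the `vol`-measure of a Borel set `B` is the common value of
`∫ |src⁻¹(x) ∩ B|` and `∫ |rng⁻¹(x) ∩ B|`. -/
structure PMPGroupoid (A X : Type*) [MeasurableSpace A] [StandardBorelSpace A]
    [MeasurableSpace X] [StandardBorelSpace X] where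
  src : A → X
  rng : A → X
  one : X → A
  mul : A → A → A
  inv : A → A
  src_one : ∀ x, src (one x) = x
  rng_one : ∀ x, rng (one x) = x
  src_mul : ∀ x y, src x = rng y → src (mul x y) = src y
  rng_mul : ∀ x y, src x = rng y → rng (mul x y) = rng x
  mul_assoc : ∀ x y z, src x = rng y → src y = rng z → mul (mul x y) z = mul x (mul y z)
  mul_one : ∀ x, mul x (one (src x)) = x
  one_mul : ∀ x, mul (one (rng x)) x = x
  src_inv : ∀ x, src (inv x) = rng x
  rng_inv : ∀ x, rng (inv x) = src x
  mul_inv : ∀ x, mul x (inv x) = one (rng x)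
  inv_mul : ∀ x, mul (inv x) x = one (src x)
  measurable_src : Measurable src
  measurable_rng : Measurable rng
  measurable_one : Measurable one
  measurable_mul : Measurable fun p : {p : A × A // src p.1 = rng p.2} => mul p.1.1 p.1.2
  measurable_inv : Measurable inv
  countable_src_fiber : ∀ x, (src ⁻¹' {x}).Countable
  unitMeasure : Measure X
  isProbabilityMeasure : IsProbabilityMeasure unitMeasure
  vol : Measure A
  vol_eq_src : ∀ B : Set A, MeasurableSet B →
    vol B = ∫⁻ x, ((src ⁻¹' {x} ∩ B).encard : ℝ≥0∞) ∂unitMeasure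
  vol_eq_rng : ∀ B : Set A, MeasurableSet B →
    vol B = ∫⁻ x, ((rng ⁻¹' {x} ∩ B).encard : ℝ≥0∞) ∂unitMeasure

/-! ### Finite models: `d × d` matrices -/

/-- The set `I_d` of partial permutation matrices of size `d`. -/
def partialPermMatrices (d : ℕ) : Set (Matrix (Fin d) (Fin d) ℂ) :=
  Set.range fun f : Fin d ≃. Fin d => f.toMatrix

/-- The normalized trace on `d × d` matrices. -/
def normTrace {d : ℕ} (a : Matrix (Fin d) (Fin d) ℂ) : ℂ := a.trace / d

/-- The `2`-norm `‖a‖₂ = tr(a* a)^{1/2}` with respect to the normalized trace. -/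
def norm2 {d : ℕ} (a : Matrix (Fin d) (Fin d) ℂ) : ℝ :=
  Real.sqrt (normTrace (a.conjTranspose * a)).re

namespace PMPGroupoid

variable {A X : Type*} [MeasurableSpace A] [StandardBorelSpace A]
  [MeasurableSpace X] [StandardBorelSpace X]

/-- The set of units, as a subset of the groupoid. -/
def units (𝒢 : PMPGroupoid A X) : Set A := Set.range 𝒢.one

theorem measurableSet_units (𝒢 : PMPGroupoid A X) : MeasurableSet 𝒢.units := by
  have hinj : Function.Injective 𝒢.one := fun x y h => by
    rw [← 𝒢.src_one x, h, 𝒢.src_one]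
  exact (𝒢.measurable_one.measurableEmbedding hinj).measurableSet_range

theorem vol_units (𝒢 : PMPGroupoid A X) : 𝒢.vol 𝒢.units = 1 := by
  have := 𝒢.isProbabilityMeasure
  rw [𝒢.vol_eq_src _ 𝒢.measurableSet_units]
  have h : ∀ x, 𝒢.src ⁻¹' {x} ∩ 𝒢.units = {𝒢.one x} := by
    intro x
    ext a
    constructor
    · rintro ⟨h, y, rfl⟩
      simp only [Set.mem_preimage, 𝒢.src_one, Set.mem_singleton_iff] at h
      simp [h]
    · rintro rfl
      exact ⟨by simp [𝒢.src_one], x, rfl⟩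
  simp [h]

/-- The Hilbert space `L²(𝒢, vol)`. -/
abbrev L2 (𝒢 : PMPGroupoid A X) := Lp ℂ 2 𝒢.vol

/-- The algebra of bounded operators on `L²(𝒢, vol)`. -/
abbrev Op (𝒢 : PMPGroupoid A X) := 𝒢.L2 →L[ℂ] 𝒢.L2

/-- Borel sets on which both the source and the range map are injective. -/
def IsBisection (𝒢 : PMPGroupoid A X) (B : Set A) : Prop :=
  MeasurableSet B ∧ Set.InjOn 𝒢.src B ∧ Set.InjOn 𝒢.rng B

/-- `T` is the partial isometry `s_B` of a bisection `B`: `(T ξ)(x) = ξ(y⁻¹)` when `y` is the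
element with `rng y = src x` and `x y ∈ B`, and `(T ξ)(x) = 0` when there is no such `y`. -/
def IsPartialIsometryOf (𝒢 : PMPGroupoid A X) (B : Set A) (T : 𝒢.Op) : Prop :=
  ∀ ξ : 𝒢.L2, ∀ᵐ x ∂𝒢.vol,
    (∀ y, 𝒢.rng y = 𝒢.src x → 𝒢.mul x y ∈ B → T ξ x = ξ (𝒢.inv y)) ∧
    ((¬ ∃ y, 𝒢.rng y = 𝒢.src x ∧ 𝒢.mul x y ∈ B) → T ξ x = 0)

/-- The inverse semigroup `I_𝒢` of partial isometries `s_B`. Its product is composition and its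
inverse is the adjoint. -/
def partialIsometries (𝒢 : PMPGroupoid A X) : Set 𝒢.Op :=
  {T | ∃ B, 𝒢.IsBisection B ∧ 𝒢.IsPartialIsometryOf B T}

/-- The linear span `[I_𝒢]`. -/
abbrev linSpan (𝒢 : PMPGroupoid A X) : Submodule ℂ 𝒢.Op :=
  Submodule.span ℂ 𝒢.partialIsometries

/-- The characteristic function of the set of units, as a vector in `L²(𝒢, vol)`. -/
def unitVector (𝒢 : PMPGroupoid A X) : 𝒢.L2 :=
  indicatorConstLp 2 𝒢.measurableSet_units (by simp [𝒢.vol_units]) (1 : ℂ)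

/-- The trace `τ(a) = ⟨a 1, 1⟩` where `1` is the characteristic function of the units. (In Mathlib
the inner product is linear in the second variable.) -/
def trace (𝒢 : PMPGroupoid A X) (a : 𝒢.Op) : ℂ :=
  inner ℂ 𝒢.unitVector (a 𝒢.unitVector)

/-- The set `SA(F, n, δ, d)`: linear maps `φ : [I_𝒢] → M_d` such that for all words `s₁ ⋯ s_k`,
`1 ≤ k ≤ n`, in elements of `F ∪ F*`, one has `‖φ(s₁ ⋯ s_k) - φ(s₁) ⋯ φ(s_k)‖₂ < δ`,
`φ(s₁ ⋯ s_k) ∈ I_d`, and `|tr φ(s₁ ⋯ s_k) - τ(s₁ ⋯ s_k)| < δ`. The variable `a` below is the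
product `s₁ ⋯ s_k`, viewed as an element of the domain `[I_𝒢]` of `φ`. -/
def SA (𝒢 : PMPGroupoid A X) (F : Set 𝒢.Op) (n : ℕ) (δ : ℝ) (d : ℕ) :
    Set (𝒢.linSpan →ₗ[ℂ] Matrix (Fin d) (Fin d) ℂ) :=
  {φ | ∀ l : List 𝒢.linSpan, l ≠ [] → l.length ≤ n →
    (∀ s ∈ l, (s : 𝒢.Op) ∈ F ∪ ContinuousLinearMap.adjoint '' F) →
    ∀ a : 𝒢.linSpan, (a : 𝒢.Op) = (l.map Subtype.val).prod →
      norm2 (φ a - (l.map φ).prod) < δ ∧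
      φ a ∈ partialPermMatrices d ∧
      ‖normTrace (φ a) - 𝒢.trace a‖ < δ}

/-- `|S|_E`: the number of distinct restrictions to `E` of the maps in `S`, possibly infinite. -/
def restrictCard (𝒢 : PMPGroupoid A X) (E : Set 𝒢.Op) {d : ℕ}
    (S : Set (𝒢.linSpan →ₗ[ℂ] Matrix (Fin d) (Fin d) ℂ)) : ℕ∞ :=
  ((fun φ (e : {a : 𝒢.linSpan // (a : 𝒢.Op) ∈ E}) => φ e.1) '' S).encard

/-- `log |SA(F, n, δ, d)|_E / (d log d)`, an extended real number, with `log 0 = -∞` and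
`log ∞ = ∞`. -/
def growth (𝒢 : PMPGroupoid A X) (E F : Set 𝒢.Op) (n : ℕ) (δ : ℝ) (d : ℕ) : EReal :=
  ENNReal.log (𝒢.restrictCard E (𝒢.SA F n δ d) : ℝ≥0∞) / ((d * Real.log d : ℝ) : EReal)

/-- The sofic dimension `s(Ω)` of a set `Ω` of partial isometries. -/
def soficDimOf (𝒢 : PMPGroupoid A X) (Ω : Set 𝒢.Op) : EReal :=
  ⨆ (E : Set 𝒢.Op) (_ : E.Finite ∧ E ⊆ Ω), ⨅ (F : Set 𝒢.Op) (_ : F.Finite ∧ F ⊆ Ω),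
    ⨅ (n : ℕ) (_ : 1 ≤ n), ⨅ (δ : ℝ) (_ : 0 < δ), limsup (𝒢.growth E F n δ) atTop

/-- The lower sofic dimension of a set `Ω` of partial isometries. -/
def lowerSoficDimOf (𝒢 : PMPGroupoid A X) (Ω : Set 𝒢.Op) : EReal :=
  ⨆ (E : Set 𝒢.Op) (_ : E.Finite ∧ E ⊆ Ω), ⨅ (F : Set 𝒢.Op) (_ : F.Finite ∧ F ⊆ Ω),
    ⨅ (n : ℕ) (_ : 1 ≤ n), ⨅ (δ : ℝ) (_ : 0 < δ), liminf (𝒢.growth E F n δ) atTop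

/-- The sofic dimension `s(𝒢) = s(I_𝒢)`. -/
def soficDim (𝒢 : PMPGroupoid A X) : EReal := 𝒢.soficDimOf 𝒢.partialIsometries

/-- The lower sofic dimension of `𝒢`. -/
def lowerSoficDim (𝒢 : PMPGroupoid A X) : EReal := 𝒢.lowerSoficDimOf 𝒢.partialIsometries

end PMPGroupoid

/-! ### Countable discrete groups and their measure-preserving actions -/

section Actions

variable (G : Type*) [Group G] [Countable G] [MeasurableSpace G] [DiscreteMeasurableSpace G]

/-- A countable discrete group as a p.m.p. groupoid with a single unit. -/
def groupGroupoid : PMPGroupoid G Unit where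
  src _ := ()
  rng _ := ()
  one _ := 1
  mul g h := g * h
  inv g := g⁻¹
  src_one _ := rfl
  rng_one _ := rfl
  src_mul _ _ _ := rfl
  rng_mul _ _ _ := rfl
  mul_assoc x y z _ _ := _root_.mul_assoc x y z
  mul_one := _root_.mul_one
  one_mul := _root_.one_mul
  src_inv _ := rfl
  rng_inv _ := rfl
  mul_inv := mul_inv_cancel
  inv_mul := inv_mul_cancel
  measurable_src := measurable_const
  measurable_rng := measurable_const
  measurable_one := measurable_const
  measurable_mul := (measurable_of_countable fun p : G × G => p.1 * p.2).comp measurable_subtype_coe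
  measurable_inv := measurable_of_countable _
  countable_src_fiber _ := Set.to_countable _
  unitMeasure := Measure.dirac ()
  isProbabilityMeasure := inferInstance
  vol := Measure.count
  vol_eq_src B hB := by simp [Measure.count_apply hB]
  vol_eq_rng B hB := by simp [Measure.count_apply hB]

variable (X : Type*) [MeasurableSpace X] [StandardBorelSpace X] [MulAction G X]
  [MeasurableConstSMul G X] (μ : Measure X) [IsProbabilityMeasure μ] [SMulInvariantMeasure G X μ]

/-- The p.m.p. groupoid `G × X` of a measure-preserving action of a countable discrete group `G`
on `(X, μ)`, in which `(g, x)` is an arrow from `x` to `g x`. -/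
def actionGroupoid : PMPGroupoid (G × X) X where
  src p := p.2
  rng p := p.1 • p.2
  one x := (1, x)
  mul p q := (p.1 * q.1, q.2)
  inv p := (p.1⁻¹, p.1 • p.2)
  src_one _ := rfl
  rng_one x := one_smul G x
  src_mul _ _ _ := rfl
  rng_mul p q h := by
    show (p.1 * q.1) • q.2 = p.1 • p.2
    rw [mul_smul, ← h]
  mul_assoc p q r _ _ := by simp [_root_.mul_assoc]
  mul_one p := by simp
  one_mul p := by simp
  src_inv _ := rfl
  rng_inv p := by simp
  mul_inv p := by simp
  inv_mul p := by simp
  measurable_src := measurable_snd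
  measurable_rng := measurable_from_prod_countable_right fun g => measurable_const_smul g
  measurable_one := measurable_const.prodMk measurable_id
  measurable_mul := by
    have h : Measurable fun p : (G × X) × (G × X) => (p.1.1 * p.2.1, p.2.2) :=
      ((measurable_of_countable fun p : G × G => p.1 * p.2).comp
        ((measurable_fst.comp measurable_fst).prodMk (measurable_fst.comp measurable_snd))).prodMk
        (measurable_snd.comp measurable_snd)
    exact h.comp measurable_subtype_coe
  measurable_inv :=
    ((measurable_of_countable fun g : G => g⁻¹).comp measurable_fst).prodMk
      (measurable_from_prod_countable_right fun g => measurable_const_smul g)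
  countable_src_fiber x := by
    refine (Set.countable_range fun g : G => (g, x)).mono ?_
    rintro ⟨g, y⟩ h
    exact ⟨g, by simpa using Eq.symm h⟩
  unitMeasure := μ
  isProbabilityMeasure := inferInstance
  vol := Measure.count.prod μ
  vol_eq_src B hB := by
    rw [Measure.prod_apply_symm hB]
    refine lintegral_congr fun x => ?_
    rw [Measure.count_apply (measurable_prodMk_right hB)]
    congr 1
    rw [← (Prod.mk_left_injective x).encard_image]
    congr 1
    ext ⟨g, y⟩
    simp only [Set.mem_image, Set.mem_preimage, Set.mem_inter_iff, Set.mem_singleton_iff,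
      Prod.mk.injEq]
    constructor
    · rintro ⟨g, h, rfl, rfl⟩
      exact ⟨rfl, h⟩
    · rintro ⟨rfl, h⟩
      exact ⟨g, h, rfl, rfl⟩
  vol_eq_rng B hB := by
    have hm : ∀ g : G, MeasurableSet {x | (g, x) ∈ B} := fun g => measurable_prodMk_left hB
    have hm' : ∀ g : G, MeasurableSet {x | (g, g⁻¹ • x) ∈ B} := fun g =>
      (measurable_const_smul g⁻¹) (hm g)
    have h1 : ∀ x : X, (((fun p : G × X => p.1 • p.2) ⁻¹' {x} ∩ B).encard : ℝ≥0∞) =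
        ∑' g : G, {x | (g, g⁻¹ • x) ∈ B}.indicator 1 x := by
      intro x
      have h2 : (fun p : G × X => p.1 • p.2) ⁻¹' {x} ∩ B =
          (fun g : G => (g, g⁻¹ • x)) '' {g | (g, g⁻¹ • x) ∈ B} := by
        ext ⟨g, y⟩
        simp only [Set.mem_image, Set.mem_preimage, Set.mem_inter_iff, Set.mem_singleton_iff,
          Prod.mk.injEq, Set.mem_ofPred_eq]
        constructor
        · rintro ⟨rfl, h⟩
          exact ⟨g, by simpa using h, rfl, by simp⟩
        · rintro ⟨g, h, rfl, rfl⟩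
          exact ⟨by simp, h⟩
      rw [h2, Function.Injective.encard_image (fun a b h => congrArg Prod.fst h),
        ← Measure.count_apply (MeasurableSet.of_discrete),
        ← lintegral_indicator_one MeasurableSet.of_discrete, lintegral_count]
      rfl
    simp_rw [h1]
    rw [lintegral_tsum fun g => (measurable_one.indicator (hm' g)).aemeasurable,
      Measure.prod_apply hB, lintegral_count]
    refine tsum_congr fun g => ?_
    rw [lintegral_indicator_one (hm' g)]
    exact (measure_preimage_smul μ g⁻¹ {x | (g, x) ∈ B}).symm

end Actions

/-! ### Bernoulli actions -/

/-- The space `Y^G` of the Bernoulli action, with the product Borel structure. -/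
def BernoulliSpace (G Y : Type*) : Type _ := G → Y

section Bernoulli

variable (G : Type*) {Y : Type*} [MeasurableSpace Y]

instance : MeasurableSpace (BernoulliSpace G Y) :=
  inferInstanceAs (MeasurableSpace (G → Y))

instance [Countable G] [StandardBorelSpace Y] : StandardBorelSpace (BernoulliSpace G Y) :=
  inferInstanceAs (StandardBorelSpace (G → Y))

/-- The shift action `(g x)(t) = x(g⁻¹ t)`. -/
instance [Group G] : MulAction G (BernoulliSpace G Y) where
  smul g x := fun t => x (g⁻¹ * t)
  one_smul x := by
    funext t
    show x (1⁻¹ * t) = x t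
    simp
  mul_smul g h x := by
    funext t
    show x ((g * h)⁻¹ * t) = x (h⁻¹ * (g⁻¹ * t))
    simp [mul_assoc]

/-- The product measure `ν^G`. -/
def bernoulliMeasure (ν : Measure Y) [IsProbabilityMeasure ν] : Measure (BernoulliSpace G Y) :=
  Measure.infinitePi fun _ : G => ν

instance (ν : Measure Y) [IsProbabilityMeasure ν] : IsProbabilityMeasure (bernoulliMeasure G ν) :=
  inferInstanceAs (IsProbabilityMeasure (Measure.infinitePi fun _ : G => ν))

instance [Group G] : MeasurableConstSMul G (BernoulliSpace G Y) where
  measurable_const_smul g := by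
    show Measurable fun (x : G → Y) (t : G) => x (g⁻¹ * t)
    exact measurable_pi_lambda _ fun t => measurable_pi_apply _

instance [Group G] (ν : Measure Y) [IsProbabilityMeasure ν] :
    SMulInvariantMeasure G (BernoulliSpace G Y) (bernoulliMeasure G ν) where
  measure_preimage_smul g s hs := by
    have h := Measure.infinitePi_map_piCongrLeft (μ := fun _ : G => ν) (Equiv.mulLeft g)
    have h2 : (MeasurableEquiv.piCongrLeft (fun _ : G => Y) (Equiv.mulLeft g) :
        (G → Y) → (G → Y)) = fun x t => x (g⁻¹ * t) := by
      funext x t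
      obtain ⟨t, rfl⟩ := (Equiv.mulLeft g).surjective t
      rw [MeasurableEquiv.coe_piCongrLeft, Equiv.piCongrLeft_apply_apply]
      simp
    rw [h2] at h
    have hm : Measurable fun (x : G → Y) (t : G) => x (g⁻¹ * t) :=
      measurable_pi_lambda _ fun t => measurable_pi_apply _
    have h3 := congrArg (fun m : Measure (G → Y) => m s) h
    simp only [Measure.map_apply hm hs] at h3
    exact h3

end Bernoulli

end SoficDim

end

open MeasureTheory Filter
open scoped ENNReal

noncomputable section

namespace SoficDim

/-! ### Partial permutation matrices, acting on columns -/

section Matrices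

/-! Two inequalities are proved, each by comparing numbers of restrictions on the scale `d log d`.
Factors `C ^ d` are invisible on that scale, and a Hamming ball of radius `η d` among matrices whose
columns take `d + 1` values costs only about `η d log d`. It is therefore enough to determine
approximate homomorphisms up to a small proportion of columns and up to exponentially many choices;
`soficDim_le_of_growth_le` and `growth_le_add` turn such comparisons into inequalities for both
dimensions.

Upper bound, valid for every p.m.p. action. A bisection `B` of `G × X` splits according to the group
element, and `s_B` agrees with the translation `u_g` on the projection `p_g` onto the sources of its
arrows labelled `g`. Outside a small tail finitely many `g` suffice. So for an approximate
homomorphism `φ`, almost every column of `φ(s_B)` is zero or a column of some `φ(u_g)`, and the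
choice of `g` at each column is only exponential information. The restriction of `φ` to the
translations is an approximate homomorphism of the group (`SA_comp`), whence
`soficDim_action_le_group`.

Lower bound, valid once sofic approximations of `G` carry good points of `X` (`AdmitsSoficModels`).
An approximate homomorphism `ψ` of `G` yields maps `σ g` of `Fin d` that act freely at most points
(`exists_sofic_of_SA`). Given points `x v` that are almost equivariant and equidistributed, an arrow
set `B` is modelled by the matrix sending `v` to `σ g v` whenever `(g, x v) ∈ B`. These matrices are
partial permutations, multiply correctly off a small set, have the right traces, and send `u_g`
close to `ψ(λ_g)`. Since `SA` consists of maps linear on the whole span, the matrix is read off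
linearly from `a 1` in `L²`, through a linear choice of representatives that is correct, off a null
set, for the finitely many relevant words.

For a Bernoulli action the points come from random labels: `x v` reads the labels of `Fin d` along
`σ`. Equivariance on finitely many coordinates is then automatic, each `x v` has law exactly `ν^G`,
and cylinder events at two points are independent unless the labels they read overlap. Overlapping
pairs number `O(d)`, so a second moment estimate provides a good labelling (`exists_labelling`,
`exists_bernoulli_model`). -/

open scoped Classical in
theorem exists_pequiv_of_injOn {α β : Type*} (h : α → Option β)
    (hinj : ∀ v w i, h v = some i → h w = some i → v = w) :
    ∃ f : α ≃. β, ∀ v, f v = h v := by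
  refine ⟨⟨h, fun i => if H : ∃ v, h v = some i then some H.choose else none, fun v i => ?_⟩,
    fun v => rfl⟩
  constructor
  · intro hv
    split_ifs at hv with H
    · have := H.choose_spec
      rw [Option.some.inj hv] at this
      exact this
  · intro hv
    have H : ∃ v, h v = some i := ⟨v, hv⟩
    rw [dif_pos H, hinj _ _ i H.choose_spec hv]

variable {d : ℕ}

/-- The partial permutation matrix sending the basis vector `v` to the basis vector `f v`. -/
def colMatrix (f : Fin d ≃. Fin d) : Matrix (Fin d) (Fin d) ℂ := f.symm.toMatrix

theorem colMatrix_apply (f : Fin d ≃. Fin d) (i v : Fin d) :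
    colMatrix f i v = if f v = some i then 1 else 0 := by
  rw [colMatrix, PEquiv.toMatrix_apply]
  congr 1
  exact propext (PEquiv.mem_iff_mem f)

theorem colMatrix_mem (f : Fin d ≃. Fin d) : colMatrix f ∈ partialPermMatrices d :=
  ⟨f.symm, rfl⟩

theorem exists_colMatrix {a : Matrix (Fin d) (Fin d) ℂ} (ha : a ∈ partialPermMatrices d) :
    ∃ f : Fin d ≃. Fin d, a = colMatrix f := by
  obtain ⟨f, rfl⟩ := ha
  exact ⟨f.symm, by simp [colMatrix]⟩

theorem colMatrix_mul (f g : Fin d ≃. Fin d) :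
    colMatrix f * colMatrix g = colMatrix (g.trans f) := by
  rw [colMatrix, colMatrix, colMatrix, ← PEquiv.toMatrix_trans]
  rfl

theorem colMatrix_refl : colMatrix (PEquiv.refl (Fin d)) = 1 := by
  simp [colMatrix]

theorem mul_mem_partialPermMatrices {a b : Matrix (Fin d) (Fin d) ℂ}
    (ha : a ∈ partialPermMatrices d) (hb : b ∈ partialPermMatrices d) :
    a * b ∈ partialPermMatrices d := by
  obtain ⟨f, rfl⟩ := exists_colMatrix ha
  obtain ⟨g, rfl⟩ := exists_colMatrix hb
  rw [colMatrix_mul]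
  exact colMatrix_mem _

theorem one_mem_partialPermMatrices :
    (1 : Matrix (Fin d) (Fin d) ℂ) ∈ partialPermMatrices d :=
  colMatrix_refl (d := d) ▸ colMatrix_mem _

theorem list_prod_mem_partialPermMatrices (l : List (Matrix (Fin d) (Fin d) ℂ))
    (hl : ∀ a ∈ l, a ∈ partialPermMatrices d) : l.prod ∈ partialPermMatrices d := by
  induction l with
  | nil => simpa using one_mem_partialPermMatrices
  | cons a l ih =>
    rw [List.prod_cons]
    exact mul_mem_partialPermMatrices (hl a (by simp)) (ih fun b hb => hl b (by simp [hb]))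

theorem mem_partialPermMatrices_of_columns (a : Matrix (Fin d) (Fin d) ℂ)
    (h : Fin d → Option (Fin d)) (hinj : ∀ v w i, h v = some i → h w = some i → v = w)
    (ha : ∀ i v, a i v = if h v = some i then 1 else 0) : a ∈ partialPermMatrices d := by
  obtain ⟨f, hf⟩ := exists_pequiv_of_injOn h hinj
  have : a = colMatrix f := by
    ext i v
    rw [ha, colMatrix_apply, hf]
  rw [this]
  exact colMatrix_mem f

open scoped Classical in
/-- The number of columns in which two matrices differ. -/
def colDist (a b : Matrix (Fin d) (Fin d) ℂ) : ℕ :=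
  (Finset.univ.filter fun v => a.transpose v ≠ b.transpose v).card

theorem colDist_self (a : Matrix (Fin d) (Fin d) ℂ) : colDist a a = 0 := by
  simp [colDist]

theorem colDist_comm (a b : Matrix (Fin d) (Fin d) ℂ) : colDist a b = colDist b a := by
  unfold colDist
  congr 1
  ext v
  simp [eq_comm]

open scoped Classical in
theorem colDist_le_card {a b : Matrix (Fin d) (Fin d) ℂ} (S : Finset (Fin d))
    (h : ∀ v ∉ S, ∀ i, a i v = b i v) : colDist a b ≤ S.card := by
  refine Finset.card_le_card fun v hv => ?_
  by_contra hS
  simp only [Finset.mem_filter] at hv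
  exact hv.2 (funext fun i => h v hS i)

theorem colDist_triangle (a b c : Matrix (Fin d) (Fin d) ℂ) :
    colDist a c ≤ colDist a b + colDist b c := by
  classical
  refine le_trans (Finset.card_le_card ?_) (Finset.card_union_le _ _)
  intro v hv
  simp only [Finset.mem_filter, Finset.mem_univ, true_and, Finset.mem_union] at hv ⊢
  by_contra hcon
  push Not at hcon
  exact hv (hcon.1.trans hcon.2)

/-- Column `v` of `c * a` depends only on column `v` of `a`. This lets the errors in a word be added
up letter by letter. -/
theorem colDist_mul_left (c a b : Matrix (Fin d) (Fin d) ℂ) :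
    colDist (c * a) (c * b) ≤ colDist a b := by
  classical
  refine colDist_le_card _ fun v hv i => ?_
  simp only [Finset.mem_filter, Finset.mem_univ, true_and, not_not] at hv
  simp only [Matrix.mul_apply]
  exact Finset.sum_congr rfl fun j _ => by rw [show a j v = b j v from congrFun hv j]

theorem norm2_sq (a : Matrix (Fin d) (Fin d) ℂ) :
    norm2 a ^ 2 = (∑ v, ∑ i, ‖a i v‖ ^ 2) / d := by
  have h : (normTrace (a.conjTranspose * a)).re = (∑ v, ∑ i, ‖a i v‖ ^ 2) / d := by
    have : normTrace (a.conjTranspose * a) = (((∑ v, ∑ i, ‖a i v‖ ^ 2) / d : ℝ) : ℂ) := by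
      simp only [normTrace, Matrix.trace, Matrix.diag, Matrix.mul_apply,
        Matrix.conjTranspose_apply]
      push_cast
      congr 1
      refine Finset.sum_congr rfl fun v _ => Finset.sum_congr rfl fun i _ => ?_
      exact Complex.conj_mul' (a i v)
    rw [this, Complex.ofReal_re]
  rw [norm2, Real.sq_sqrt, h]
  rw [h]
  positivity

theorem norm2_nonneg (a : Matrix (Fin d) (Fin d) ℂ) : 0 ≤ norm2 a := Real.sqrt_nonneg _

/-- Two distinct columns with entries `0` and `1` differ by `1` somewhere, so each contributes at
least `1` to `d ‖a - b‖₂²`. With `norm2_sq_le_colDist` this makes the `2`-norm and the proportion of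
differing columns interchangeable on partial permutations. -/
theorem colDist_le_of_norm2 {a b : Matrix (Fin d) (Fin d) ℂ} (ha : a ∈ partialPermMatrices d)
    (hb : b ∈ partialPermMatrices d) : (colDist a b : ℝ) ≤ d * norm2 (a - b) ^ 2 := by
  classical
  obtain ⟨f, rfl⟩ := exists_colMatrix ha
  obtain ⟨g, rfl⟩ := exists_colMatrix hb
  rcases Nat.eq_zero_or_pos d with rfl | hd
  · simp [colDist]
  rw [norm2_sq, mul_div_cancel₀ _ (by positivity), colDist, Finset.card_filter]
  push_cast
  refine Finset.sum_le_sum fun v _ => ?_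
  split_ifs with h
  · obtain ⟨i, hi⟩ : ∃ i, colMatrix f i v ≠ colMatrix g i v := by
      by_contra hcon
      push Not at hcon
      exact h (funext hcon)
    refine le_trans ?_ (Finset.single_le_sum (f := fun i => ‖(colMatrix f - colMatrix g) i v‖ ^ 2)
      (fun i _ => by positivity) (Finset.mem_univ i))
    simp only [Matrix.sub_apply, colMatrix_apply] at hi ⊢
    split_ifs at hi ⊢ <;> simp_all
  · positivity

/-- A column of a partial permutation matrix has at most one nonzero entry, so a pair of differing
columns contributes at most `2`. -/
theorem norm2_sq_le_colDist {a b : Matrix (Fin d) (Fin d) ℂ} (ha : a ∈ partialPermMatrices d)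
    (hb : b ∈ partialPermMatrices d) : d * norm2 (a - b) ^ 2 ≤ 2 * (colDist a b : ℝ) := by
  classical
  obtain ⟨f, rfl⟩ := exists_colMatrix ha
  obtain ⟨g, rfl⟩ := exists_colMatrix hb
  rcases Nat.eq_zero_or_pos d with rfl | hd
  · simp
  rw [norm2_sq, mul_div_cancel₀ _ (by positivity), colDist, Finset.card_filter]
  push_cast
  rw [Finset.mul_sum]
  refine Finset.sum_le_sum fun v _ => ?_
  have key : ∀ o : Option (Fin d), ∑ i, (if o = some i then (1 : ℝ) else 0) ≤ 1 := by
    intro o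
    cases o <;> simp
  split_ifs with h
  · calc ∑ i, ‖(colMatrix f - colMatrix g) i v‖ ^ 2
        ≤ ∑ i, ((if f v = some i then (1 : ℝ) else 0) + (if g v = some i then (1 : ℝ) else 0)) := by
          refine Finset.sum_le_sum fun i _ => ?_
          simp only [Matrix.sub_apply, colMatrix_apply]
          split_ifs <;> norm_num
      _ ≤ 2 * 1 := by
          rw [Finset.sum_add_distrib]
          linarith [key (f v), key (g v)]
  · push Not at h
    rw [Finset.sum_eq_zero]
    · simp
    · intro i _
      rw [Matrix.sub_apply, show colMatrix f i v = colMatrix g i v from congrFun h i]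
      simp

theorem norm2_lt_of_colDist {a b : Matrix (Fin d) (Fin d) ℂ} (ha : a ∈ partialPermMatrices d)
    (hb : b ∈ partialPermMatrices d) {δ : ℝ} (hδ : 0 < δ) (hd : 0 < d)
    (h : 2 * (colDist a b : ℝ) < δ ^ 2 * d) : norm2 (a - b) < δ := by
  have h1 := norm2_sq_le_colDist ha hb
  have hd' : (0 : ℝ) < d := by exact_mod_cast hd
  refine lt_of_pow_lt_pow_left₀ 2 hδ.le ?_
  nlinarith

theorem colDist_le_of_norm2_lt {a b : Matrix (Fin d) (Fin d) ℂ} (ha : a ∈ partialPermMatrices d)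
    (hb : b ∈ partialPermMatrices d) {δ : ℝ} (h : norm2 (a - b) < δ) :
    (colDist a b : ℝ) ≤ δ ^ 2 * d := by
  have h1 := colDist_le_of_norm2 ha hb
  have h2 : norm2 (a - b) ^ 2 ≤ δ ^ 2 := by
    have := norm2_nonneg (a - b)
    gcongr
  have : (0 : ℝ) ≤ d := by positivity
  nlinarith

open scoped Classical in
theorem normTrace_colMatrix (f : Fin d ≃. Fin d) :
    normTrace (colMatrix f) = ((Finset.univ.filter fun v => f v = some v).card : ℂ) / d := by
  simp only [normTrace, Matrix.trace, Matrix.diag, colMatrix_apply]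
  rw [Finset.card_filter]
  push_cast
  rfl

/-! ### Counting -/

open scoped Classical in
/-- The functions with values in `O` that differ from `c` in at most `m` places. -/
theorem exists_finset_hamming_ball {β : Type*} (O : Finset β) (k : ℕ) (hk : 1 ≤ k)
    (hO : O.card ≤ k) (c : Fin d → β) (m : ℕ) :
    ∃ S : Finset (Fin d → β), S.card ≤ 2 ^ d * k ^ m ∧
      ∀ f : Fin d → β, (∀ v, f v ∈ O) → (Finset.univ.filter fun v => f v ≠ c v).card ≤ m →
        f ∈ S := by
  -- A function in the ball is determined by the set `T` of places where it may leave `c`, at most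
  -- `2 ^ d` choices, and by its values there, at most `k ^ m` choices.
  refine ⟨(Finset.univ.filter fun T : Finset (Fin d) => T.card ≤ m).biUnion fun T =>
    Fintype.piFinset fun v => if v ∈ T then O else {c v}, ?_, ?_⟩
  · refine le_trans (Finset.card_biUnion_le_card_mul _ _ (k ^ m) fun T hT => ?_) ?_
    · rw [Fintype.card_piFinset]
      simp only [Finset.mem_filter] at hT
      calc ∏ v, (if v ∈ T then O else {c v}).card ≤ ∏ v, (if v ∈ T then k else 1) := by
            refine Finset.prod_le_prod' fun v _ => ?_
            split_ifs <;> simp [hO]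
        _ = k ^ T.card := by simp
        _ ≤ k ^ m := Nat.pow_le_pow_right hk hT.2
    · gcongr
      refine (Finset.card_filter_le _ _).trans ?_
      simp
  · intro f hf hm
    simp only [Finset.mem_biUnion, Finset.mem_filter, Finset.mem_univ, true_and]
    refine ⟨_, hm, ?_⟩
    simp only [Fintype.mem_piFinset, Finset.mem_filter, Finset.mem_univ, true_and]
    intro v
    split_ifs with h
    · exact hf v
    · push Not at h
      simp [h]

open scoped Classical in
-- A column of a partial permutation matrix is zero or a basis vector, so it takes at most `d + 1`
-- values.
theorem exists_finset_colDist_ball (c : Matrix (Fin d) (Fin d) ℂ) (m : ℕ) :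
    ∃ S : Finset (Matrix (Fin d) (Fin d) ℂ), S.card ≤ 2 ^ d * (d + 1) ^ m ∧
      ∀ a ∈ partialPermMatrices d, colDist a c ≤ m → a ∈ S := by
  let O : Finset (Fin d → ℂ) :=
    (Finset.univ : Finset (Option (Fin d))).image fun o i => if o = some i then 1 else 0
  have hO : O.card ≤ d + 1 := by
    refine Finset.card_image_le.trans ?_
    simp
  obtain ⟨S, hS, h⟩ := exists_finset_hamming_ball O (d + 1) (by omega) hO c.transpose m
  refine ⟨S.image Matrix.transpose, Finset.card_image_le.trans hS, fun a ha hm => ?_⟩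
  refine Finset.mem_image.2 ⟨a.transpose, h _ (fun v => ?_) hm, Matrix.transpose_transpose a⟩
  obtain ⟨f, rfl⟩ := exists_colMatrix ha
  refine Finset.mem_image.2 ⟨f v, Finset.mem_univ _, ?_⟩
  funext i
  rw [Matrix.transpose_apply, colMatrix_apply]

/-- The counting scheme of both inequalities: `T` is the set of restrictions on the other side, and
a restriction `t` leaves at most `M` possibilities for each coordinate of `r`. -/
theorem encard_le_of_fibers {ι β γ : Type*} [Finite ι] (S : Set (ι → β)) (T : Set γ)
    (M : ℕ) (hM : 1 ≤ M) (O : γ → ι → Finset β)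
    (hO : ∀ t i, (O t i).card ≤ M) (h : ∀ r ∈ S, ∃ t ∈ T, ∀ i, r i ∈ O t i) :
    S.encard ≤ T.encard * (M ^ Nat.card ι : ℕ) := by
  classical
  have := Fintype.ofFinite ι
  rcases T.finite_or_infinite with hT | hT
  · lift T to Finset γ using hT
    have hsub : S ⊆ (T.biUnion fun t => Fintype.piFinset (O t) : Finset (ι → β)) := by
      intro r hr
      obtain ⟨t, ht, hr⟩ := h r hr
      simp only [Finset.coe_biUnion, Set.mem_iUnion, Finset.mem_coe]
      exact ⟨t, by simpa using ht, by simpa using hr⟩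
    refine (Set.encard_le_encard hsub).trans ?_
    rw [Set.encard_coe_eq_coe_finsetCard, Set.encard_coe_eq_coe_finsetCard]
    norm_cast
    refine Finset.card_biUnion_le_card_mul _ _ _ fun t _ => ?_
    rw [Fintype.card_piFinset, Nat.card_eq_fintype_card, ← Finset.card_univ]
    exact Finset.prod_le_pow_card _ _ _ fun i _ => hO t i
  · rw [Set.Infinite.encard_eq hT, ENat.top_mul]
    · exact le_top
    · have : 0 < M ^ Nat.card ι := by positivity
      exact_mod_cast this.ne'

end Matrices

/-! ### Comparison of growth rates -/

/-- The factor `C ^ d` has logarithm `O(d)`, absorbed by `d log d` for large `d`; the factor `(d +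
1) ^ m` costs at most `2 η d log d` because `d + 1 ≤ d ^ 2`. -/
theorem eventually_log_pow_le (C k : ℕ) (hC : 1 ≤ C) {η ε : ℝ} (hη : 0 ≤ η)
    (h : 2 * k * η < ε) :
    ∀ᶠ d : ℕ in atTop, ∀ m : ℕ, (m : ℝ) ≤ η * d →
      Real.log (((C ^ d * (d + 1) ^ m) ^ k : ℕ) : ℝ) ≤ ε * (d * Real.log d) := by
  have htend : Tendsto (fun d : ℕ => (ε - 2 * k * η) * Real.log d) atTop atTop :=
    (Real.tendsto_log_atTop.comp tendsto_natCast_atTop_atTop).const_mul_atTop (by linarith)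
  filter_upwards [htend.eventually_ge_atTop (k * Real.log C), eventually_ge_atTop 2]
    with d hd hd2 m hm
  have hd2' : (2 : ℝ) ≤ d := by exact_mod_cast hd2
  have hlogd : 0 ≤ Real.log d := Real.log_nonneg (by linarith)
  have hlog : Real.log (d + 1) ≤ 2 * Real.log d := by
    rw [← Real.log_rpow (by linarith)]
    refine Real.log_le_log (by linarith) ?_
    norm_num
    nlinarith
  have hC' : (C : ℝ) ≠ 0 := by positivity
  push_cast
  rw [Real.log_pow, Real.log_mul (by positivity) (by positivity), Real.log_pow, Real.log_pow]
  have h1 : (m : ℝ) * Real.log (d + 1) ≤ η * d * (2 * Real.log d) := by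
    gcongr
    exact Real.log_nonneg (by linarith)
  have hk : (0 : ℝ) ≤ k := by positivity
  have hd0 : (0 : ℝ) ≤ d := by positivity
  calc (k : ℝ) * (d * Real.log C + m * Real.log (d + 1))
      ≤ k * (d * Real.log C + η * d * (2 * Real.log d)) := by gcongr
    _ = d * (k * Real.log C) + 2 * k * η * (d * Real.log d) := by ring
    _ ≤ d * ((ε - 2 * k * η) * Real.log d) + 2 * k * η * (d * Real.log d) := by gcongr
    _ = ε * (d * Real.log d) := by ring

theorem log_div_le_add {a b : ℝ≥0∞} {N : ℕ} (hN : 1 ≤ N) {x ε : ℝ} (hx : 0 < x)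
    (hab : a ≤ b * N) (hlog : Real.log N ≤ ε * x) :
    ENNReal.log a / (x : EReal) ≤ ENNReal.log b / (x : EReal) + (ε : EReal) := by
  have hx' : (0 : EReal) ≤ (x : EReal) := by exact_mod_cast hx.le
  have h1 : ENNReal.log a ≤ ENNReal.log b + ((Real.log N : ℝ) : EReal) := by
    refine (ENNReal.log_le_log hab).trans ?_
    rw [ENNReal.log_mul_add]
    gcongr
    rw [ENNReal.log_pos_real (by positivity) (by simp)]
    simp
  refine (EReal.div_le_div_right_of_nonneg hx' h1).trans ?_
  rw [EReal.add_div_of_nonneg_right hx']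
  gcongr
  rw [← EReal.coe_div, EReal.coe_le_coe_iff]
  rwa [div_le_iff₀ hx]

theorem limsup_le_limsup_add_coe {u v : ℕ → EReal} {ε : ℝ}
    (h : ∀ᶠ d in atTop, u d ≤ v d + (ε : EReal)) :
    limsup u atTop ≤ limsup v atTop + (ε : EReal) := by
  refine (limsup_le_limsup h).trans ?_
  refine (EReal.limsup_add_le (v := fun _ => (ε : EReal)) ?_ ?_).trans ?_
  · right; simp
  · right; simp
  · simp

theorem liminf_le_liminf_add_coe {u v : ℕ → EReal} {ε : ℝ}
    (h : ∀ᶠ d in atTop, u d ≤ v d + (ε : EReal)) :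
    liminf u atTop ≤ liminf v atTop + (ε : EReal) := by
  refine (liminf_le_liminf h).trans ?_
  have := EReal.liminf_add_le (u := fun _ => (ε : EReal)) (v := v) (f := atTop) ?_ ?_
  · simp only [limsup_const] at this
    rw [add_comm]
    refine le_trans (le_of_eq ?_) this
    congr 1
    ext d
    simp [add_comm]
  · left; simp
  · left; simp

/-- The functional `lim` stands for `limsup` or `liminf`. The order of choices matters: `E'` answers
`E` and `ε` alone, while `F`, `n`, `δ` may depend on everything chosen on the other side. -/
theorem iSup_iInf_le_of_le_add {α β : Type*} (P : α → Prop) (Q : β → Prop)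
    (lim : (ℕ → EReal) → EReal) (hlim : ∀ (u v : ℕ → EReal) (ε : ℝ),
      (∀ᶠ d in atTop, u d ≤ v d + (ε : EReal)) → lim u ≤ lim v + (ε : EReal))
    (f : α → α → ℕ → ℝ → ℕ → EReal) (g : β → β → ℕ → ℝ → ℕ → EReal)
    (h : ∀ E, P E → ∀ ε : ℝ, 0 < ε → ∃ E', Q E' ∧ ∀ F', Q F' → ∀ n', 1 ≤ n' → ∀ δ' : ℝ, 0 < δ' →
      ∃ F, P F ∧ ∃ n, 1 ≤ n ∧ ∃ δ : ℝ, 0 < δ ∧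
        ∀ᶠ d in atTop, f E F n δ d ≤ g E' F' n' δ' d + (ε : EReal)) :
    (⨆ (E : α) (_ : P E), ⨅ (F : α) (_ : P F), ⨅ (n : ℕ) (_ : 1 ≤ n), ⨅ (δ : ℝ) (_ : 0 < δ),
      lim (f E F n δ)) ≤
    ⨆ (E : β) (_ : Q E), ⨅ (F : β) (_ : Q F), ⨅ (n : ℕ) (_ : 1 ≤ n), ⨅ (δ : ℝ) (_ : 0 < δ),
      lim (g E F n δ) := by
  refine iSup₂_le fun E hE => ?_
  set R := ⨆ (E : β) (_ : Q E), ⨅ (F : β) (_ : Q F), ⨅ (n : ℕ) (_ : 1 ≤ n), ⨅ (δ : ℝ) (_ : 0 < δ),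
      lim (g E F n δ) with hR
  have main : ∀ ε : ℝ, 0 < ε → (⨅ (F : α) (_ : P F), ⨅ (n : ℕ) (_ : 1 ≤ n),
      ⨅ (δ : ℝ) (_ : 0 < δ), lim (f E F n δ)) ≤ R + (ε : EReal) := by
    intro ε hε
    obtain ⟨E', hE', hF⟩ := h E hE ε hε
    refine (EReal.sub_le_iff_le_add (by simp) (by simp)).1 ?_
    refine le_trans ?_ (le_iSup₂ (f := fun (E : β) (_ : Q E) => ⨅ (F : β) (_ : Q F),
      ⨅ (n : ℕ) (_ : 1 ≤ n), ⨅ (δ : ℝ) (_ : 0 < δ), lim (g E F n δ)) E' hE')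
    refine le_iInf₂ fun F' hF' => le_iInf₂ fun n' hn' => le_iInf₂ fun δ' hδ' => ?_
    obtain ⟨F, hF, n, hn, δ, hδ, hd⟩ := hF F' hF' n' hn' δ' hδ'
    refine EReal.sub_le_of_le_add ?_
    exact (iInf₂_le_of_le F hF (iInf₂_le_of_le n hn (iInf₂_le_of_le δ hδ le_rfl))).trans
      (hlim _ _ _ hd)
  -- The slack is removed by testing against reals `z > R` and taking `ε = z - y` with `y` a real
  -- between `R` and `z`, which avoids a case distinction on infinite `R`.
  refine EReal.le_of_forall_lt_iff_le.1 fun z hz => ?_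
  obtain ⟨y, hy1, hy2⟩ := EReal.lt_iff_exists_real_btwn.1 hz
  have hyz : y < z := by exact_mod_cast hy2
  refine (main (z - y) (by linarith)).trans ?_
  calc R + ((z - y : ℝ) : EReal) ≤ y + ((z - y : ℝ) : EReal) := by gcongr
    _ = z := by rw [← EReal.coe_add]; congr 1; ring

namespace PMPGroupoid

variable {A X A' X' : Type*} [MeasurableSpace A] [StandardBorelSpace A]
  [MeasurableSpace X] [StandardBorelSpace X] [MeasurableSpace A'] [StandardBorelSpace A']
  [MeasurableSpace X'] [StandardBorelSpace X']

theorem growth_le_add (𝒢 : PMPGroupoid A X) (ℋ : PMPGroupoid A' X') {E F : Set 𝒢.Op}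
    {E' F' : Set ℋ.Op} {n n' : ℕ} {δ δ' : ℝ} {C k : ℕ} (hC : 1 ≤ C) {η ε : ℝ} (hη : 0 ≤ η)
    (hε : 2 * k * η < ε)
    (h : ∀ᶠ d : ℕ in atTop, ∃ m : ℕ, (m : ℝ) ≤ η * d ∧ 𝒢.restrictCard E (𝒢.SA F n δ d) ≤
      ℋ.restrictCard E' (ℋ.SA F' n' δ' d) * ((C ^ d * (d + 1) ^ m) ^ k : ℕ)) :
    ∀ᶠ d in atTop, 𝒢.growth E F n δ d ≤ ℋ.growth E' F' n' δ' d + (ε : EReal) := by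
  filter_upwards [h, eventually_log_pow_le C k hC hη hε, eventually_ge_atTop 2]
    with d ⟨m, hm, hcard⟩ hlog hd
  have hd2 : (2 : ℝ) ≤ d := by exact_mod_cast hd
  refine log_div_le_add (N := (C ^ d * (d + 1) ^ m) ^ k) (Nat.one_le_pow _ _ (by positivity)) ?_ ?_
    (hlog m hm)
  · have := Real.log_pos (show (1 : ℝ) < d by linarith)
    positivity
  · exact_mod_cast hcard

/-- If every finite configuration in `𝒢` is dominated, up to arbitrarily small exponential loss,
by configurations in `ℋ`, then the sofic dimensions of `𝒢` are at most those of `ℋ`. -/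
theorem soficDim_le_of_growth_le (𝒢 : PMPGroupoid A X) (ℋ : PMPGroupoid A' X')
    (h : ∀ E : Set 𝒢.Op, (E.Finite ∧ E ⊆ 𝒢.partialIsometries) → ∀ ε : ℝ, 0 < ε →
      ∃ E' : Set ℋ.Op, (E'.Finite ∧ E' ⊆ ℋ.partialIsometries) ∧
        ∀ F' : Set ℋ.Op, (F'.Finite ∧ F' ⊆ ℋ.partialIsometries) → ∀ n' : ℕ, 1 ≤ n' →
          ∀ δ' : ℝ, 0 < δ' →
          ∃ F : Set 𝒢.Op, (F.Finite ∧ F ⊆ 𝒢.partialIsometries) ∧ ∃ n : ℕ, 1 ≤ n ∧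
            ∃ δ : ℝ, 0 < δ ∧
            ∀ᶠ d in atTop, 𝒢.growth E F n δ d ≤ ℋ.growth E' F' n' δ' d + (ε : EReal)) :
    𝒢.soficDim ≤ ℋ.soficDim ∧ 𝒢.lowerSoficDim ≤ ℋ.lowerSoficDim := by
  unfold soficDim lowerSoficDim soficDimOf lowerSoficDimOf
  exact ⟨iSup_iInf_le_of_le_add _ _ (fun u => limsup u atTop)
      (fun u v ε h => limsup_le_limsup_add_coe h) _ _ h,
    iSup_iInf_le_of_le_add _ _ (fun u => liminf u atTop)
      (fun u v ε h => liminf_le_liminf_add_coe h) _ _ h⟩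

end PMPGroupoid

namespace PMPGroupoid

variable {A X : Type*} [MeasurableSpace A] [StandardBorelSpace A]
  [MeasurableSpace X] [StandardBorelSpace X] (𝒢 : PMPGroupoid A X)

/-! ### Products of sets of arrows -/

theorem mul_inv_cancel_right {x y : A} (h : 𝒢.src x = 𝒢.rng y) :
    𝒢.mul (𝒢.mul x y) (𝒢.inv y) = x := by
  rw [𝒢.mul_assoc x y _ h (𝒢.rng_inv y).symm, 𝒢.mul_inv, ← h, 𝒢.mul_one]

theorem inv_mul_cancel_left {x y : A} (h : 𝒢.src x = 𝒢.rng y) :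
    𝒢.mul (𝒢.inv x) (𝒢.mul x y) = y := by
  rw [← 𝒢.mul_assoc _ x y (𝒢.src_inv x) h, 𝒢.inv_mul, h, 𝒢.one_mul]

theorem inv_inv (x : A) : 𝒢.inv (𝒢.inv x) = x := by
  have h := 𝒢.inv_mul_cancel_left (x := 𝒢.inv x) (y := x) (𝒢.src_inv x)
  rw [𝒢.inv_mul] at h
  have h2 := 𝒢.mul_one (𝒢.inv (𝒢.inv x))
  rw [𝒢.src_inv, 𝒢.rng_inv] at h2
  rw [← h2, h]

/-- The product of two sets of arrows. -/
def setMul (B C : Set A) : Set A :=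
  {z | ∃ b ∈ B, ∃ c ∈ C, 𝒢.src b = 𝒢.rng c ∧ 𝒢.mul b c = z}

/-- The set of inverses of a set of arrows. -/
def setInv (B : Set A) : Set A := 𝒢.inv ⁻¹' B

variable {𝒢}

/-- Multiplication is injective on composable pairs from `B × C`: the range of `b c` determines `b`,
hence `c`. An injective Borel image of a Borel set is Borel (Lusin–Souslin). -/
theorem measurableSet_setMul {B C : Set A} (hB : 𝒢.IsBisection B) (hC : MeasurableSet C) :
    MeasurableSet (𝒢.setMul B C) := by
  have hS : MeasurableSet {p : A × A | 𝒢.src p.1 = 𝒢.rng p.2} :=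
    measurableSet_eq_fun (𝒢.measurable_src.comp measurable_fst)
      (𝒢.measurable_rng.comp measurable_snd)
  have := hS.standardBorel
  have hmeas : MeasurableSet {p : {p : A × A | 𝒢.src p.1 = 𝒢.rng p.2} |
      p.1.1 ∈ B ∧ p.1.2 ∈ C} :=
    ((measurable_fst.comp measurable_subtype_coe) hB.1).inter
      ((measurable_snd.comp measurable_subtype_coe) hC)
  have himg := hmeas.image_of_measurable_injOn 𝒢.measurable_mul ?_
  · convert himg using 1
    ext z
    constructor
    · rintro ⟨b, hb, c, hc, h, rfl⟩
      exact ⟨⟨(b, c), h⟩, ⟨hb, hc⟩, rfl⟩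
    · rintro ⟨⟨⟨b, c⟩, h⟩, ⟨hb, hc⟩, rfl⟩
      exact ⟨b, hb, c, hc, h, rfl⟩
  · rintro ⟨⟨b, c⟩, h⟩ ⟨hb, hc⟩ ⟨⟨b', c'⟩, h'⟩ ⟨hb', hc'⟩ heq
    change 𝒢.src b = 𝒢.rng c at h
    change 𝒢.src b' = 𝒢.rng c' at h'
    dsimp only at heq hb hb' hc hc'
    have h1 : b = b' := hB.2.2 hb hb' (by
      rw [← 𝒢.rng_mul b c h, heq, 𝒢.rng_mul b' c' h'])
    subst h1
    have h2 : c = c' := by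
      rw [← 𝒢.inv_mul_cancel_left h, heq, 𝒢.inv_mul_cancel_left h']
    subst h2
    rfl

/-- Left multiplication preserves sources, and an arrow `c` can be multiplied by at most one element
of `B`; so each source fibre of `B C` is the image of one of `C`. -/
theorem vol_setMul_le {B C : Set A} (hB : 𝒢.IsBisection B) (hC : MeasurableSet C) :
    𝒢.vol (𝒢.setMul B C) ≤ 𝒢.vol C := by
  classical
  rw [𝒢.vol_eq_src _ (measurableSet_setMul hB hC), 𝒢.vol_eq_src _ hC]
  refine lintegral_mono fun x => ?_
  let f : A → A := fun c => if h : ∃ b ∈ B, 𝒢.src b = 𝒢.rng c then 𝒢.mul h.choose c else c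
  have hsub : 𝒢.src ⁻¹' {x} ∩ 𝒢.setMul B C ⊆ f '' (𝒢.src ⁻¹' {x} ∩ C) := by
    rintro _ ⟨hx, b, hb, c, hc, h, rfl⟩
    refine ⟨c, ⟨?_, hc⟩, ?_⟩
    · rw [Set.mem_preimage, 𝒢.src_mul b c h] at hx
      exact hx
    · have hex : ∃ b ∈ B, 𝒢.src b = 𝒢.rng c := ⟨b, hb, h⟩
      have := hB.2.1 hex.choose_spec.1 hb (hex.choose_spec.2.trans h.symm)
      simp only [f, dif_pos hex, this]
  exact ENat.toENNReal_le.2 ((Set.encard_le_encard hsub).trans (Set.encard_image_le _ _))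

theorem setInv_isBisection {B : Set A} (hB : 𝒢.IsBisection B) :
    𝒢.IsBisection (𝒢.setInv B) := by
  refine ⟨𝒢.measurable_inv hB.1, fun x hx y hy h => ?_, fun x hx y hy h => ?_⟩
  · have := hB.2.2 hx hy (by rw [𝒢.rng_inv, 𝒢.rng_inv, h])
    rw [← 𝒢.inv_inv x, this, 𝒢.inv_inv]
  · have := hB.2.1 hx hy (by rw [𝒢.src_inv, 𝒢.src_inv, h])
    rw [← 𝒢.inv_inv x, this, 𝒢.inv_inv]

theorem setMul_isBisection {B C : Set A} (hB : 𝒢.IsBisection B) (hC : 𝒢.IsBisection C) :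
    𝒢.IsBisection (𝒢.setMul B C) := by
  refine ⟨measurableSet_setMul hB hC.1, ?_, ?_⟩
  · rintro _ ⟨b, hb, c, hc, h, rfl⟩ _ ⟨b', hb', c', hc', h', rfl⟩ heq
    rw [𝒢.src_mul _ _ h, 𝒢.src_mul _ _ h'] at heq
    obtain rfl := hC.2.1 hc hc' heq
    obtain rfl := hB.2.1 hb hb' (h.trans h'.symm)
    rfl
  · rintro _ ⟨b, hb, c, hc, h, rfl⟩ _ ⟨b', hb', c', hc', h', rfl⟩ heq
    rw [𝒢.rng_mul _ _ h, 𝒢.rng_mul _ _ h'] at heq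
    obtain rfl := hB.2.2 hb hb' heq
    obtain rfl := hC.2.2 hc hc' (h.symm.trans h')
    rfl

theorem units_isBisection : 𝒢.IsBisection 𝒢.units := by
  refine ⟨𝒢.measurableSet_units, ?_, ?_⟩
  · rintro _ ⟨x, rfl⟩ _ ⟨y, rfl⟩ h
    rw [𝒢.src_one, 𝒢.src_one] at h
    rw [h]
  · rintro _ ⟨x, rfl⟩ _ ⟨y, rfl⟩ h
    rw [𝒢.rng_one, 𝒢.rng_one] at h
    rw [h]

theorem setMul_units (B : Set A) : 𝒢.setMul B 𝒢.units = B := by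
  ext z
  constructor
  · rintro ⟨b, hb, _, ⟨x, rfl⟩, h, rfl⟩
    rw [𝒢.rng_one] at h
    rwa [← h, 𝒢.mul_one]
  · intro hz
    exact ⟨z, hz, _, ⟨𝒢.src z, rfl⟩, (𝒢.rng_one _).symm, 𝒢.mul_one z⟩

theorem setMul_inter_setInv {B C D : Set A} (hB : 𝒢.IsBisection B) :
    𝒢.setMul B (D ∩ 𝒢.setMul (𝒢.setInv B) C) = 𝒢.setMul B D ∩ C := by
  ext z
  constructor
  · rintro ⟨b, hb, d, ⟨hd, b', hb', c, hc, h', rfl⟩, h, rfl⟩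
    refine ⟨⟨b, hb, _, hd, h, rfl⟩, ?_⟩
    have : 𝒢.inv b' = b := hB.2.1 hb' hb (by rw [h, 𝒢.rng_mul _ _ h', 𝒢.src_inv])
    rw [← this, 𝒢.inv_mul_cancel_left h']
    exact hc
  · rintro ⟨⟨b, hb, d, hd, h, rfl⟩, hc⟩
    have h1 : 𝒢.src (𝒢.inv b) = 𝒢.rng (𝒢.mul b d) := by rw [𝒢.src_inv, 𝒢.rng_mul _ _ h]
    exact ⟨b, hb, d, ⟨hd, 𝒢.inv b, by rwa [setInv, Set.mem_preimage, 𝒢.inv_inv], _, hc, h1,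
      𝒢.inv_mul_cancel_left h⟩, h, rfl⟩

theorem setMul_setInv_inter {B C D : Set A} (hB : 𝒢.IsBisection B) :
    𝒢.setMul (𝒢.setInv B) (𝒢.setMul B D ∩ C) = D ∩ 𝒢.setMul (𝒢.setInv B) C := by
  have := setMul_inter_setInv (C := D) (D := C) (setInv_isBisection hB)
  have h2 : 𝒢.setInv (𝒢.setInv B) = B := by
    ext x
    simp [setInv, 𝒢.inv_inv]
  rw [h2] at this
  rw [Set.inter_comm, this, Set.inter_comm]

/-- This is `⟨s_B 1_D, 1_C⟩ = ⟨1_D, s_{B⁻¹} 1_C⟩` in terms of sets. Each inequality is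
`vol_setMul_le`, applied to `B` or to `B⁻¹`, since these carry the two intersections onto each
other. -/
theorem vol_setMul_inter {B C D : Set A} (hB : 𝒢.IsBisection B) (hC : MeasurableSet C)
    (hD : MeasurableSet D) :
    𝒢.vol (𝒢.setMul B D ∩ C) = 𝒢.vol (D ∩ 𝒢.setMul (𝒢.setInv B) C) := by
  have hB' := setInv_isBisection hB
  refine le_antisymm ?_ ?_
  · rw [← setMul_inter_setInv hB]
    exact vol_setMul_le hB (hD.inter (measurableSet_setMul hB' hC))
  · rw [← setMul_setInv_inter hB]
    exact vol_setMul_le hB' ((measurableSet_setMul hB hD).inter hC)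

theorem vol_le_one {B : Set A} (hB : 𝒢.IsBisection B) : 𝒢.vol B ≤ 1 := by
  rw [← setMul_units (𝒢 := 𝒢) B]
  exact (vol_setMul_le hB 𝒢.measurableSet_units).trans 𝒢.vol_units.le

/-- Left multiplication by a bisection sends null sets to null sets, by `vol_setMul_le`. -/
theorem ae_of_setMul {B : Set A} (hB : 𝒢.IsBisection B) {P : A → Prop}
    (h : ∀ᵐ z ∂𝒢.vol, P z) :
    ∀ᵐ x ∂𝒢.vol, ∀ b ∈ B, ∀ z, 𝒢.src b = 𝒢.rng z → 𝒢.mul b z = x → P z := by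
  have h0 : 𝒢.vol (𝒢.setMul B (toMeasurable 𝒢.vol {z | ¬ P z})) = 0 := by
    refine le_antisymm ((vol_setMul_le hB (measurableSet_toMeasurable _ _)).trans ?_) zero_le
    rw [measure_toMeasurable]
    exact h.le
  refine measure_mono_null (fun x hx => ?_) h0
  simp only [Set.mem_compl_iff, Set.mem_ofPred_eq] at hx
  push Not at hx
  obtain ⟨b, hb, z, h1, h2, hz⟩ := hx
  exact ⟨b, hb, z, subset_toMeasurable _ _ hz, h1, h2⟩

/-! ### The operators of bisections -/

/-- Substituting `b = x y` and `z = y⁻¹` writes `x = b z`, so the definition reads `(T ξ)(b z) = ξ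
z`. This form composes well. -/
theorem isPartialIsometryOf_iff {B : Set A} {T : 𝒢.Op} :
    𝒢.IsPartialIsometryOf B T ↔ ∀ ξ : 𝒢.L2, ∀ᵐ x ∂𝒢.vol,
      (∀ b ∈ B, ∀ z, 𝒢.src b = 𝒢.rng z → 𝒢.mul b z = x → T ξ x = ξ z) ∧
      (x ∉ 𝒢.setMul B Set.univ → T ξ x = 0) := by
  have e1 : ∀ x y : A, 𝒢.rng y = 𝒢.src x → 𝒢.mul x y ∈ B →
      𝒢.src (𝒢.mul x y) = 𝒢.rng (𝒢.inv y) ∧ 𝒢.mul (𝒢.mul x y) (𝒢.inv y) = x :=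
    fun x y h _ => ⟨by rw [𝒢.src_mul _ _ h.symm, 𝒢.rng_inv], 𝒢.mul_inv_cancel_right h.symm⟩
  have e2 : ∀ b z : A, 𝒢.src b = 𝒢.rng z → 𝒢.rng (𝒢.inv z) = 𝒢.src (𝒢.mul b z) ∧
      𝒢.mul (𝒢.mul b z) (𝒢.inv z) = b :=
    fun b z h => ⟨by rw [𝒢.rng_inv, 𝒢.src_mul _ _ h], 𝒢.mul_inv_cancel_right h⟩
  refine forall_congr' fun ξ => eventually_congr (Eventually.of_forall fun x => and_congr ?_ ?_)
  · constructor
    · rintro h b hb z hz rfl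
      have := h (𝒢.inv z) (e2 b z hz).1 (by rwa [(e2 b z hz).2])
      rwa [𝒢.inv_inv] at this
    · intro h y hy hB
      exact h _ hB _ (e1 x y hy hB).1 (e1 x y hy hB).2
  · refine imp_congr (not_congr ?_) Iff.rfl
    constructor
    · rintro ⟨y, hy, hB⟩
      exact ⟨_, hB, _, trivial, (e1 x y hy hB).1, (e1 x y hy hB).2⟩
    · rintro ⟨b, hb, z, -, hz, rfl⟩
      exact ⟨𝒢.inv z, (e2 b z hz).1, by rwa [(e2 b z hz).2]⟩

theorem IsPartialIsometryOf.unique {B : Set A} {T T' : 𝒢.Op} (h : 𝒢.IsPartialIsometryOf B T)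
    (h' : 𝒢.IsPartialIsometryOf B T') : T = T' := by
  rw [isPartialIsometryOf_iff] at h h'
  ext1 ξ
  apply Lp.ext
  filter_upwards [h ξ, h' ξ] with x hx hx'
  by_cases hxB : x ∈ 𝒢.setMul B Set.univ
  · obtain ⟨b, hb, z, -, h1, h2⟩ := hxB
    rw [hx.1 b hb z h1 h2, hx'.1 b hb z h1 h2]
  · rw [hx.2 hxB, hx'.2 hxB]

theorem IsPartialIsometryOf.mul {B C : Set A} {T S : 𝒢.Op} (hB : 𝒢.IsBisection B)
    (hT : 𝒢.IsPartialIsometryOf B T) (hS : 𝒢.IsPartialIsometryOf C S) :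
    𝒢.IsPartialIsometryOf (𝒢.setMul B C) (T * S) := by
  rw [isPartialIsometryOf_iff] at *
  intro ξ
  filter_upwards [hT (S ξ), ae_of_setMul hB (hS ξ)] with x hx hz
  constructor
  · rintro _ ⟨b, hb, c, hc, h, rfl⟩ w h' hw
    rw [𝒢.src_mul _ _ h] at h'
    have h1 : 𝒢.src b = 𝒢.rng (𝒢.mul c w) := by rw [𝒢.rng_mul _ _ h', h]
    have h2 : 𝒢.mul b (𝒢.mul c w) = x := by rw [← 𝒢.mul_assoc _ _ _ h h', hw]
    rw [mul_apply_eq_comp, hx.1 b hb _ h1 h2]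
    exact (hz b hb _ h1 h2).1 c hc w h' rfl
  · intro hxBC
    rw [mul_apply_eq_comp]
    by_cases hxB : x ∈ 𝒢.setMul B Set.univ
    · obtain ⟨b, hb, z, -, h1, h2⟩ := hxB
      rw [hx.1 b hb z h1 h2]
      refine (hz b hb z h1 h2).2 ?_
      rintro ⟨c, hc, w, -, h3, rfl⟩
      rw [𝒢.rng_mul _ _ h3] at h1
      refine hxBC ⟨𝒢.mul b c, ⟨b, hb, c, hc, h1, rfl⟩, w, trivial, ?_, ?_⟩
      · rw [𝒢.src_mul _ _ h1, h3]
      · rw [𝒢.mul_assoc _ _ _ h1 h3, h2]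
    · exact hx.2 hxB

variable (𝒢) in
/-- The vector `ξ` is the characteristic function of the set `C`. -/
def IsIndicator (C : Set A) (ξ : 𝒢.L2) : Prop :=
  ξ =ᵐ[𝒢.vol] C.indicator fun _ => (1 : ℂ)

theorem isIndicator_indicatorConstLp {C : Set A} (hC : MeasurableSet C) (h : 𝒢.vol C ≠ ∞) :
    𝒢.IsIndicator C (indicatorConstLp 2 hC h (1 : ℂ)) :=
  indicatorConstLp_coeFn

theorem isIndicator_unitVector : 𝒢.IsIndicator 𝒢.units 𝒢.unitVector :=
  indicatorConstLp_coeFn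

theorem IsIndicator.eq {C : Set A} {ξ : 𝒢.L2} (hξ : 𝒢.IsIndicator C ξ) (hC : MeasurableSet C)
    (h : 𝒢.vol C ≠ ∞) : ξ = indicatorConstLp 2 hC h (1 : ℂ) :=
  Lp.ext (hξ.trans indicatorConstLp_coeFn.symm)

theorem IsIndicator.inner {C D : Set A} {ξ ζ : 𝒢.L2} (hξ : 𝒢.IsIndicator C ξ)
    (hζ : 𝒢.IsIndicator D ζ) (hC : MeasurableSet C) (hD : MeasurableSet D) (h : 𝒢.vol C ≠ ∞)
    (h' : 𝒢.vol D ≠ ∞) : inner ℂ ξ ζ = ((𝒢.vol.real (C ∩ D) : ℝ) : ℂ) := by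
  rw [hξ.eq hC h, hζ.eq hD h']
  exact L2.inner_indicatorConstLp_one_indicatorConstLp_one hC hD h h'

theorem IsPartialIsometryOf.isIndicator {B C : Set A} {T : 𝒢.Op} (hB : 𝒢.IsBisection B)
    (hT : 𝒢.IsPartialIsometryOf B T) {ξ : 𝒢.L2} (hξ : 𝒢.IsIndicator C ξ) :
    𝒢.IsIndicator (𝒢.setMul B C) (T ξ) := by
  classical
  rw [isPartialIsometryOf_iff] at hT
  filter_upwards [hT ξ, ae_of_setMul hB hξ] with x hx hz
  by_cases hxB : x ∈ 𝒢.setMul B Set.univ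
  · obtain ⟨b, hb, z, -, h1, h2⟩ := hxB
    rw [hx.1 b hb z h1 h2, hz b hb z h1 h2, Set.indicator_apply, Set.indicator_apply]
    congr 1
    refine propext ⟨fun hzC => ⟨b, hb, z, hzC, h1, h2⟩, ?_⟩
    rintro ⟨b', hb', c, hc, h, h'⟩
    obtain rfl := hB.2.2 hb hb' (by
      rw [← 𝒢.rng_mul _ _ h1, h2, ← h', 𝒢.rng_mul _ _ h])
    rwa [← 𝒢.inv_mul_cancel_left h1, h2, ← h', 𝒢.inv_mul_cancel_left h]
  · rw [hx.2 hxB, Set.indicator_of_notMem]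
    rintro ⟨b, hb, c, -, h⟩
    exact hxB ⟨b, hb, c, trivial, h⟩

/-- The adjoint need not be identified on all of `L²`: words are only ever applied to the unit
vector, so characteristic functions suffice. The two sides have equal integrals over every set `D`
of finite measure, by `vol_setMul_inter`. -/
theorem IsPartialIsometryOf.isIndicator_adjoint {B C : Set A} {T : 𝒢.Op}
    (hB : 𝒢.IsBisection B) (hT : 𝒢.IsPartialIsometryOf B T) {ξ : 𝒢.L2}
    (hξ : 𝒢.IsIndicator C ξ) (hC : MeasurableSet C) (hfin : 𝒢.vol C ≠ ∞) :
    𝒢.IsIndicator (𝒢.setMul (𝒢.setInv B) C) (ContinuousLinearMap.adjoint T ξ) := by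
  have hB' := setInv_isBisection hB
  have hE := measurableSet_setMul hB' hC
  have hEfin : 𝒢.vol (𝒢.setMul (𝒢.setInv B) C) ≠ ∞ :=
    ((vol_setMul_le hB' hC).trans_lt hfin.lt_top).ne
  refine EventuallyEq.trans ?_ (isIndicator_indicatorConstLp hE hEfin)
  refine Lp.ae_eq_of_forall_setIntegral_eq _ _ (by simp) (by simp)
    (fun s _ hs => integrableOn_Lp_of_measure_ne_top _ (by simp) hs.ne)
    (fun s _ hs => integrableOn_Lp_of_measure_ne_top _ (by simp) hs.ne) fun D hD hDfin => ?_
  rw [← L2.inner_indicatorConstLp_one hD hDfin.ne, ← L2.inner_indicatorConstLp_one hD hDfin.ne,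
    ContinuousLinearMap.adjoint_inner_right]
  have hD' := isIndicator_indicatorConstLp hD hDfin.ne
  have hBD : 𝒢.vol (𝒢.setMul B D) ≠ ∞ := ((vol_setMul_le hB hD).trans_lt hDfin).ne
  rw [(hT.isIndicator hB hD').inner hξ (measurableSet_setMul hB hD) hC hBD hfin,
    hD'.inner (isIndicator_indicatorConstLp hE hEfin) hD hE hDfin.ne hEfin]
  simp only [Measure.real, vol_setMul_inter hB hC hD]

theorem trace_eq {C : Set A} {T : 𝒢.Op} (hC : 𝒢.IsBisection C)
    (hT : 𝒢.IsIndicator C (T 𝒢.unitVector)) :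
    𝒢.trace T = ((𝒢.vol.real (𝒢.units ∩ C) : ℝ) : ℂ) :=
  isIndicator_unitVector.inner hT 𝒢.measurableSet_units hC.1 (by simp [𝒢.vol_units])
    ((vol_le_one hC).trans_lt ENNReal.one_lt_top).ne

theorem IsPartialIsometryOf.isIndicator_unitVector {B : Set A} {T : 𝒢.Op}
    (hB : 𝒢.IsBisection B) (hT : 𝒢.IsPartialIsometryOf B T) :
    𝒢.IsIndicator B (T 𝒢.unitVector) := by
  have := hT.isIndicator hB PMPGroupoid.isIndicator_unitVector
  rwa [setMul_units] at this

/-- Every element of `F ∪ F*` acts on characteristic functions through a bisection. -/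
theorem exists_bisection_action {F : Set 𝒢.Op} (hF : F ⊆ 𝒢.partialIsometries) {T : 𝒢.Op}
    (hT : T ∈ F ∪ ContinuousLinearMap.adjoint '' F) :
    ∃ B, 𝒢.IsBisection B ∧ ∀ C ξ, 𝒢.IsBisection C → 𝒢.IsIndicator C ξ →
      𝒢.IsIndicator (𝒢.setMul B C) (T ξ) := by
  rcases hT with hT | ⟨S, hS, rfl⟩
  · obtain ⟨B, hB, h⟩ := hF hT
    exact ⟨B, hB, fun C ξ _ hξ => h.isIndicator hB hξ⟩
  · obtain ⟨B, hB, h⟩ := hF hS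
    exact ⟨_, setInv_isBisection hB, fun C ξ hC hξ => h.isIndicator_adjoint hB hξ hC.1
      ((vol_le_one hC).trans_lt ENNReal.one_lt_top).ne⟩

theorem zero_mem_partialIsometries : (0 : 𝒢.Op) ∈ 𝒢.partialIsometries := by
  refine ⟨∅, ⟨MeasurableSet.empty, by simp, by simp⟩, ?_⟩
  rw [isPartialIsometryOf_iff]
  intro ξ
  filter_upwards [Lp.coeFn_zero ℂ 2 𝒢.vol] with x hx
  exact ⟨fun b hb => hb.elim, fun _ => by simpa using hx⟩

theorem IsPartialIsometryOf.eq_zero {T : 𝒢.Op} (h : 𝒢.IsPartialIsometryOf ∅ T) : T = 0 := by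
  refine h.unique ?_
  rw [isPartialIsometryOf_iff]
  intro ξ
  filter_upwards [Lp.coeFn_zero ℂ 2 𝒢.vol] with x hx
  exact ⟨fun b hb => hb.elim, fun _ => by simpa using hx⟩

/-! ### Operators of measure preserving maps and of sets of units -/

/-- Here every arrow factors as `x = b (θ x)` with `b ∈ B`, so `s_B` is the composition operator of
`θ`, an isometry of `L²`. -/
theorem exists_isPartialIsometryOf_of_measurePreserving {B : Set A} (θ : A → A)
    (hθ : MeasurePreserving θ 𝒢.vol 𝒢.vol)
    (h : ∀ x, ∃ b ∈ B, 𝒢.src b = 𝒢.rng (θ x) ∧ 𝒢.mul b (θ x) = x) (hB : 𝒢.IsBisection B) :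
    ∃ T : 𝒢.Op, 𝒢.IsPartialIsometryOf B T ∧ ∀ ξ, ‖T ξ‖ = ‖ξ‖ := by
  refine ⟨(Lp.compMeasurePreservingₗᵢ ℂ θ hθ).toContinuousLinearMap, ?_,
    fun ξ => (Lp.compMeasurePreservingₗᵢ ℂ θ hθ).norm_map ξ⟩
  rw [isPartialIsometryOf_iff]
  intro ξ
  filter_upwards [Lp.coeFn_compMeasurePreserving ξ hθ] with x hx
  obtain ⟨b, hb, h1, h2⟩ := h x
  refine ⟨fun b' hb' z hz hx' => hx.trans ?_, fun hxB => ?_⟩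
  · obtain rfl := hB.2.2 hb hb' (by
      rw [← 𝒢.rng_mul _ _ h1, h2, ← hx', 𝒢.rng_mul _ _ hz])
    have : θ x = z := by
      rw [← 𝒢.inv_mul_cancel_left h1, h2, ← hx', 𝒢.inv_mul_cancel_left hz]
    rw [Function.comp_apply, this]
  · exact (hxB ⟨b, hb, _, trivial, h1, h2⟩).elim

variable (𝒢)

/-- Multiplication by the characteristic function of `rng⁻¹(S)`. -/
def proj {S : Set X} (hS : MeasurableSet S) : 𝒢.Op :=
  (ContinuousLinearMap.mul ℂ ℂ).holderL 𝒢.vol ∞ 2 2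
    (((memLp_top_const (1 : ℂ)).indicator (𝒢.measurable_rng hS)).toLp)

open scoped Classical in
theorem proj_apply {S : Set X} (hS : MeasurableSet S) (ξ : 𝒢.L2) :
    ∀ᵐ x ∂𝒢.vol, 𝒢.proj hS ξ x = if 𝒢.rng x ∈ S then ξ x else 0 := by
  have h1 := ContinuousLinearMap.coeFn_holder (r := 2) (ContinuousLinearMap.mul ℂ ℂ)
    (((memLp_top_const (1 : ℂ)).indicator (𝒢.measurable_rng hS)).toLp) ξ (μ := 𝒢.vol)
  have h2 := ((memLp_top_const (1 : ℂ)).indicator (𝒢.measurable_rng hS)).coeFn_toLp (μ := 𝒢.vol)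
  filter_upwards [h1, h2] with x hx hx2
  refine hx.trans ?_
  simp only [ContinuousLinearMap.mul_apply', hx2, Set.indicator_apply, Set.mem_preimage]
  split_ifs <;> simp

/-- The set of units in `S`. -/
def unitsOf (S : Set X) : Set A := 𝒢.one '' S

theorem unitsOf_isBisection {S : Set X} (hS : MeasurableSet S) :
    𝒢.IsBisection (𝒢.unitsOf S) := by
  have hinj : Function.Injective 𝒢.one := fun x y h => by
    rw [← 𝒢.src_one x, h, 𝒢.src_one]
  exact ⟨(𝒢.measurable_one.measurableEmbedding hinj).measurableSet_image.2 hS,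
    units_isBisection.2.1.mono (Set.image_subset_range _ _),
    units_isBisection.2.2.mono (Set.image_subset_range _ _)⟩

theorem proj_isPartialIsometryOf {S : Set X} (hS : MeasurableSet S) :
    𝒢.IsPartialIsometryOf (𝒢.unitsOf S) (𝒢.proj hS) := by
  rw [isPartialIsometryOf_iff]
  intro ξ
  filter_upwards [𝒢.proj_apply hS ξ] with x hx
  constructor
  · rintro _ ⟨s, hs, rfl⟩ z hz rfl
    rw [𝒢.src_one] at hz
    subst hz
    rw [𝒢.one_mul] at hx ⊢
    rw [hx, if_pos hs]
  · intro h
    rw [hx, if_neg]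
    exact fun hS => h ⟨_, ⟨_, hS, rfl⟩, x, trivial, 𝒢.src_one _, 𝒢.one_mul x⟩

theorem proj_add {S S' S'' : Set X} (hS : MeasurableSet S) (hS' : MeasurableSet S')
    (hS'' : MeasurableSet S'') (h : S'' = S ∪ S') (hd : Disjoint S S') :
    𝒢.proj hS'' = 𝒢.proj hS + 𝒢.proj hS' := by
  classical
  ext1 ξ
  apply Lp.ext
  rw [add_apply]
  filter_upwards [𝒢.proj_apply hS ξ, 𝒢.proj_apply hS' ξ, 𝒢.proj_apply hS'' ξ,
    Lp.coeFn_add (𝒢.proj hS ξ) (𝒢.proj hS' ξ)] with x h1 h2 h3 h4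
  rw [h4, Pi.add_apply, h1, h2, h3, h]
  by_cases hx : 𝒢.rng x ∈ S
  · simp [hx, Set.disjoint_left.1 hd hx]
  · simp [hx]

theorem proj_mem {S : Set X} (hS : MeasurableSet S) : 𝒢.proj hS ∈ 𝒢.partialIsometries :=
  ⟨_, 𝒢.unitsOf_isBisection hS, 𝒢.proj_isPartialIsometryOf hS⟩

theorem vol_unitsOf {S : Set X} (hS : MeasurableSet S) :
    𝒢.vol (𝒢.unitsOf S) = 𝒢.unitMeasure S := by
  classical
  rw [𝒢.vol_eq_src _ (𝒢.unitsOf_isBisection hS).1, ← lintegral_indicator_one hS]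
  refine lintegral_congr fun x => ?_
  rw [Set.indicator_apply]
  split_ifs with h
  · have : 𝒢.src ⁻¹' {x} ∩ 𝒢.unitsOf S = {𝒢.one x} := by
      ext a
      constructor
      · rintro ⟨h, y, hy, rfl⟩
        simp only [Set.mem_preimage, 𝒢.src_one, Set.mem_singleton_iff] at h
        simp [h]
      · rintro rfl
        exact ⟨by simp [𝒢.src_one], x, h, rfl⟩
    simp [this]
  · have : 𝒢.src ⁻¹' {x} ∩ 𝒢.unitsOf S = ∅ := by
      ext a
      simp only [Set.mem_inter_iff, Set.mem_empty_iff_false, iff_false, not_and]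
      rintro ha ⟨y, hy, rfl⟩
      simp only [Set.mem_preimage, 𝒢.src_one, Set.mem_singleton_iff] at ha
      exact h (ha ▸ hy)
    simp [this]

theorem trace_proj {S : Set X} (hS : MeasurableSet S) :
    𝒢.trace (𝒢.proj hS) = ((𝒢.unitMeasure.real S : ℝ) : ℂ) := by
  rw [trace_eq (𝒢.unitsOf_isBisection hS)
    ((𝒢.proj_isPartialIsometryOf hS).isIndicator_unitVector (𝒢.unitsOf_isBisection hS)),
    Measure.real, Measure.real,
    Set.inter_eq_right.2 (show 𝒢.unitsOf S ⊆ 𝒢.units from Set.image_subset_range _ _),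
    𝒢.vol_unitsOf hS]

end PMPGroupoid

/-! ### Unitary translations from a group of bisections -/

namespace PMPGroupoid

variable {A X : Type*} [MeasurableSpace A] [StandardBorelSpace A]
  [MeasurableSpace X] [StandardBorelSpace X] {𝒢 : PMPGroupoid A X}

theorem one_isPartialIsometryOf : 𝒢.IsPartialIsometryOf 𝒢.units 1 := by
  rw [isPartialIsometryOf_iff]
  refine fun ξ => Eventually.of_forall fun x => ⟨?_, fun h => ?_⟩
  · rintro _ ⟨s, rfl⟩ z hz rfl
    rw [𝒢.src_one] at hz
    subst hz
    rw [𝒢.one_mul]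
    rfl
  · exact (h ⟨_, ⟨𝒢.rng x, rfl⟩, x, trivial, 𝒢.src_one _, 𝒢.one_mul x⟩).elim

/-- Multiplicativity follows from uniqueness of the operator of a bisection. An isometry with a
right inverse is unitary, so its adjoint is that inverse. -/
theorem exists_translations {G : Type*} [Group G] (U : G → Set A)
    (hU : ∀ g, 𝒢.IsBisection (U g)) (h1 : U 1 = 𝒢.units)
    (hmul : ∀ g h, 𝒢.setMul (U g) (U h) = U (g * h))
    (hθ : ∀ g, ∃ θ : A → A, MeasurePreserving θ 𝒢.vol 𝒢.vol ∧
      ∀ x, ∃ b ∈ U g, 𝒢.src b = 𝒢.rng (θ x) ∧ 𝒢.mul b (θ x) = x) :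
    ∃ lam : G →* 𝒢.Op, ∀ g, 𝒢.IsPartialIsometryOf (U g) (lam g) ∧
      ContinuousLinearMap.adjoint (lam g) = lam g⁻¹ := by
  have hT : ∀ g, ∃ T : 𝒢.Op, 𝒢.IsPartialIsometryOf (U g) T ∧ ∀ ξ, ‖T ξ‖ = ‖ξ‖ := fun g => by
    obtain ⟨θ, hθ, h⟩ := hθ g
    exact exists_isPartialIsometryOf_of_measurePreserving θ hθ h (hU g)
  choose T hT hnorm using hT
  let lam : G →* 𝒢.Op :=
    { toFun := T
      map_one' := (hT 1).unique (h1 ▸ one_isPartialIsometryOf)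
      map_mul' := fun g h => (hT _).unique (hmul g h ▸ (hT g).mul (hU g) (hT h)) }
  refine ⟨lam, fun g => ⟨hT g, ?_⟩⟩
  have e1 : ContinuousLinearMap.adjoint (lam g) * lam g = 1 :=
    (ContinuousLinearMap.norm_map_iff_adjoint_comp_self (lam g)).1 (hnorm g)
  have e2 : lam g * lam g⁻¹ = 1 := by rw [← map_mul, mul_inv_cancel, map_one]
  calc ContinuousLinearMap.adjoint (lam g)
      = ContinuousLinearMap.adjoint (lam g) * (lam g * lam g⁻¹) := by rw [e2, _root_.mul_one]
    _ = lam g⁻¹ := by rw [← _root_.mul_assoc, e1, _root_.one_mul]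

end PMPGroupoid

open PMPGroupoid

/-! ### The operators of a group viewed as a groupoid -/

section GroupOps

variable (G : Type*) [Group G] [Countable G] [MeasurableSpace G] [DiscreteMeasurableSpace G]

theorem singleton_isBisection (g : G) : (groupGroupoid G).IsBisection {g} :=
  ⟨MeasurableSet.of_discrete, by simp, by simp⟩

theorem exists_group_translations : ∃ lam : G →* (groupGroupoid G).Op, ∀ g,
    (groupGroupoid G).IsPartialIsometryOf {g} (lam g) ∧
      ContinuousLinearMap.adjoint (lam g) = lam g⁻¹ := by
  refine exists_translations _ (singleton_isBisection G) ?_ ?_ ?_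
  · ext x
    exact ⟨fun h => ⟨(), h.symm⟩, fun ⟨_, h⟩ => h.symm⟩
  · intro g h
    ext x
    constructor
    · rintro ⟨_, rfl, _, rfl, -, rfl⟩
      rfl
    · rintro rfl
      exact ⟨_, rfl, _, rfl, rfl, rfl⟩
  · intro g
    exact ⟨fun x => g⁻¹ * x, measurePreserving_mul_left Measure.count g⁻¹,
      fun x => ⟨g, rfl, rfl, mul_inv_cancel_left g x⟩⟩

/-- The left translation operators on `ℓ²(G)`. -/
def groupTranslation : G →* (groupGroupoid G).Op := (exists_group_translations G).choose

variable {G}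

theorem groupTranslation_spec (g : G) :
    (groupGroupoid G).IsPartialIsometryOf {g} (groupTranslation G g) :=
  ((exists_group_translations G).choose_spec g).1

theorem adjoint_groupTranslation (g : G) :
    ContinuousLinearMap.adjoint (groupTranslation G g) = groupTranslation G g⁻¹ :=
  ((exists_group_translations G).choose_spec g).2

theorem groupTranslation_mem (g : G) :
    groupTranslation G g ∈ (groupGroupoid G).partialIsometries :=
  ⟨_, singleton_isBisection G g, groupTranslation_spec g⟩

/-- With a single unit the source map is constant, so a bisection has at most one element. -/
theorem eq_zero_or_groupTranslation {T : (groupGroupoid G).Op}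
    (hT : T ∈ (groupGroupoid G).partialIsometries) : T = 0 ∨ ∃ g, T = groupTranslation G g := by
  obtain ⟨B, hB, h⟩ := hT
  have hsub : B.Subsingleton := fun x hx y hy => hB.2.1 hx hy rfl
  rcases hsub.eq_empty_or_singleton with rfl | ⟨g, rfl⟩
  · exact Or.inl h.eq_zero
  · exact Or.inr ⟨g, h.unique (groupTranslation_spec g)⟩

open scoped Classical in
theorem vol_real_singleton_inter (g h : G) :
    (groupGroupoid G).vol.real ({g} ∩ {h}) = if g = h then 1 else 0 := by
  have : (groupGroupoid G).vol = Measure.count := rfl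
  rw [Measure.real, this]
  split_ifs with hgh
  · subst hgh
    simp
  · simp [Set.singleton_inter_eq_empty.2 (show g ∉ ({h} : Set G) from hgh)]

open scoped Classical in
theorem trace_groupTranslation (g : G) :
    (groupGroupoid G).trace (groupTranslation G g) = if g = 1 then 1 else 0 := by
  rw [trace_eq (singleton_isBisection G g)
    ((groupTranslation_spec g).isIndicator_unitVector (singleton_isBisection G g))]
  have : (groupGroupoid G).units = {1} := by
    ext x
    exact ⟨fun ⟨_, h⟩ => h.symm, fun h => ⟨(), h.symm⟩⟩
  rw [this, vol_real_singleton_inter]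
  simp only [eq_comm]
  split_ifs <;> simp

/-- Applied to the unit vector, the translations give the orthonormal point masses of `ℓ²(G)`.
Independence is what allows linear maps on `[I_G]` to be prescribed on translations. -/
theorem linearIndependent_groupTranslation :
    LinearIndependent ℂ fun g : G => (⟨groupTranslation G g,
      Submodule.subset_span (groupTranslation_mem g)⟩ : (groupGroupoid G).linSpan) := by
  classical
  let ev : (groupGroupoid G).linSpan →ₗ[ℂ] (groupGroupoid G).L2 :=
    (ContinuousLinearMap.apply ℂ _ (groupGroupoid G).unitVector).toLinearMap ∘ₗ
      (groupGroupoid G).linSpan.subtype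
  refine LinearIndependent.of_comp ev (Orthonormal.linearIndependent (𝕜 := ℂ) ?_)
  rw [orthonormal_iff_ite]
  intro g h
  have hfin : ∀ g : G, (groupGroupoid G).vol {g} ≠ ∞ := fun g =>
    ((vol_le_one (singleton_isBisection G g)).trans_lt ENNReal.one_lt_top).ne
  have := ((groupTranslation_spec g).isIndicator_unitVector (singleton_isBisection G g)).inner
    ((groupTranslation_spec h).isIndicator_unitVector (singleton_isBisection G h))
    (singleton_isBisection G g).1 (singleton_isBisection G h).1 (hfin g) (hfin h)
  refine this.trans ?_
  rw [vol_real_singleton_inter]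
  split_ifs <;> simp

theorem span_groupTranslation :
    ⊤ ≤ Submodule.span ℂ (Set.range fun g : G => (⟨groupTranslation G g,
      Submodule.subset_span (groupTranslation_mem g)⟩ : (groupGroupoid G).linSpan)) := by
  rintro ⟨a, ha⟩ -
  induction ha using Submodule.span_induction with
  | mem x hx =>
    rcases eq_zero_or_groupTranslation hx with rfl | ⟨g, rfl⟩
    · exact Submodule.zero_mem _
    · exact Submodule.subset_span ⟨g, rfl⟩
  | zero => exact Submodule.zero_mem _
  | add x y hx hy h1 h2 => exact Submodule.add_mem _ h1 h2
  | smul c x hx h1 => exact Submodule.smul_mem _ c h1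

end GroupOps

/-! ### The operators of an action groupoid -/

section ActionOps

/-- The set of arrows with a given group element. -/
def slice {G : Type*} (X : Type*) (g : G) : Set (G × X) := Prod.fst ⁻¹' {g}

theorem mem_slice {G X : Type*} {g k : G} {x : X} : (k, x) ∈ slice X g ↔ k = g := Iff.rfl

variable {G : Type*} [Group G] [Countable G] [MeasurableSpace G] [DiscreteMeasurableSpace G]
  {X : Type*} [MeasurableSpace X] [StandardBorelSpace X] [MulAction G X]
  [MeasurableConstSMul G X] {μ : Measure X} [IsProbabilityMeasure μ] [SMulInvariantMeasure G X μ]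

theorem mem_setMul_action {B C : Set (G × X)} {k : G} {x : X} :
    (k, x) ∈ (actionGroupoid G X μ).setMul B C ↔
      ∃ g h, g * h = k ∧ (h, x) ∈ C ∧ (g, h • x) ∈ B := by
  constructor
  · rintro ⟨⟨g, y⟩, hb, ⟨h, z⟩, hc, e, heq⟩
    simp only [actionGroupoid, Prod.mk.injEq] at e heq
    obtain ⟨rfl, rfl⟩ := heq
    exact ⟨g, h, rfl, hc, e ▸ hb⟩
  · rintro ⟨g, h, rfl, hc, hb⟩
    exact ⟨_, hb, _, hc, rfl, rfl⟩

theorem mem_units_action {k : G} {x : X} : (k, x) ∈ (actionGroupoid G X μ).units ↔ k = 1 := by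
  constructor
  · rintro ⟨y, hy⟩
    exact (congrArg Prod.fst hy).symm
  · rintro rfl
    exact ⟨x, rfl⟩

theorem mem_unitsOf_action {S : Set X} {k : G} {x : X} :
    (k, x) ∈ (actionGroupoid G X μ).unitsOf S ↔ k = 1 ∧ x ∈ S := by
  constructor
  · rintro ⟨y, hS, hy⟩
    obtain ⟨h1, h2⟩ := Prod.ext_iff.1 hy
    exact ⟨h1.symm, (show y = x from h2) ▸ hS⟩
  · rintro ⟨rfl, h⟩
    exact ⟨x, h, rfl⟩

theorem slice_isBisection (g : G) : (actionGroupoid G X μ).IsBisection (slice X g) := by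
  refine ⟨measurable_fst MeasurableSet.of_discrete, ?_, ?_⟩
  · rintro ⟨_, x⟩ rfl ⟨_, y⟩ h heq
    simp only [actionGroupoid] at heq
    obtain rfl := mem_slice.1 h
    rw [heq]
  · rintro ⟨_, x⟩ rfl ⟨k, y⟩ h heq
    obtain rfl : k = _ := h
    simp only [actionGroupoid, smul_left_cancel_iff] at heq
    rw [heq]

theorem slice_one : slice X (1 : G) = (actionGroupoid G X μ).units := by
  ext ⟨k, x⟩
  rw [mem_slice, mem_units_action]

variable (G X μ) in
theorem exists_action_translations : ∃ u : G →* (actionGroupoid G X μ).Op, ∀ g,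
    (actionGroupoid G X μ).IsPartialIsometryOf (slice X g) (u g) ∧
      ContinuousLinearMap.adjoint (u g) = u g⁻¹ := by
  refine exists_translations _ slice_isBisection slice_one ?_ ?_
  · intro g h
    ext ⟨k, x⟩
    simp only [mem_setMul_action, mem_slice]
    exact ⟨fun ⟨_, _, h1, h2, h3⟩ => by rw [← h1, h2, h3], fun h1 => ⟨g, h, h1.symm, rfl, rfl⟩⟩
  · intro g
    refine ⟨fun p => (g⁻¹ * p.1, p.2), ?_, ?_⟩
    · exact (measurePreserving_mul_left Measure.count g⁻¹).prod (MeasurePreserving.id μ)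
    · rintro ⟨k, x⟩
      refine ⟨(g, (g⁻¹ * k) • x), rfl, rfl, ?_⟩
      simp [actionGroupoid]

variable (G X μ) in
/-- The translation operators on `L²(G × X)`. -/
def actionTranslation : G →* (actionGroupoid G X μ).Op := (exists_action_translations G X μ).choose

theorem actionTranslation_spec (g : G) :
    (actionGroupoid G X μ).IsPartialIsometryOf (slice X g) (actionTranslation G X μ g) :=
  ((exists_action_translations G X μ).choose_spec g).1

theorem adjoint_actionTranslation (g : G) :
    ContinuousLinearMap.adjoint (actionTranslation G X μ g) = actionTranslation G X μ g⁻¹ :=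
  ((exists_action_translations G X μ).choose_spec g).2

theorem actionTranslation_mem (g : G) :
    actionTranslation G X μ g ∈ (actionGroupoid G X μ).partialIsometries :=
  ⟨_, slice_isBisection g, actionTranslation_spec g⟩

open scoped Classical in
theorem trace_actionTranslation (g : G) :
    (actionGroupoid G X μ).trace (actionTranslation G X μ g) = if g = 1 then 1 else 0 := by
  rw [trace_eq (slice_isBisection g)
    ((actionTranslation_spec g).isIndicator_unitVector (slice_isBisection g))]
  split_ifs with h
  · subst h
    rw [slice_one (μ := μ), Set.inter_self, Measure.real, vol_units]
    simp
  · have : (actionGroupoid G X μ).units ∩ slice X g = ∅ := by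
      ext ⟨k, x⟩
      simp only [Set.mem_inter_iff, mem_units_action, mem_slice, Set.mem_empty_iff_false,
        iff_false, not_and]
      rintro rfl rfl
      exact h rfl
    simp [this]

theorem vol_action {B : Set (G × X)} (hB : MeasurableSet B) :
    (actionGroupoid G X μ).vol B = ∑' g : G, μ {x | (g, x) ∈ B} := by
  change (Measure.count.prod μ) B = _
  rw [Measure.prod_apply hB, lintegral_count]
  rfl

/-- The linear map `[I_G] → [I_{G × X}]` which sends translations to translations. -/
theorem exists_linSpan_map : ∃ J : (groupGroupoid G).linSpan →ₗ[ℂ] (actionGroupoid G X μ).linSpan,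
    ∀ (g : G) (a : (groupGroupoid G).linSpan), (a : (groupGroupoid G).Op) = groupTranslation G g →
      (J a : (actionGroupoid G X μ).Op) = actionTranslation G X μ g := by
  let b := Module.Basis.mk (linearIndependent_groupTranslation (G := G)) span_groupTranslation
  refine ⟨b.constr ℂ fun g => ⟨actionTranslation G X μ g,
    Submodule.subset_span (actionTranslation_mem g)⟩, fun g a ha => ?_⟩
  have : a = b g := by
    rw [Module.Basis.mk_apply]
    exact Subtype.ext ha
  rw [this, Module.Basis.constr_basis]

end ActionOps

/-! ### Columns of `φ(s_B)` assembled from columns of `φ(u_g)` -/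

section Center

variable {d : ℕ}

/-- The matrix whose column `v` is the one of `m k` if `P v = some k` and zero otherwise. -/
def centerMatrix {κ : Type*} (m : κ → Matrix (Fin d) (Fin d) ℂ) (P : Fin d → Option κ) :
    Matrix (Fin d) (Fin d) ℂ :=
  fun i v => (P v).elim 0 fun k => m k i v

open scoped Classical in
-- In the application `a = φ(s_B)`, `m k = φ(u_k)`, `p k` models the sources with group element `k`,
-- `q` all sources and `r` the tail. At a good `v` fixed by some `p k`, the relation `a p_k = m_k
-- p_k` identifies column `v` of `a`. At a good `v` fixed by none, `q` kills `v`, so `a = a q` has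
-- zero column there.
theorem exists_colDist_centerMatrix_le {κ : Type*} [Fintype κ]
    {a q r : Matrix (Fin d) (Fin d) ℂ} {m p : κ → Matrix (Fin d) (Fin d) ℂ}
    (hp : ∀ k, p k ∈ partialPermMatrices d) (hq : q ∈ partialPermMatrices d)
    (hsum : q = ∑ k, p k + r) :
    ∃ P : Fin d → Option κ, colDist a (centerMatrix m P) ≤
      ∑ k, colDist (a * p k) (m k * p k) + colDist a (a * q) + colDist q (q * q) +
        (Finset.univ.filter fun v => r v v ≠ 0).card := by
  have mul_col : ∀ (b c : Matrix (Fin d) (Fin d) ℂ) (v w : Fin d),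
      (∀ i, c i v = if w = i then 1 else 0) → ∀ i, (b * c) i v = b i w := by
    intro b c v w h i
    simp [Matrix.mul_apply, h]
  let P : Fin d → Option κ := fun v => if h : ∃ k, p k v v ≠ 0 then some h.choose else none
  refine ⟨P, ?_⟩
  let bad : Finset (Fin d) :=
    ((Finset.univ.biUnion fun k => Finset.univ.filter fun v =>
      (a * p k).transpose v ≠ (m k * p k).transpose v) ∪
      (Finset.univ.filter fun v => a.transpose v ≠ (a * q).transpose v) ∪
      (Finset.univ.filter fun v => q.transpose v ≠ (q * q).transpose v)) ∪
      (Finset.univ.filter fun v => r v v ≠ 0)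
  have hbad : bad.card ≤ ∑ k, colDist (a * p k) (m k * p k) + colDist a (a * q) +
      colDist q (q * q) + (Finset.univ.filter fun v => r v v ≠ 0).card := by
    refine (Finset.card_union_le _ _).trans (Nat.add_le_add_right ?_ _)
    refine (Finset.card_union_le _ _).trans (Nat.add_le_add_right ?_ _)
    refine (Finset.card_union_le _ _).trans (Nat.add_le_add_right ?_ _)
    exact Finset.card_biUnion_le
  refine (colDist_le_card bad fun v hv i => ?_).trans hbad
  simp only [bad, Finset.mem_union, Finset.mem_biUnion, Finset.mem_filter, Finset.mem_univ,
    true_and, not_or, not_exists, not_not] at hv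
  obtain ⟨⟨⟨h1, h2⟩, h3⟩, h4⟩ := hv
  by_cases h : ∃ k, p k v v ≠ 0
  · have hP : P v = some h.choose := dif_pos h
    set k := h.choose
    have hk : p k v v ≠ 0 := h.choose_spec
    obtain ⟨f, hf⟩ := exists_colMatrix (hp k)
    have hfv : f v = some v := by
      rw [hf, colMatrix_apply] at hk
      by_contra hcon
      exact hk (if_neg hcon)
    have hcol : ∀ i, p k i v = if v = i then 1 else 0 := by
      intro i
      rw [hf, colMatrix_apply, hfv]
      simp
    have := congrFun (h1 k) i
    rw [Matrix.transpose_apply, Matrix.transpose_apply, mul_col _ _ _ _ hcol,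
      mul_col _ _ _ _ hcol] at this
    simp [centerMatrix, hP, this]
  · have hP : P v = none := dif_neg h
    push Not at h
    have hqv : q v v = 0 := by
      rw [hsum, Matrix.add_apply, Matrix.sum_apply, h4, Finset.sum_eq_zero fun k _ => h k,
        add_zero]
    simp only [centerMatrix, hP, Option.elim_none]
    obtain ⟨f, hf⟩ := exists_colMatrix hq
    have ha : a i v = (a * q) i v := congrFun h2 i
    rw [ha]
    cases hfv : f v with
    | none =>
      simp [Matrix.mul_apply, hf, colMatrix_apply, hfv]
    | some w =>
      -- If `q` sends `v` to `w`, then `q = q q` at column `v` makes `q` fix `w`, and injectivity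
      -- gives `v = w`, against the vanishing of `q v v`.
      exfalso
      have h5 := congrFun h3 w
      rw [hf, colMatrix_mul, Matrix.transpose_apply, Matrix.transpose_apply, colMatrix_apply,
        colMatrix_apply, if_pos hfv] at h5
      have h6 : (f.trans f) v = some w := by
        by_contra hcon
        rw [if_neg hcon] at h5
        exact one_ne_zero h5
      have h7 : f w = some w := by
        have : (f.trans f) v = (f v).bind f := rfl
        rw [this, hfv] at h6
        exact h6
      have : v = w := f.inj hfv h7
      subst this
      rw [hf, colMatrix_apply, if_pos hfv] at hqv
      exact one_ne_zero hqv

open scoped Classical in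
-- The normalized trace of a partial permutation matrix is its proportion of fixed points.
theorem card_diag_le {r : Matrix (Fin d) (Fin d) ℂ} (hr : r ∈ partialPermMatrices d) {t δ : ℝ}
    (ht : ‖normTrace r - (t : ℂ)‖ < δ) :
    ((Finset.univ.filter fun v => r v v ≠ 0).card : ℝ) ≤ (t + δ) * d := by
  rcases Nat.eq_zero_or_pos d with rfl | hd
  · simp
  have hd' : (0 : ℝ) < d := by exact_mod_cast hd
  obtain ⟨f, rfl⟩ := exists_colMatrix hr
  rw [normTrace_colMatrix] at ht
  have h1 : (((Finset.univ.filter fun v => f v = some v).card : ℂ) / d - (t : ℂ)) =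
      ((((Finset.univ.filter fun v => f v = some v).card : ℝ) / d - t : ℝ) : ℂ) := by
    push_cast
    rfl
  rw [h1, Complex.norm_real, Real.norm_eq_abs] at ht
  have h2 := (abs_lt.1 ht).2
  have h3 : ((Finset.univ.filter fun v => f v = some v).card : ℝ) / d < t + δ := by linarith
  rw [div_lt_iff₀ hd'] at h3
  refine le_trans (le_of_eq ?_) h3.le
  congr 2
  ext v
  simp [colMatrix_apply]

open scoped Classical in
-- There are `(Fintype.card κ + 1) ^ d` patterns `P`, each with its own Hamming ball, so not knowing
-- `P` costs only an exponential factor.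
theorem exists_finset_center_ball {κ : Type*} [Fintype κ] (m : κ → Matrix (Fin d) (Fin d) ℂ)
    (b : ℕ) :
    ∃ S : Finset (Matrix (Fin d) (Fin d) ℂ),
      S.card ≤ (2 * (Fintype.card κ + 1)) ^ d * (d + 1) ^ b ∧
      ∀ a ∈ partialPermMatrices d, ∀ P, colDist a (centerMatrix m P) ≤ b → a ∈ S := by
  choose S hS h using fun P : Fin d → Option κ => exists_finset_colDist_ball (centerMatrix m P) b
  refine ⟨Finset.univ.biUnion S, ?_, fun a ha P hP => ?_⟩
  · refine (Finset.card_biUnion_le_card_mul _ _ _ fun P _ => hS P).trans (le_of_eq ?_)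
    simp only [Finset.card_univ, Fintype.card_fun, Fintype.card_option, Fintype.card_fin]
    rw [mul_pow]
    ring
  · exact Finset.mem_biUnion.2 ⟨P, Finset.mem_univ _, h P a ha hP⟩

end Center

/-! ### Short words in `SA`, and sums of projections -/

namespace PMPGroupoid

variable {A X : Type*} [MeasurableSpace A] [StandardBorelSpace A]
  [MeasurableSpace X] [StandardBorelSpace X] {𝒢 : PMPGroupoid A X}

theorem SA_apply_mem {F : Set 𝒢.Op} {n d : ℕ} {δ : ℝ} (hn : 1 ≤ n)
    {φ : 𝒢.linSpan →ₗ[ℂ] Matrix (Fin d) (Fin d) ℂ} (hφ : φ ∈ 𝒢.SA F n δ d) {s : 𝒢.linSpan}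
    (hs : (s : 𝒢.Op) ∈ F) :
    φ s ∈ partialPermMatrices d ∧ ‖normTrace (φ s) - 𝒢.trace s‖ < δ :=
  (hφ [s] (by simp) (by simpa using hn) (by simpa using Or.inl hs) s (by simp)).2

theorem SA_mul {F : Set 𝒢.Op} {n d : ℕ} {δ : ℝ} (hn : 2 ≤ n)
    {φ : 𝒢.linSpan →ₗ[ℂ] Matrix (Fin d) (Fin d) ℂ} (hφ : φ ∈ 𝒢.SA F n δ d) {s t a : 𝒢.linSpan}
    (hs : (s : 𝒢.Op) ∈ F) (ht : (t : 𝒢.Op) ∈ F) (ha : (a : 𝒢.Op) = s * t) :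
    (colDist (φ a) (φ s * φ t) : ℝ) ≤ δ ^ 2 * d ∧ φ a ∈ partialPermMatrices d ∧
      ‖normTrace (φ a) - 𝒢.trace a‖ < δ := by
  have h := hφ [s, t] (by simp) (by simpa using hn)
    (by
      intro x hx
      rcases List.mem_cons.1 hx with rfl | hx
      · exact Or.inl hs
      · rw [List.mem_singleton.1 hx]
        exact Or.inl ht) a (by simp [ha])
  refine ⟨colDist_le_of_norm2_lt h.2.1 ?_ (by simpa using h.1), h.2⟩
  exact mul_mem_partialPermMatrices (SA_apply_mem (by omega) hφ hs).1
    (SA_apply_mem (by omega) hφ ht).1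

theorem proj_sum (𝒢 : PMPGroupoid A X) {ι : Type*} (K : Finset ι) (S : ι → Set X)
    (hS : ∀ k, MeasurableSet (S k)) (hd : Pairwise fun k l => Disjoint (S k) (S l))
    {R Q : Set X} (hR : MeasurableSet R) (hQ : MeasurableSet Q)
    (hQR : Q = (⋃ k ∈ K, S k) ∪ R) (hdR : ∀ k ∈ K, Disjoint (S k) R) :
    𝒢.proj hQ = ∑ k ∈ K, 𝒢.proj (hS k) + 𝒢.proj hR := by
  classical
  induction K using Finset.induction_on generalizing Q with
  | empty =>
    simp only [Finset.notMem_empty, Set.iUnion_of_empty, Set.iUnion_empty, Set.empty_union] at hQR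
    subst hQR
    simp
  | insert k K hk ih =>
    have hQ' : MeasurableSet ((⋃ l ∈ K, S l) ∪ R) :=
      (MeasurableSet.biUnion K.countable_toSet fun l _ => hS l).union hR
    rw [Finset.sum_insert hk, add_assoc, ← ih hQ' rfl fun l hl => hdR l (by simp [hl])]
    refine 𝒢.proj_add (hS k) hQ' hQ ?_ ?_
    · rw [hQR, Finset.set_biUnion_insert, Set.union_assoc]
    · rw [Set.disjoint_union_right]
      refine ⟨?_, hdR k (by simp)⟩
      simp only [Set.disjoint_iUnion_right]
      intro l hl
      exact hd fun h => hk (h ▸ hl)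

end PMPGroupoid

open PMPGroupoid

/-! ### Splitting a bisection by group element; restriction to the group -/

section Upper

/-- The set of sources of the arrows of `B` with group element `g`. -/
def fiberAt {G X : Type*} (B : Set (G × X)) (g : G) : Set X := {x | (g, x) ∈ B}

theorem measurableSet_fiberAt {G X : Type*} [MeasurableSpace G] [MeasurableSpace X]
    {B : Set (G × X)} (hB : MeasurableSet B) (g : G) :
    MeasurableSet (fiberAt B g) := measurable_prodMk_left hB

variable {G : Type*} [Group G] [Countable G] [MeasurableSpace G] [DiscreteMeasurableSpace G]
  {X : Type*} [MeasurableSpace X] [StandardBorelSpace X] [MulAction G X]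
  [MeasurableConstSMul G X] {μ : Measure X} [IsProbabilityMeasure μ] [SMulInvariantMeasure G X μ]

theorem disjoint_fiberAt {B : Set (G × X)} (hB : (actionGroupoid G X μ).IsBisection B) :
    Pairwise fun g h => Disjoint (fiberAt B g) (fiberAt B h) := by
  intro g h hgh
  rw [Set.disjoint_left]
  intro x hg hh
  exact hgh (congrArg Prod.fst (hB.2.1 hg hh rfl))

/-- The measures of the fibres sum to `vol B ≤ 1`, so the tails of the series tend to zero. -/
theorem eventually_measure_tail_lt {B : Set (G × X)}
    (hB : (actionGroupoid G X μ).IsBisection B) {η : ℝ≥0∞} (hη : 0 < η) :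
    ∀ᶠ K : Finset G in atTop, μ (⋃ g ∈ (K : Set G)ᶜ, fiberAt B g) < η := by
  have hsum : ∑' g, μ (fiberAt B g) ≠ ∞ := by
    have := vol_action (μ := μ) hB.1
    unfold fiberAt
    rw [← this]
    exact ((vol_le_one hB).trans_lt ENNReal.one_lt_top).ne
  filter_upwards [(ENNReal.tendsto_tsum_compl_atTop_zero hsum).eventually_lt_const hη] with K hK
  refine lt_of_le_of_lt ?_ hK
  have : (⋃ g ∈ (K : Set G)ᶜ, fiberAt B g) = ⋃ g : {g // g ∉ K}, fiberAt B g := by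
    ext x
    simp
  rw [this]
  exact measure_iUnion_le _

/-- Over the sources whose arrow in `B` has group element `g`, multiplication by `B` is translation
by `g`. -/
theorem mul_proj_eq {B : Set (G × X)} {T : (actionGroupoid G X μ).Op}
    (hB : (actionGroupoid G X μ).IsBisection B)
    (hT : (actionGroupoid G X μ).IsPartialIsometryOf B T) (g : G) :
    T * (actionGroupoid G X μ).proj (measurableSet_fiberAt hB.1 g) =
      actionTranslation G X μ g * (actionGroupoid G X μ).proj (measurableSet_fiberAt hB.1 g) := by
  have hp := (actionGroupoid G X μ).proj_isPartialIsometryOf (measurableSet_fiberAt hB.1 g)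
  refine (hT.mul hB hp).unique ?_
  have := (actionTranslation_spec (μ := μ) g).mul (slice_isBisection g) hp
  convert this using 1
  ext ⟨k, x⟩
  simp only [mem_setMul_action, mem_unitsOf_action, mem_slice]
  constructor
  · rintro ⟨k', _, rfl, ⟨rfl, h1⟩, h2⟩
    rw [one_smul] at h2
    exact ⟨k', 1, rfl, ⟨rfl, h1⟩, congrArg Prod.fst (hB.2.1 h2 h1 rfl)⟩
  · rintro ⟨k', _, rfl, ⟨rfl, h1⟩, rfl⟩
    exact ⟨k', 1, rfl, ⟨rfl, h1⟩, by rwa [one_smul]⟩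

theorem mul_proj_source {B : Set (G × X)} {T : (actionGroupoid G X μ).Op}
    (hB : (actionGroupoid G X μ).IsBisection B)
    (hT : (actionGroupoid G X μ).IsPartialIsometryOf B T)
    (hq : MeasurableSet (⋃ g, fiberAt B g)) :
    T * (actionGroupoid G X μ).proj hq = T := by
  have hp := (actionGroupoid G X μ).proj_isPartialIsometryOf hq
  refine (hT.mul hB hp).unique ?_
  convert hT using 1
  ext ⟨k, x⟩
  simp only [mem_setMul_action, mem_unitsOf_action]
  constructor
  · rintro ⟨k', _, rfl, ⟨rfl, h1⟩, h2⟩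
    rwa [one_smul, ← _root_.mul_one k'] at h2
  · intro h
    exact ⟨k, 1, _root_.mul_one k, ⟨rfl, Set.mem_iUnion.2 ⟨k, h⟩⟩, by rwa [one_smul]⟩

theorem proj_mul_self {S : Set X} (hS : MeasurableSet S) :
    (actionGroupoid G X μ).proj hS * (actionGroupoid G X μ).proj hS =
      (actionGroupoid G X μ).proj hS := by
  have hp := (actionGroupoid G X μ).proj_isPartialIsometryOf hS
  refine (hp.mul ((actionGroupoid G X μ).unitsOf_isBisection hS) hp).unique ?_
  convert hp using 1
  ext ⟨k, x⟩
  simp only [mem_setMul_action, mem_unitsOf_action]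
  constructor
  · rintro ⟨_, _, rfl, ⟨rfl, h1⟩, rfl, h2⟩
    exact ⟨_root_.mul_one 1, h1⟩
  · rintro ⟨rfl, h⟩
    exact ⟨1, 1, _root_.mul_one 1, ⟨rfl, h⟩, rfl, by rwa [one_smul]⟩

/-- Words in translations are mapped by `J` to words in translations. -/
theorem prod_groupTranslation
    {J : (groupGroupoid G).linSpan →ₗ[ℂ] (actionGroupoid G X μ).linSpan}
    (hJ : ∀ (g : G) (a : (groupGroupoid G).linSpan),
      (a : (groupGroupoid G).Op) = groupTranslation G g →
      (J a : (actionGroupoid G X μ).Op) = actionTranslation G X μ g)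
    (l : List (groupGroupoid G).linSpan)
    (hl : ∀ s ∈ l, (s : (groupGroupoid G).Op) = 0 ∨
      ∃ g, (s : (groupGroupoid G).Op) = groupTranslation G g) :
    ((l.map Subtype.val).prod = 0 ∧ ((l.map J).map Subtype.val).prod = 0) ∨
      ∃ g, (l.map Subtype.val).prod = groupTranslation G g ∧
        ((l.map J).map Subtype.val).prod = actionTranslation G X μ g := by
  induction l with
  | nil => exact Or.inr ⟨1, by simp, by simp⟩
  | cons s l ih =>
    simp only [List.map_cons, List.prod_cons]
    rcases hl s (by simp) with hs | ⟨g, hg⟩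
    · left
      have : J s = 0 := by
        rw [show s = 0 from Subtype.ext hs, map_zero]
      rw [hs, this]
      exact ⟨zero_mul _, zero_mul _⟩
    · rcases ih fun t ht => hl t (by simp [ht]) with ⟨h1, h2⟩ | ⟨h, h1, h2⟩
      · left
        rw [h1, h2]
        exact ⟨mul_zero _, mul_zero _⟩
      · right
        refine ⟨g * h, ?_, ?_⟩
        · rw [h1, hg, map_mul]
        · rw [h2, hJ g s hg, map_mul]

/-- On words in translations and zero, `J` respects products, adjoints and traces, so each condition
for the group is an instance of the condition for the action. -/
theorem SA_comp {J : (groupGroupoid G).linSpan →ₗ[ℂ] (actionGroupoid G X μ).linSpan}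
    (hJ : ∀ (g : G) (a : (groupGroupoid G).linSpan),
      (a : (groupGroupoid G).Op) = groupTranslation G g →
      (J a : (actionGroupoid G X μ).Op) = actionTranslation G X μ g)
    {F' : Set (groupGroupoid G).Op} (hF' : F' ⊆ (groupGroupoid G).partialIsometries)
    {F : Set (actionGroupoid G X μ).Op}
    (hF : ∀ a : (groupGroupoid G).linSpan, (a : (groupGroupoid G).Op) ∈ F' →
      (J a : (actionGroupoid G X μ).Op) ∈ F)
    {n n' d : ℕ} {δ δ' : ℝ} (hn : n' ≤ n) (hδ : δ ≤ δ')
    {φ : (actionGroupoid G X μ).linSpan →ₗ[ℂ] Matrix (Fin d) (Fin d) ℂ}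
    (hφ : φ ∈ (actionGroupoid G X μ).SA F n δ d) :
    φ ∘ₗ J ∈ (groupGroupoid G).SA F' n' δ' d := by
  classical
  intro l hl0 hln hlF a ha
  have hl : ∀ s ∈ l, ((s : (groupGroupoid G).Op) = 0 ∨
      ∃ g, (s : (groupGroupoid G).Op) = groupTranslation G g) ∧
      (J s : (actionGroupoid G X μ).Op) ∈ F ∪ ContinuousLinearMap.adjoint '' F := by
    intro s hs
    rcases hlF s hs with h | ⟨t, ht, hts⟩
    · exact ⟨eq_zero_or_groupTranslation (hF' h), Or.inl (hF s h)⟩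
    · let t' : (groupGroupoid G).linSpan := ⟨t, Submodule.subset_span (hF' ht)⟩
      rcases eq_zero_or_groupTranslation (hF' ht) with h | ⟨g, hg⟩
      · have hs0 : (s : (groupGroupoid G).Op) = 0 := by rw [← hts, h, map_zero]
        refine ⟨Or.inl hs0, Or.inr ⟨_, hF t' ht, ?_⟩⟩
        rw [show t' = 0 from Subtype.ext h, show s = 0 from Subtype.ext hs0, map_zero]
        exact map_zero _
      · have hsg : (s : (groupGroupoid G).Op) = groupTranslation G g⁻¹ := by
          rw [← hts, hg, adjoint_groupTranslation]
        refine ⟨Or.inr ⟨_, hsg⟩, Or.inr ⟨_, hF t' ht, ?_⟩⟩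
        rw [hJ g t' hg, hJ _ s hsg, adjoint_actionTranslation]
  have key := prod_groupTranslation hJ l fun s hs => (hl s hs).1
  have hJa : (J a : (actionGroupoid G X μ).Op) = ((l.map J).map Subtype.val).prod ∧
      (actionGroupoid G X μ).trace (J a) = (groupGroupoid G).trace a := by
    rcases key with ⟨h1, h2⟩ | ⟨g, h1, h2⟩
    · have : a = 0 := Subtype.ext (ha.trans h1)
      subst this
      rw [map_zero, h2]
      refine ⟨rfl, ?_⟩
      simp [PMPGroupoid.trace]
    · have h3 := hJ g a (ha.trans h1)
      rw [h3, h2, trace_actionTranslation, ha, h1, trace_groupTranslation]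
      exact ⟨rfl, rfl⟩
  have := hφ (l.map J) (by simpa using hl0) (by simpa using hln.trans hn) (by
    intro s hs
    obtain ⟨t, ht, rfl⟩ := List.mem_map.1 hs
    exact (hl t ht).2) (J a) hJa.1
  rw [hJa.2, List.map_map] at this
  exact ⟨this.1.trans_le hδ, this.2.1, this.2.2.trans_le hδ⟩

end Upper

open PMPGroupoid

/-- The error of `exists_center_of_SA` with tail mass `η / 4` and `c = K.card`; the condition on `δ`
is supplied by `exists_small_tolerance`. -/
theorem quarter_bound {c d : ℕ} {δ η : ℝ} (hδ0 : 0 < δ) (hδ1 : δ ≤ 1)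
    (hδ2 : (2 * c + 3) * δ ≤ η / 2) :
    (2 * c + 2) * δ ^ 2 * d + (η / 4 + δ) * d ≤ η * d := by
  have hδsq : δ ^ 2 ≤ δ := by nlinarith
  have hη : 0 ≤ η := by
    have : (0 : ℝ) ≤ (2 * c + 3) * δ := by positivity
    linarith
  calc (2 * c + 2) * δ ^ 2 * d + (η / 4 + δ) * d
      ≤ (2 * c + 2) * δ * d + (η / 4 + δ) * d := by gcongr
    _ = ((2 * c + 3) * δ + η / 4) * d := by ring
    _ ≤ η * d := by
        gcongr
        linarith

theorem exists_small_tolerance (c : ℕ) {δ' η : ℝ} (hδ' : 0 < δ') (hη : 0 < η) :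
    ∃ δ : ℝ, 0 < δ ∧ δ ≤ δ' ∧ δ ≤ 1 ∧ (2 * c + 3) * δ ≤ η / 2 := by
  refine ⟨min δ' (min 1 (η / (2 * (2 * c + 3)))), by positivity, min_le_left _ _,
    (min_le_right _ _).trans (min_le_left _ _), ?_⟩
  have : min δ' (min 1 (η / (2 * (2 * c + 3)))) ≤ η / (2 * (2 * c + 3)) :=
    (min_le_right _ _).trans (min_le_right _ _)
  rw [le_div_iff₀ (by positivity)] at this
  linarith

theorem exists_small_rate (k : ℕ) {ε : ℝ} (hε : 0 < ε) : ∃ η : ℝ, 0 < η ∧ 2 * k * η < ε := by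
  refine ⟨ε / (4 * (k + 1)), by positivity, ?_⟩
  rw [mul_div_assoc', div_lt_iff₀ (by positivity)]
  nlinarith

/-! ### The upper bound, for all p.m.p. actions -/

section Upper

variable {G : Type*} [Group G] [Countable G] [MeasurableSpace G] [DiscreteMeasurableSpace G]
  {X : Type*} [MeasurableSpace X] [StandardBorelSpace X] [MulAction G X]
  [MeasurableConstSMul G X] {μ : Measure X} [IsProbabilityMeasure μ] [SMulInvariantMeasure G X μ]

/-- Each `g ∈ K` costs two comparisons of words of length two, the relations `T = T q` and `q = q q`
cost one each, every comparison losing at most `δ ^ 2 * d` columns. The tail contributes its fixed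
points, at most `(η + δ) * d`. Linearity of `φ` transports `q = ∑ p g + r`. -/
theorem exists_center_of_SA {B : Set (G × X)} {T : (actionGroupoid G X μ).Op}
    (hB : (actionGroupoid G X μ).IsBisection B)
    (hT : (actionGroupoid G X μ).IsPartialIsometryOf B T) (K : Finset G) {η : ℝ} (hη : 0 ≤ η)
    (hr : MeasurableSet (⋃ g ∈ (K : Set G)ᶜ, fiberAt B g))
    (hq : MeasurableSet (⋃ g, fiberAt B g))
    (hK : μ (⋃ g ∈ (K : Set G)ᶜ, fiberAt B g) < ENNReal.ofReal η)
    {F : Set (actionGroupoid G X μ).Op} (hTF : T ∈ F)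
    (hu : ∀ g ∈ K, actionTranslation G X μ g ∈ F)
    (hp : ∀ g ∈ K, (actionGroupoid G X μ).proj (measurableSet_fiberAt hB.1 g) ∈ F)
    (hqF : (actionGroupoid G X μ).proj hq ∈ F) (hrF : (actionGroupoid G X μ).proj hr ∈ F)
    {n d : ℕ} {δ : ℝ} (hn : 2 ≤ n)
    {φ : (actionGroupoid G X μ).linSpan →ₗ[ℂ] Matrix (Fin d) (Fin d) ℂ}
    (hφ : φ ∈ (actionGroupoid G X μ).SA F n δ d) (a : (actionGroupoid G X μ).linSpan)
    (ha : (a : (actionGroupoid G X μ).Op) = T) (u : K → (actionGroupoid G X μ).linSpan)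
    (hu' : ∀ g : K, (u g : (actionGroupoid G X μ).Op) = actionTranslation G X μ g) :
    ∃ P : Fin d → Option K, (colDist (φ a) (centerMatrix (fun g => φ (u g)) P) : ℝ) ≤
      (2 * K.card + 2) * δ ^ 2 * d + (η + δ) * d := by
  classical
  let lift : ∀ {S : Set X} (_ : MeasurableSet S), (actionGroupoid G X μ).linSpan := fun hS =>
    ⟨(actionGroupoid G X μ).proj hS, Submodule.subset_span ((actionGroupoid G X μ).proj_mem hS)⟩
  let p : K → (actionGroupoid G X μ).linSpan := fun g => lift (measurableSet_fiberAt hB.1 (g : G))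
  let q : (actionGroupoid G X μ).linSpan := lift hq
  let r : (actionGroupoid G X μ).linSpan := lift hr
  have hpF : ∀ g : K, (p g : (actionGroupoid G X μ).Op) ∈ F := fun g => hp g g.2
  have hsum : q = ∑ g, p g + r := by
    apply Subtype.ext
    rw [Submodule.coe_add, AddSubmonoidClass.coe_finsetSum]
    have h1 := (actionGroupoid G X μ).proj_sum K (fiberAt B) (fun g => measurableSet_fiberAt hB.1 g)
      (disjoint_fiberAt hB) hr hq ?_ ?_
    · rw [← Finset.sum_coe_sort K] at h1
      exact h1
    · ext x
      simp only [Set.mem_iUnion, Set.mem_union, Set.mem_compl_iff, Finset.mem_coe, exists_prop]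
      constructor
      · rintro ⟨g, hg⟩
        by_cases hgK : g ∈ K
        · exact Or.inl ⟨g, hgK, hg⟩
        · exact Or.inr ⟨g, hgK, hg⟩
      · rintro (⟨g, -, hg⟩ | ⟨g, -, hg⟩) <;> exact ⟨g, hg⟩
    · intro g hg
      rw [Set.disjoint_iUnion₂_right]
      intro h hh
      exact disjoint_fiberAt hB (fun e => hh (e ▸ hg))
  have hqm := SA_apply_mem (by omega) hφ (s := q) hqF
  have hrm := SA_apply_mem (by omega) hφ (s := r) hrF
  have hqq := SA_mul hn hφ (s := q) (t := q) (a := q) hqF hqF (proj_mul_self hq).symm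
  have haq := SA_mul hn hφ (s := a) (t := q) (a := a) (ha ▸ hTF) hqF (by
    rw [ha]; exact (mul_proj_source hB hT hq).symm)
  obtain ⟨P, hP⟩ := exists_colDist_centerMatrix_le (a := φ a) (q := φ q) (r := φ r)
    (m := fun g => φ (u g)) (p := fun g => φ (p g))
    (fun g => (SA_apply_mem (by omega) hφ (hpF g)).1) hqm.1 (by rw [hsum, map_add, map_sum])
  refine ⟨P, ?_⟩
  have hP' : (colDist (φ a) (centerMatrix (fun g => φ (u g)) P) : ℝ) ≤
      ∑ g : K, (colDist (φ a * φ (p g)) (φ (u g) * φ (p g)) : ℝ) + colDist (φ a) (φ a * φ q) +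
      colDist (φ q) (φ q * φ q) +
        ((Finset.univ.filter fun v => φ r v v ≠ 0).card : ℝ) := by
    exact_mod_cast hP
  have h1 : ∀ g : K, (colDist (φ a * φ (p g)) (φ (u g) * φ (p g)) : ℝ) ≤ 2 * (δ ^ 2 * d) := by
    intro g
    have hmul := mul_proj_eq hB hT (g : G)
    -- The element `b = T p_g = u_g p_g` is a word of length two in two ways, and `φ b` is close to
    -- both products.
    let b : (actionGroupoid G X μ).linSpan :=
      ⟨T * (actionGroupoid G X μ).proj (measurableSet_fiberAt hB.1 (g : G)), Submodule.subset_span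
      ⟨_, setMul_isBisection hB
        ((actionGroupoid G X μ).unitsOf_isBisection (measurableSet_fiberAt hB.1 (g : G))),
        hT.mul hB ((actionGroupoid G X μ).proj_isPartialIsometryOf _)⟩⟩
    have e1 := (SA_mul hn hφ (s := a) (t := p g) (a := b) (ha ▸ hTF) (hpF g) (by rw [ha])).1
    have e2 := (SA_mul hn hφ (s := u g) (t := p g) (a := b) (hu' g ▸ hu g g.2) (hpF g) (by
      rw [hu' g]; exact hmul)).1
    have e3 := colDist_triangle (φ a * φ (p g)) (φ b) (φ (u g) * φ (p g))
    rw [colDist_comm (φ a * φ (p g)) (φ b)] at e3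
    have e4 : (colDist (φ a * φ (p g)) (φ (u g) * φ (p g)) : ℝ) ≤
        colDist (φ b) (φ a * φ (p g)) + colDist (φ b) (φ (u g) * φ (p g)) := by exact_mod_cast e3
    linarith
  have h2 : ((Finset.univ.filter fun v => φ r v v ≠ 0).card : ℝ) ≤ (η + δ) * d := by
    have h3 := hrm.2
    rw [show (r : (actionGroupoid G X μ).Op) = (actionGroupoid G X μ).proj hr from rfl,
      (actionGroupoid G X μ).trace_proj] at h3
    refine (card_diag_le hrm.1 h3).trans ?_
    have : (actionGroupoid G X μ).unitMeasure.real (⋃ g ∈ (K : Set G)ᶜ, fiberAt B g) ≤ η :=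
      ENNReal.toReal_le_of_le_ofReal hη hK.le
    gcongr
  have h3 : ∑ g : K, (colDist (φ a * φ (p g)) (φ (u g) * φ (p g)) : ℝ) ≤
      K.card * (2 * (δ ^ 2 * d)) := by
    refine (Finset.sum_le_sum fun g _ => h1 g).trans (le_of_eq ?_)
    simp
  nlinarith [hqq.1, haq.1]

/-- The restriction of `φ` to the translations in `K` is that of the group map `φ ∘ₗ J`. Given it,
each `φ a` with `a` in `E` lies in the balls around the centre matrices built from it. -/
theorem restrictCard_action_le {E : Set (actionGroupoid G X μ).Op} (hEfin : E.Finite)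
    {B : (actionGroupoid G X μ).Op → Set (G × X)}
    (hB : ∀ T ∈ E, (actionGroupoid G X μ).IsBisection (B T))
    (hT : ∀ T ∈ E, (actionGroupoid G X μ).IsPartialIsometryOf (B T) T) (K : Finset G) {η : ℝ}
    (hη0 : 0 < η) (hK : ∀ T ∈ E,
      μ (⋃ g ∈ (K : Set G)ᶜ, fiberAt (B T) g) < ENNReal.ofReal (η / 4))
    {J : (groupGroupoid G).linSpan →ₗ[ℂ] (actionGroupoid G X μ).linSpan}
    (hJ : ∀ (g : G) (a : (groupGroupoid G).linSpan),
      (a : (groupGroupoid G).Op) = groupTranslation G g →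
      (J a : (actionGroupoid G X μ).Op) = actionTranslation G X μ g)
    {F' : Set (groupGroupoid G).Op} (hF' : F' ⊆ (groupGroupoid G).partialIsometries)
    {F : Set (actionGroupoid G X μ).Op}
    (hF : ∀ a : (groupGroupoid G).linSpan, (a : (groupGroupoid G).Op) ∈ F' →
      (J a : (actionGroupoid G X μ).Op) ∈ F)
    (hEF : E ⊆ F) (hu : ∀ g ∈ K, actionTranslation G X μ g ∈ F)
    (hproj : ∀ T ∈ E, ∀ (Z : Set X) (hZ : MeasurableSet Z),
      (Z ∈ (fiberAt (B T)) '' K ∨ Z = (⋃ g, fiberAt (B T) g) ∨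
        Z = (⋃ g ∈ (K : Set G)ᶜ, fiberAt (B T) g)) → (actionGroupoid G X μ).proj hZ ∈ F)
    {n n' : ℕ} {δ δ' : ℝ} (hn : 2 ≤ n) (hnn' : n' ≤ n) (hδδ' : δ ≤ δ') (hδ0 : 0 < δ) (hδ1 : δ ≤ 1)
    (hδ2 : (2 * K.card + 3) * δ ≤ η / 2) (d : ℕ) :
    (actionGroupoid G X μ).restrictCard E ((actionGroupoid G X μ).SA F n δ d) ≤
      (groupGroupoid G).restrictCard (groupTranslation G '' (K : Set G))
        ((groupGroupoid G).SA F' n' δ' d) *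
      (((2 * (K.card + 1)) ^ d * (d + 1) ^ ⌊η * d⌋₊) ^
        Nat.card {a : (actionGroupoid G X μ).linSpan //
          (a : (actionGroupoid G X μ).Op) ∈ E} : ℕ) := by
  have : Finite {a : (actionGroupoid G X μ).linSpan // (a : (actionGroupoid G X μ).Op) ∈ E} :=
    (hEfin.preimage Subtype.val_injective.injOn).to_subtype
  let idx : K → {a : (groupGroupoid G).linSpan //
      (a : (groupGroupoid G).Op) ∈ groupTranslation G '' (K : Set G)} := fun g =>
    ⟨⟨groupTranslation G g, Submodule.subset_span (groupTranslation_mem _)⟩, g, g.2, rfl⟩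
  have hball : ∀ m : K → Matrix (Fin d) (Fin d) ℂ, ∃ S : Finset (Matrix (Fin d) (Fin d) ℂ),
      S.card ≤ (2 * (K.card + 1)) ^ d * (d + 1) ^ ⌊η * d⌋₊ ∧
      ∀ a ∈ partialPermMatrices d, ∀ P, colDist a (centerMatrix m P) ≤ ⌊η * d⌋₊ → a ∈ S := by
    intro m
    obtain ⟨S, hS, h⟩ := exists_finset_center_ball m ⌊η * d⌋₊
    rw [Fintype.card_coe] at hS
    exact ⟨S, hS, h⟩
  choose S hScard hS using hball
  refine encard_le_of_fibers _ _ ((2 * (K.card + 1)) ^ d * (d + 1) ^ ⌊η * d⌋₊)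
    (Nat.one_le_iff_ne_zero.2 (by positivity)) (fun t _ => S fun g => t (idx g))
    (fun t _ => hScard fun g => t (idx g)) ?_
  rintro _ ⟨φ, hφ, rfl⟩
  have hψ := SA_comp hJ hF' hF hnn' hδδ' hφ
  refine ⟨_, ⟨_, hψ, rfl⟩, fun ⟨a, haE⟩ => ?_⟩
  have haF := hEF haE
  have hBa := hB a haE
  have hr : MeasurableSet (⋃ g ∈ (K : Set G)ᶜ, fiberAt (B a) g) :=
    MeasurableSet.biUnion (Set.to_countable _) fun g _ => measurableSet_fiberAt hBa.1 g
  have hq : MeasurableSet (⋃ g, fiberAt (B a) g) :=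
    MeasurableSet.iUnion fun g => measurableSet_fiberAt hBa.1 g
  obtain ⟨P, hP⟩ := exists_center_of_SA hBa (hT a haE) K (η := η / 4) (by positivity) hr hq
    (hK a haE) haF hu
    (fun g hg => hproj a haE _ _ (Or.inl ⟨g, hg, rfl⟩)) (hproj a haE _ _ (Or.inr (Or.inl rfl)))
    (hproj a haE _ _ (Or.inr (Or.inr rfl))) hn hφ a rfl (fun g => J (idx g).1)
    (fun g => hJ g _ rfl)
  refine hS _ (φ a) (SA_apply_mem (by omega) hφ haF).1 P
    (Nat.le_floor (hP.trans (quarter_bound hδ0 hδ1 hδ2)))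

theorem exists_extended_set {E : Set (actionGroupoid G X μ).Op} (hEfin : E.Finite)
    (hEsub : E ⊆ (actionGroupoid G X μ).partialIsometries)
    (B : (actionGroupoid G X μ).Op → Set (G × X)) (K : Finset G)
    {J : (groupGroupoid G).linSpan →ₗ[ℂ] (actionGroupoid G X μ).linSpan}
    (hJ : ∀ (g : G) (a : (groupGroupoid G).linSpan),
      (a : (groupGroupoid G).Op) = groupTranslation G g →
      (J a : (actionGroupoid G X μ).Op) = actionTranslation G X μ g)
    {F' : Set (groupGroupoid G).Op} (hF'fin : F'.Finite)
    (hF' : F' ⊆ (groupGroupoid G).partialIsometries) :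
    ∃ F : Set (actionGroupoid G X μ).Op, (F.Finite ∧ F ⊆ (actionGroupoid G X μ).partialIsometries) ∧
      (∀ a : (groupGroupoid G).linSpan, (a : (groupGroupoid G).Op) ∈ F' →
        (J a : (actionGroupoid G X μ).Op) ∈ F) ∧ E ⊆ F ∧
      (∀ g ∈ K, actionTranslation G X μ g ∈ F) ∧
      ∀ T ∈ E, ∀ (Z : Set X) (hZ : MeasurableSet Z),
        (Z ∈ (fiberAt (B T)) '' K ∨ Z = (⋃ g, fiberAt (B T) g) ∨
          Z = (⋃ g ∈ (K : Set G)ᶜ, fiberAt (B T) g)) → (actionGroupoid G X μ).proj hZ ∈ F := by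
  -- The operator `proj` takes a proof of measurability, so it is packaged as a set with at most one
  -- element, empty when `S` is not measurable.
  let projSet : Set X → Set (actionGroupoid G X μ).Op :=
    fun S => {p | ∃ hS : MeasurableSet S, p = (actionGroupoid G X μ).proj hS}
  have projSet_fin : ∀ S, (projSet S).Finite := fun S => by
    refine Set.Subsingleton.finite ?_
    rintro _ ⟨h, rfl⟩ _ ⟨h', rfl⟩
    rfl
  have projSet_sub : ∀ S, projSet S ⊆ (actionGroupoid G X μ).partialIsometries := by
    rintro S _ ⟨h, rfl⟩
    exact (actionGroupoid G X μ).proj_mem h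
  let F₃ : Set (actionGroupoid G X μ).Op := ⋃ T ∈ E, ((⋃ g ∈ K, projSet (fiberAt (B T) g)) ∪
    projSet (⋃ g, fiberAt (B T) g) ∪ projSet (⋃ g ∈ (K : Set G)ᶜ, fiberAt (B T) g))
  refine ⟨(fun a : (groupGroupoid G).linSpan => (J a : (actionGroupoid G X μ).Op)) ''
    (Subtype.val ⁻¹' F') ∪ actionTranslation G X μ '' K ∪ E ∪ F₃, ⟨?_, ?_⟩,
    fun a ha => Or.inl (Or.inl (Or.inl ⟨a, ha, rfl⟩)), fun T hT => Or.inl (Or.inr hT),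
    fun g hg => Or.inl (Or.inl (Or.inr ⟨g, hg, rfl⟩)), ?_⟩
  · refine (((Set.Finite.image _ (hF'fin.preimage Subtype.val_injective.injOn)).union
      (K.finite_toSet.image _)).union hEfin).union (hEfin.biUnion fun T _ => ?_)
    exact ((K.finite_toSet.biUnion fun g _ => projSet_fin _).union (projSet_fin _)).union
      (projSet_fin _)
  · refine Set.union_subset (Set.union_subset (Set.union_subset ?_ ?_) hEsub) ?_
    · rintro _ ⟨a, ha, rfl⟩
      rcases eq_zero_or_groupTranslation (hF' ha) with h | ⟨g, hg⟩
      · change (J a : (actionGroupoid G X μ).Op) ∈ _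
        rw [show a = 0 from Subtype.ext h, map_zero]
        exact zero_mem_partialIsometries
      · change (J a : (actionGroupoid G X μ).Op) ∈ _
        rw [hJ g a hg]
        exact actionTranslation_mem g
    · rintro _ ⟨g, -, rfl⟩
      exact actionTranslation_mem g
    · refine Set.iUnion₂_subset fun T _ => Set.union_subset (Set.union_subset ?_ (projSet_sub _))
        (projSet_sub _)
      exact Set.iUnion₂_subset fun g _ => projSet_sub _
  · intro T hTE Z hZ h
    refine Or.inr (Set.mem_iUnion₂.2 ⟨T, hTE, ?_⟩)
    rcases h with ⟨g, hg, rfl⟩ | rfl | rfl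
    · exact Or.inl (Or.inl (Set.mem_iUnion₂.2 ⟨g, hg, hZ, rfl⟩))
    · exact Or.inl (Or.inr ⟨hZ, rfl⟩)
    · exact Or.inr ⟨hZ, rfl⟩

theorem soficDim_action_le_group :
    (actionGroupoid G X μ).soficDim ≤ (groupGroupoid G).soficDim ∧
    (actionGroupoid G X μ).lowerSoficDim ≤ (groupGroupoid G).lowerSoficDim := by
  refine soficDim_le_of_growth_le _ _ fun E hE ε hε => ?_
  obtain ⟨hEfin, hEsub⟩ := hE
  have hEsub' : ∀ T : (actionGroupoid G X μ).Op, ∃ B, T ∈ E →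
      (actionGroupoid G X μ).IsBisection B ∧
        (actionGroupoid G X μ).IsPartialIsometryOf B T := fun T => by
    by_cases hT : T ∈ E
    · obtain ⟨B, hB⟩ := hEsub hT
      exact ⟨B, fun _ => hB⟩
    · exact ⟨∅, fun h => (hT h).elim⟩
  choose B hB using hEsub'
  obtain ⟨η, hη0, hηε⟩ := exists_small_rate
    (Nat.card {a : (actionGroupoid G X μ).linSpan // (a : (actionGroupoid G X μ).Op) ∈ E}) hε
  obtain ⟨K, hK⟩ : ∃ K : Finset G, ∀ T ∈ E,
      μ (⋃ g ∈ (K : Set G)ᶜ, fiberAt (B T) g) < ENNReal.ofReal (η / 4) :=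
    ((Filter.eventually_all_finite hEfin).2 fun T hTE =>
      eventually_measure_tail_lt (hB T hTE).1 (by positivity)).exists
  refine ⟨groupTranslation G '' K, ⟨K.finite_toSet.image _, ?_⟩, ?_⟩
  · rintro _ ⟨g, -, rfl⟩
    exact groupTranslation_mem g
  intro F' hF' n' hn' δ' hδ'
  obtain ⟨J, hJ⟩ := exists_linSpan_map (G := G) (X := X) (μ := μ)
  obtain ⟨F, hF, hF1, hF2, hF3, hF4⟩ := exists_extended_set hEfin hEsub B K hJ hF'.1 hF'.2
  obtain ⟨δ, hδ0, hδδ', hδ1, hδ2⟩ := exists_small_tolerance K.card hδ' hη0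
  -- Words of length two are needed for the column comparison, whatever `n'` is.
  refine ⟨F, hF, max n' 2, hn'.trans (le_max_left _ _), δ, hδ0, ?_⟩
  refine growth_le_add _ _ (Nat.mul_pos two_pos (Nat.succ_pos K.card)) hη0.le hηε
    (Eventually.of_forall fun d =>
      ⟨⌊η * d⌋₊, Nat.floor_le (mul_nonneg hη0.le d.cast_nonneg), ?_⟩)
  exact restrictCard_action_le hEfin (fun T hT => (hB T hT).1) (fun T hT => (hB T hT).2) K hη0 hK
    hJ hF'.2 hF1 hF2 hF3 hF4 (le_max_right n' 2) (le_max_left n' 2) hδδ' hδ0 hδ1 hδ2 d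

end Upper

/-! ### Random models of Bernoulli actions -/

open ProbabilityTheory

/-- At the point `v`, the maps `σ g` with `g ∈ T` behave like a free action of the group. -/
def IsSoficAt {G : Type*} [Group G] {d : ℕ} (T : Finset G) (σ : G → Fin d → Fin d) (v : Fin d) :
    Prop :=
  σ 1 v = v ∧ (∀ g ∈ T, ∀ h ∈ T, σ g (σ h v) = σ (g * h) v) ∧ ∀ g ∈ T, g ≠ 1 → σ g v ≠ v

section Random

open scoped Classical in
/-- The point of `Y^G` seen from `v` in a labelling: the coordinates in `L` are read off along the
maps `σ`, the other ones are private to `v`. -/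
def modelPoint {Y G : Type*} [Group G] {d : ℕ} (L : Finset G) (σ : G → Fin d → Fin d)
    (v : Fin d) (y : Fin d × Option G → Y) :
    G → Y :=
  fun t => y (if t ∈ L then (σ t⁻¹ v, none) else (v, some t))

theorem modelPoint_apply {Y G : Type*} [Group G] {d : ℕ} {L : Finset G} {σ : G → Fin d → Fin d}
    {v : Fin d} {y : Fin d × Option G → Y} {t : G} (ht : t ∈ L) :
    modelPoint L σ v y t = y (σ t⁻¹ v, none) := by
  rw [modelPoint, if_pos ht]

variable {Y : Type*} [MeasurableSpace Y] (ν : Measure Y) [IsProbabilityMeasure ν]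

theorem iIndepFun_eval (I : Type*) :
    iIndepFun (fun (i : I) (y : I → Y) => y i) (Measure.infinitePi fun _ : I => ν) := by
  rw [iIndepFun_iff_map_fun_eq_infinitePi_map (by fun_prop), Measure.map_id']
  congr
  funext i
  exact ((measurePreserving_eval_infinitePi (fun _ : I => ν) i).map_eq).symm

/-- Distinct coordinates of an i.i.d. family, listed in any order, are again i.i.d. -/
theorem infinitePi_map_comp_injective {I G : Type*} {f : G → I} (hf : f.Injective) :
    (Measure.infinitePi fun _ : I => ν).map (fun y t => y (f t)) =
      Measure.infinitePi fun _ : G => ν := by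
  have h := (iIndepFun_eval ν I).precomp hf
  rw [iIndepFun_iff_map_fun_eq_infinitePi_map (by fun_prop)] at h
  rw [h]
  congr
  funext i
  exact (measurePreserving_eval_infinitePi (fun _ : I => ν) (f i)).map_eq

theorem indepFun_of_disjoint_range {I L L' : Type*} [Finite L] [Finite L'] {a : L → I} {b : L' → I}
    (hab : ∀ s t, a s ≠ b t) :
    IndepFun (fun (y : I → Y) t => y (a t)) (fun (y : I → Y) t => y (b t))
      (Measure.infinitePi fun _ : I => ν) := by
  classical
  have := Fintype.ofFinite L
  have := Fintype.ofFinite L'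
  have hdisj : Disjoint (Finset.univ.image a) (Finset.univ.image b) := by
    rw [Finset.disjoint_left]
    intro i hi hi'
    obtain ⟨s, -, rfl⟩ := Finset.mem_image.1 hi
    obtain ⟨t, -, ht⟩ := Finset.mem_image.1 hi'
    exact hab s t ht.symm
  have h := (iIndepFun_eval ν I).indepFun_finset _ _ hdisj (fun i => measurable_pi_apply i)
  exact h.comp (φ := fun z t => z ⟨a t, Finset.mem_image_of_mem _ (Finset.mem_univ t)⟩)
    (ψ := fun z t => z ⟨b t, Finset.mem_image_of_mem _ (Finset.mem_univ t)⟩)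
    (measurable_pi_lambda _ fun t => measurable_pi_apply _)
    (measurable_pi_lambda _ fun t => measurable_pi_apply _)

theorem exists_cylinder_approx {G : Type*} {C : Set (G → Y)} (hC : MeasurableSet C) {ε : ℝ≥0∞}
    (hε : 0 < ε) : ∃ (L : Finset G) (S : Set (L → Y)), MeasurableSet S ∧
      (Measure.infinitePi fun _ : G => ν) (symmDiff (cylinder L S) C) < ε := by
  obtain ⟨t, ht, h⟩ := exists_measure_symmDiff_lt_of_generateFrom_isSetRing
    (μ := Measure.infinitePi fun _ : G => ν) (C := measurableCylinders fun _ : G => Y)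
    isSetRing_measurableCylinders
    ⟨{Set.univ}, Set.countable_singleton _,
      Set.singleton_subset_iff.2 (univ_mem_measurableCylinders _), by simp⟩
    generateFrom_measurableCylinders.symm hC hε
  obtain ⟨L, S, hS, rfl⟩ := (mem_measurableCylinders t).1 ht
  exact ⟨L, S, hS, h⟩

variable {G : Type*} [Group G] {d : ℕ}

theorem measurable_modelPoint (L : Finset G) (σ : G → Fin d → Fin d) (v : Fin d) :
    Measurable (modelPoint (Y := Y) L σ v) :=
  measurable_pi_lambda _ fun _ => measurable_pi_apply _

/-- The private labels make the coordinate map injective on all of `G`, not only on `L`. Hence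
`modelPoint` has law exactly `ν^G`, and null sets and approximation errors can be measured directly.
-/
theorem map_modelPoint (L : Finset G) (σ : G → Fin d → Fin d) (v : Fin d)
    (hinj : Set.InjOn (fun t => σ t⁻¹ v) L) :
    (Measure.infinitePi fun _ : Fin d × Option G => ν).map (modelPoint L σ v) =
      Measure.infinitePi fun _ : G => ν := by
  classical
  refine infinitePi_map_comp_injective ν
    (f := fun t : G => if t ∈ L then (σ t⁻¹ v, (none : Option G)) else (v, some t)) ?_
  intro s t hst
  dsimp only at hst
  split_ifs at hst with h1 h2 h2
  · exact hinj h1 h2 (Prod.ext_iff.1 hst).1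
  · simp at hst
  · simp at hst
  · simpa using hst

open scoped Classical in
/-- The second moment of a sum of centred variables which are mostly uncorrelated. -/
theorem integral_sum_sq_le {Ω κ : Type*} [MeasurableSpace Ω] (P : Measure Ω)
    [IsProbabilityMeasure P] (V : Finset κ) (Z : κ → Ω → ℝ) (hZ : ∀ v, Measurable (Z v))
    (hb : ∀ v ω, |Z v ω| ≤ 1) (R : κ → κ → Prop)
    (h0 : ∀ v ∈ V, ∀ w ∈ V, ¬ R v w → ∫ ω, Z v ω * Z w ω ∂P = 0) :
    ∫ ω, (∑ v ∈ V, Z v ω) ^ 2 ∂P ≤ ((V ×ˢ V).filter fun p => R p.1 p.2).card := by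
  have hb2 : ∀ v w ω, |Z v ω * Z w ω| ≤ 1 := fun v w ω => by
    rw [abs_mul]
    exact mul_le_one₀ (hb v ω) (abs_nonneg _) (hb w ω)
  have hint : ∀ v w, Integrable (fun ω => Z v ω * Z w ω) P := fun v w =>
    Integrable.of_bound ((hZ v).mul (hZ w)).aestronglyMeasurable 1
      (Eventually.of_forall fun ω => hb2 v w ω)
  have h1 : ∀ ω, (∑ v ∈ V, Z v ω) ^ 2 = ∑ p ∈ V ×ˢ V, Z p.1 ω * Z p.2 ω := fun ω => by
    rw [sq, Finset.sum_mul_sum, Finset.sum_product]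
  simp_rw [h1]
  rw [integral_finsetSum _ fun p _ => hint p.1 p.2, Finset.card_filter]
  push_cast
  refine Finset.sum_le_sum fun p hp => ?_
  obtain ⟨hp1, hp2⟩ := Finset.mem_product.1 hp
  split_ifs with hR
  · refine (integral_mono (hint _ _) (integrable_const (1 : ℝ)) fun ω =>
      (le_abs_self _).trans (hb2 _ _ ω)).trans ?_
    simp
  · exact (h0 _ hp1 _ hp2 hR).le

open scoped Classical in
-- For fixed `s`, `t`, the point `v` determines `w` through `σ s⁻¹ v = σ t⁻¹ w`, by injectivity on
-- `V`; this leaves at most `d` pairs.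
theorem card_overlap_le {L : Finset G} {σ : G → Fin d → Fin d} {V : Finset (Fin d)}
    (hinj : ∀ t ∈ L, Set.InjOn (σ t⁻¹) V) :
    ((V ×ˢ V).filter fun p => ∃ s ∈ L, ∃ t ∈ L, σ s⁻¹ p.1 = σ t⁻¹ p.2).card ≤ L.card ^ 2 * d := by
  have hsub : ((V ×ˢ V).filter fun p => ∃ s ∈ L, ∃ t ∈ L, σ s⁻¹ p.1 = σ t⁻¹ p.2) ⊆
      (L ×ˢ L).biUnion fun q => (V ×ˢ V).filter fun p => σ q.1⁻¹ p.1 = σ q.2⁻¹ p.2 := by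
    intro p hp
    simp only [Finset.mem_filter, Finset.mem_biUnion, Finset.mem_product] at hp ⊢
    obtain ⟨hV, s, hs, t, ht, h⟩ := hp
    exact ⟨(s, t), ⟨hs, ht⟩, hV, h⟩
  refine (Finset.card_le_card hsub).trans ?_
  have := Finset.card_biUnion_le_card_mul (L ×ˢ L)
    (fun q => (V ×ˢ V).filter fun p => σ q.1⁻¹ p.1 = σ q.2⁻¹ p.2) d fun q hq => ?_
  · rwa [Finset.card_product, ← sq] at this
  · have hle := Finset.card_le_card_of_injOn (s := (V ×ˢ V).filter fun p => σ q.1⁻¹ p.1 = σ q.2⁻¹ p.2)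
      (t := Finset.univ) Prod.fst (fun _ _ => Finset.mem_coe.2 (Finset.mem_univ _)) ?_
    · simpa using hle
    · intro p hp p' hp' h
      simp only [Finset.coe_filter, Finset.mem_product, Set.mem_ofPred_eq] at hp hp'
      refine Prod.ext h (hinj q.2 (Finset.mem_product.1 hq).2 hp.1.2 hp'.1.2 ?_)
      rw [← hp.2, ← hp'.2, h]

open scoped Classical in
/-- Frequencies of cylinder events concentrate. -/
theorem integral_frequency_sq_le {L L' : Finset G} (hL : L ⊆ L') {S : Set (L → Y)}
    (hS : MeasurableSet S) {σ : G → Fin d → Fin d} {V : Finset (Fin d)}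
    (hinj : ∀ t ∈ L', Set.InjOn (σ t⁻¹) V) (hinj' : ∀ v ∈ V, Set.InjOn (fun t => σ t⁻¹ v) L') :
    ∫ y, (∑ v ∈ V, ((cylinder L S).indicator 1 (modelPoint L' σ v y) -
      (Measure.infinitePi fun _ : G => ν).real (cylinder L S))) ^ 2
      ∂(Measure.infinitePi fun _ : Fin d × Option G => ν) ≤ (L.card ^ 2 * d : ℝ) := by
  set p := (Measure.infinitePi fun _ : G => ν).real (cylinder L S) with hp
  set P := Measure.infinitePi fun _ : Fin d × Option G => ν with hP
  have hcyl : MeasurableSet (cylinder (α := fun _ : G => Y) L S) := hS.cylinder L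
  let Z : Fin d → (Fin d × Option G → Y) → ℝ := fun v y =>
    (cylinder L S).indicator 1 (modelPoint L' σ v y) - p
  have hZ : ∀ v, Measurable (Z v) := fun v =>
    ((measurable_one.indicator hcyl).comp (measurable_modelPoint L' σ v)).sub_const p
  have hp0 : 0 ≤ p := measureReal_nonneg
  have hp1 : p ≤ 1 := measureReal_le_one
  have hb : ∀ v y, |Z v y| ≤ 1 := by
    intro v y
    simp only [Z, Set.indicator_apply, Pi.one_apply]
    rw [abs_le]
    split_ifs <;> constructor <;> linarith
  have hmean : ∀ v ∈ V, ∫ y, Z v y ∂P = 0 := by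
    intro v hv
    have h1 : Integrable (fun y => (cylinder L S).indicator (1 : (G → Y) → ℝ) (modelPoint L' σ v y)) P :=
      Integrable.of_bound ((measurable_one.indicator hcyl).comp
        (measurable_modelPoint L' σ v)).aestronglyMeasurable 1 (Eventually.of_forall fun y => by
          simp only [Set.indicator_apply, Pi.one_apply]
          split_ifs <;> simp)
    simp only [Z]
    rw [integral_sub h1 (integrable_const p), integral_const, probReal_univ, one_smul]
    rw [← integral_map (φ := modelPoint L' σ v) (f := (cylinder L S).indicator 1)
      (measurable_modelPoint L' σ v).aemeasurable
      (measurable_one.indicator hcyl).aestronglyMeasurable, hP, map_modelPoint ν L' σ v (hinj' v hv),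
      integral_indicator_one hcyl, sub_self]
  have key := integral_sum_sq_le P V Z hZ hb
    (fun v w => ∃ s ∈ L, ∃ t ∈ L, σ s⁻¹ v = σ t⁻¹ w) ?_
  · refine key.trans ?_
    have hcard := card_overlap_le (L := L) (σ := σ) (V := V) fun t ht => hinj t (hL ht)
    have hcard' := (Nat.cast_le (α := ℝ)).2 hcard
    push_cast at hcard'
    refine le_trans (le_of_eq ?_) hcard'
    congr 2
    ext
    simp only [Finset.mem_filter]
  · intro v hv w hw hR
    push Not at hR
    -- When no label is read by both points, the two centred indicators are functions of disjoint
    -- families of labels, so the mean of their product is the product of their zero means.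
    have hind := indepFun_of_disjoint_range ν (I := Fin d × Option G) (L := L) (L' := L)
      (a := fun t => (σ (t : G)⁻¹ v, none)) (b := fun t => (σ (t : G)⁻¹ w, none))
      (fun s t h => hR s s.2 t t.2 (Prod.ext_iff.1 h).1)
    have hform : ∀ v y, Z v y = (fun z : L → Y => S.indicator 1 z - p)
        (fun t : L => y (σ (t : G)⁻¹ v, none)) := by
      intro v y
      simp only [Z, Set.indicator_apply, mem_cylinder]
      have : Finset.restrict L (modelPoint L' σ v y) = fun t : L => y (σ (t : G)⁻¹ v, none) := by
        funext t
        exact modelPoint_apply (hL t.2)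
      rw [this]
      rfl
    have hmeas : Measurable fun z : L → Y => S.indicator (1 : (L → Y) → ℝ) z - p :=
      (measurable_one.indicator hS).sub_const p
    have hmul := IndepFun.integral_fun_comp_mul_comp (f := fun z : L → Y => S.indicator (1 : (L → Y) → ℝ) z - p)
      (g := fun z : L → Y => S.indicator (1 : (L → Y) → ℝ) z - p) hind
      (measurable_pi_lambda _ fun t => measurable_pi_apply _).aemeasurable
      (measurable_pi_lambda _ fun t => measurable_pi_apply _).aemeasurable
      hmeas.aestronglyMeasurable hmeas.aestronglyMeasurable
    simp_rw [hform]
    refine hmul.trans ?_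
    have := hmean v hv
    simp_rw [hform] at this
    rw [this, zero_mul]

end Random

/-! ### Choosing a good labelling -/

section BernoulliModel

variable {G : Type*} [Group G] {Y : Type*}

/-- On `V` the map `σ g⁻¹` undoes `σ g`. -/
theorem IsSoficAt.injOn {d : ℕ} {T : Finset G} {σ : G → Fin d → Fin d} {V : Finset (Fin d)}
    (hV : ∀ v ∈ V, IsSoficAt T σ v) {g : G} (hg : g ∈ T) (hg' : g⁻¹ ∈ T) :
    Set.InjOn (σ g) V := by
  intro v hv w hw h
  rw [← (hV v hv).1, ← (hV w hw).1, ← inv_mul_cancel g, ← (hV v hv).2.1 _ hg' _ hg,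
    ← (hV w hw).2.1 _ hg' _ hg, h]

/-- If `σ s⁻¹ v = σ t⁻¹ v`, applying `σ s` shows that `σ (s * t⁻¹)` fixes `v`; freeness gives `s =
t`. -/
theorem IsSoficAt.injOn_inv {d : ℕ} {T : Finset G} {σ : G → Fin d → Fin d} {v : Fin d}
    (hv : IsSoficAt T σ v) {L : Set G} (hL : ∀ s ∈ L, s ∈ T) (hL' : ∀ s ∈ L, s⁻¹ ∈ T)
    (hLL : ∀ s ∈ L, ∀ t ∈ L, s * t⁻¹ ∈ T) : Set.InjOn (fun t => σ t⁻¹ v) L := by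
  intro s hs t ht h
  dsimp only at h
  by_contra hst
  refine hv.2.2 _ (hLL s hs t ht) (fun h1 => hst (mul_inv_eq_one.1 h1)) ?_
  rw [← hv.2.1 _ (hL s hs) _ (hL' t ht), ← h, hv.2.1 _ (hL s hs) _ (hL' s hs), mul_inv_cancel,
    hv.1]

/-- At `t`, the point of `σ h v` reads the label of `σ t⁻¹ (σ h v) = σ (h⁻¹ * t)⁻¹ v`, which is the
label the point of `v` reads at `h⁻¹ * t`. -/
theorem modelPoint_smul {d : ℕ} {T L L' : Finset G} {σ : G → Fin d → Fin d} {v : Fin d}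
    (hv : IsSoficAt T σ v) {h : G} (hh : h ∈ T) (hL : L ⊆ L') (hinv : ∀ t ∈ L', t⁻¹ ∈ T)
    (hhL : ∀ t ∈ L, h⁻¹ * t ∈ L') (S : Set (L → Y)) (y : Fin d × Option G → Y) :
    modelPoint L' σ (σ h v) y ∈ cylinder (α := fun _ : G => Y) L S ↔
      (fun t => modelPoint L' σ v y (h⁻¹ * t)) ∈ cylinder (α := fun _ : G => Y) L S := by
  rw [mem_cylinder, mem_cylinder]
  have : L.restrict (modelPoint L' σ (σ h v) y) =
      L.restrict (π := fun _ : G => Y) (fun t => modelPoint L' σ v y (h⁻¹ * t)) := by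
    funext t
    change modelPoint L' σ (σ h v) y t = modelPoint L' σ v y (h⁻¹ * t)
    rw [modelPoint_apply (hL t.2), modelPoint_apply (hhL t t.2),
      hv.2.1 _ (hinv t (hL t.2)) _ hh, mul_inv_rev, _root_.inv_inv]
  rw [this]

variable [MeasurableSpace Y] (ν : Measure Y) [IsProbabilityMeasure ν]

open scoped Classical in
/-- The first moment method for the labellings. -/
theorem exists_labelling {ι : Type*} [Fintype ι] {L' : Finset G} (L : ι → Finset G)
    (hL : ∀ i, L i ⊆ L') (S : ∀ i, Set (L i → Y)) (hS : ∀ i, MeasurableSet (S i))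
    {N : Set (G → Y)} (hN : MeasurableSet N) {d : ℕ} (hd : 0 < d) {σ : G → Fin d → Fin d}
    {V : Finset (Fin d)} (hinj : ∀ t ∈ L', Set.InjOn (σ t⁻¹) V)
    (hinj' : ∀ v ∈ V, Set.InjOn (fun t => σ t⁻¹ v) L') {h : ℝ}
    (hh : (Measure.infinitePi fun _ : G => ν).real N + (∑ i, ((L i).card : ℝ) ^ 2) / d ≤ h) :
    ∃ y : Fin d × Option G → Y,
      ((V.filter fun v => modelPoint L' σ v y ∈ N).card : ℝ) ≤ h * d ∧
      ∀ i, (((V.filter fun v => modelPoint L' σ v y ∈ cylinder (L i) (S i)).card : ℝ) -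
        (Measure.infinitePi fun _ : G => ν).real (cylinder (L i) (S i)) * V.card) ^ 2 ≤
          h * d ^ 2 := by
  set P := Measure.infinitePi fun _ : Fin d × Option G => ν with hP
  set μ := Measure.infinitePi fun _ : G => ν with hμ
  have hd' : (0 : ℝ) < d := by exact_mod_cast hd
  let A : (Fin d × Option G → Y) → ℝ := fun y => ∑ v ∈ V, N.indicator 1 (modelPoint L' σ v y)
  let D : ι → (Fin d × Option G → Y) → ℝ := fun i y =>
    ∑ v ∈ V, ((cylinder (L i) (S i)).indicator 1 (modelPoint L' σ v y) -
      μ.real (cylinder (L i) (S i)))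
  have hAi : ∀ v, Integrable (fun y => N.indicator (1 : (G → Y) → ℝ) (modelPoint L' σ v y)) P :=
    fun v => Integrable.of_bound ((measurable_one.indicator hN).comp
      (measurable_modelPoint L' σ v)).aestronglyMeasurable 1 (Eventually.of_forall fun y => by
        simp only [Set.indicator_apply, Pi.one_apply]
        split_ifs <;> simp)
  have hAint : Integrable A P := integrable_finsetSum _ fun v _ => hAi v
  have hA : ∫ y, A y ∂P ≤ μ.real N * d := by
    rw [integral_finsetSum _ fun v _ => hAi v]
    have : ∀ v ∈ V, ∫ y, N.indicator (1 : (G → Y) → ℝ) (modelPoint L' σ v y) ∂P = μ.real N := by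
      intro v hv
      rw [← integral_map (φ := modelPoint L' σ v) (f := N.indicator 1)
        (measurable_modelPoint L' σ v).aemeasurable
        (measurable_one.indicator hN).aestronglyMeasurable, hP,
        map_modelPoint ν L' σ v (hinj' v hv), integral_indicator_one hN]
    rw [Finset.sum_congr rfl this, Finset.sum_const, nsmul_eq_mul, mul_comm]
    have hVd : (V.card : ℝ) ≤ d := by
      have := V.card_le_univ
      rw [Fintype.card_fin] at this
      exact_mod_cast this
    gcongr
  have hDmeas : ∀ i, Measurable (D i) := fun i => Finset.measurable_sum _ fun v _ =>
    ((measurable_one.indicator ((hS i).cylinder (α := fun _ : G => Y) (L i))).comp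
      (measurable_modelPoint L' σ v)).sub_const _
  have hDb : ∀ i y, |D i y| ≤ V.card := by
    intro i y
    refine (Finset.abs_sum_le_sum_abs _ _).trans ?_
    have : ∀ v ∈ V, |(cylinder (α := fun _ : G => Y) (L i) (S i)).indicator (1 : (G → Y) → ℝ)
        (modelPoint L' σ v y) - μ.real (cylinder (L i) (S i))| ≤ 1 := by
      intro v _
      have h0 : 0 ≤ μ.real (cylinder (L i) (S i)) := measureReal_nonneg
      have h1 : μ.real (cylinder (L i) (S i)) ≤ 1 := measureReal_le_one
      simp only [Set.indicator_apply, Pi.one_apply]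
      rw [abs_le]
      split_ifs <;> constructor <;> linarith
    refine (Finset.sum_le_sum this).trans ?_
    simp
  have hDint : ∀ i, Integrable (fun y => D i y ^ 2) P := fun i =>
    Integrable.of_bound ((hDmeas i).pow_const 2).aestronglyMeasurable ((V.card : ℝ) ^ 2)
      (Eventually.of_forall fun y => by
        rw [Real.norm_eq_abs, abs_pow]
        exact pow_le_pow_left₀ (abs_nonneg _) (hDb i y) 2)
  have hD : ∀ i, ∫ y, D i y ^ 2 ∂P ≤ ((L i).card : ℝ) ^ 2 * d := fun i =>
    integral_frequency_sq_le ν (hL i) (hS i) hinj hinj'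
  -- All quantities to be controlled are nonnegative, so they are added into one random variable of
  -- mean at most `h`. A labelling where `H` does not exceed its mean controls them all at once.
  let H : (Fin d × Option G → Y) → ℝ := fun y => A y / d + ∑ i, D i y ^ 2 / (d : ℝ) ^ 2
  have hsumint : Integrable (fun y => ∑ i, D i y ^ 2 / (d : ℝ) ^ 2) P :=
    integrable_finsetSum _ fun i _ => (hDint i).div_const _
  have hHint : Integrable H P := (hAint.div_const _).add hsumint
  have hH : ∫ y, H y ∂P ≤ h := by
    refine le_trans ?_ hh
    rw [integral_add (hAint.div_const _) hsumint,
      integral_finsetSum _ fun i _ => (hDint i).div_const _, integral_div, Finset.sum_div]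
    refine add_le_add ?_ (Finset.sum_le_sum fun i _ => ?_)
    · rwa [div_le_iff₀ hd']
    · rw [integral_div, div_le_div_iff₀ (by positivity) hd']
      nlinarith [hD i]
  obtain ⟨y, hy⟩ := exists_le_integral hHint
  have hyh := hy.trans hH
  have hA0 : 0 ≤ A y := Finset.sum_nonneg fun v _ => Set.indicator_nonneg (fun _ _ => zero_le_one) _
  have hcount : ∀ C : Set (G → Y), ((V.filter fun v => modelPoint L' σ v y ∈ C).card : ℝ) =
      ∑ v ∈ V, C.indicator 1 (modelPoint L' σ v y) := by
    intro C
    rw [Finset.card_filter]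
    push_cast
    rfl
  refine ⟨y, ?_, fun i => ?_⟩
  · rw [hcount, ← div_le_iff₀ hd']
    refine le_trans ?_ hyh
    have : 0 ≤ ∑ i, D i y ^ 2 / (d : ℝ) ^ 2 := Finset.sum_nonneg fun i _ => by positivity
    simp only [H, A]
    linarith
  · rw [hcount]
    have e : ∑ v ∈ V, (cylinder (α := fun _ : G => Y) (L i) (S i)).indicator (1 : (G → Y) → ℝ)
        (modelPoint L' σ v y) - μ.real (cylinder (L i) (S i)) * V.card = D i y := by
      simp only [D, Finset.sum_sub_distrib, Finset.sum_const, nsmul_eq_mul]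
      ring
    rw [e, ← div_le_iff₀ (by positivity)]
    refine le_trans ?_ hyh
    have h1 := Finset.single_le_sum (f := fun i => D i y ^ 2 / (d : ℝ) ^ 2)
      (fun i _ => by positivity) (Finset.mem_univ i)
    have h2 : 0 ≤ A y / d := by positivity
    simp only [H]
    linarith

end BernoulliModel

theorem exists_symmetric_finset {G : Type*} [Group G] (M : Finset G) :
    ∃ M' T : Finset G, M ⊆ M' ∧ (1 : G) ∈ M' ∧
    (∀ g ∈ M', g⁻¹ ∈ M') ∧ M' ⊆ T ∧ ∀ g ∈ M', ∀ h ∈ M', g * h ∈ T := by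
  classical
  let M' := insert 1 (M ∪ M.image fun g => g⁻¹)
  refine ⟨M', (M' ×ˢ M').image fun p => p.1 * p.2, ?_, by simp [M'], ?_, ?_, ?_⟩
  · intro g hg
    simp [M', hg]
  · intro g hg
    simp only [M', Finset.mem_insert, Finset.mem_union, Finset.mem_image] at hg ⊢
    rcases hg with rfl | hg | ⟨h, hh, rfl⟩
    · simp
    · exact Or.inr (Or.inr ⟨g, hg, rfl⟩)
    · exact Or.inr (Or.inl (by rwa [_root_.inv_inv]))
  · intro g hg
    exact Finset.mem_image.2 ⟨(g, 1), Finset.mem_product.2 ⟨hg, by simp [M']⟩, by simp⟩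
  · intro g hg h hh
    exact Finset.mem_image.2 ⟨(g, h), Finset.mem_product.2 ⟨hg, hh⟩, rfl⟩

/-! ### Sofic models of Bernoulli actions for arbitrary events -/

section BernoulliModel

variable {G : Type*} [Group G] {Y : Type*} [MeasurableSpace Y]
  (ν : Measure Y) [IsProbabilityMeasure ν]

open scoped Classical in
/-- Bernoulli actions admit finite models over every sofic approximation of the group: any finite
family of events has the right frequencies, and is equivariant away from a small set. -/
theorem exists_bernoulli_model {ι : Type*} [Fintype ι] (C : ι → Set (BernoulliSpace G Y))
    (hC : ∀ i, MeasurableSet (C i)) (K : Finset G) {η : ℝ} (hη : 0 < η) :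
    ∃ (T : Finset G) (d₀ : ℕ), ∀ d ≥ d₀, ∀ (σ : G → Fin d → Fin d) (V : Finset (Fin d)),
      (∀ v ∈ V, IsSoficAt T σ v) →
      ∃ (x : Fin d → BernoulliSpace G Y) (V' : Finset (Fin d)), V' ⊆ V ∧
        ((V \ V').card : ℝ) ≤ η * d ∧
        (∀ v ∈ V', ∀ h ∈ K, σ h v ∈ V' → ∀ i, (x (σ h v) ∈ C i ↔ h • x v ∈ C i)) ∧
        ∀ i, |((V.filter fun v => x v ∈ C i).card : ℝ) - (bernoulliMeasure G ν).real (C i) * V.card|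
          ≤ η * d := by
  -- The bound `η / 4` serves for counts of points, `η ^ 2 / 4` for squared deviations of
  -- frequencies.
  set h : ℝ := min (η / 4) (η ^ 2 / 4) with hh
  have hh0 : 0 < h := by positivity
  set c : ℕ := (Fintype.card ι + 1) * ((insert 1 K).card + 1) with hc
  have hc0 : (0 : ℝ) < c := by positivity
  have hε : (0 : ℝ≥0∞) < ENNReal.ofReal (h / 2 / c) := by
    rw [ENNReal.ofReal_pos]
    positivity
  choose L S hS hLS using fun i => exists_cylinder_approx ν (G := G) (hC i) hε
  -- Outside `N`, every event `C i` may be replaced by its cylinder approximation, both at the point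
  -- and at its translates by `K`. The number `c` bounds the number of sets in this union and is
  -- nonzero.
  let N : Set (BernoulliSpace G Y) := ⋃ i, ⋃ g ∈ insert 1 K,
    (fun x => g • x) ⁻¹' (symmDiff (cylinder (α := fun _ : G => Y) (L i) (S i)) (C i))
  have hcyl : ∀ i, MeasurableSet (α := BernoulliSpace G Y)
      (symmDiff (cylinder (α := fun _ : G => Y) (L i) (S i)) (C i)) := fun i =>
    ((hS i).cylinder (α := fun _ : G => Y) (L i)).symmDiff (hC i)
  have hN : MeasurableSet N := MeasurableSet.iUnion fun i =>
    Finset.measurableSet_biUnion _ fun g _ => measurable_const_smul g (hcyl i)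
  have hμN : (bernoulliMeasure G ν).real N ≤ h / 2 := by
    have h1 : bernoulliMeasure G ν N ≤ ∑ i : ι, ∑ g ∈ insert 1 K, ENNReal.ofReal (h / 2 / c) := by
      refine (measure_iUnion_fintype_le _ _).trans (Finset.sum_le_sum fun i _ => ?_)
      refine (measure_biUnion_finset_le _ _).trans (Finset.sum_le_sum fun g _ => ?_)
      rw [measure_preimage_smul]
      exact (hLS i).le
    rw [Finset.sum_const, Finset.sum_const, Finset.card_univ, ← mul_smul, nsmul_eq_mul,
      ← ENNReal.ofReal_natCast, ← ENNReal.ofReal_mul (by positivity)] at h1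
    refine (ENNReal.toReal_le_of_le_ofReal (by positivity) h1).trans ?_
    have h2 : ((Fintype.card ι * (insert 1 K).card : ℕ) : ℝ) ≤ c := by
      exact_mod_cast Nat.mul_le_mul (Nat.le_succ _) (Nat.le_succ _)
    calc ((Fintype.card ι * (insert 1 K).card : ℕ) : ℝ) * (h / 2 / c) ≤ c * (h / 2 / c) := by
          gcongr
      _ = h / 2 := by field_simp
  let L₀ : Finset G := Finset.univ.biUnion L
  -- The coordinates `K⁻¹ L₀` are included because the coordinate `t` of `g • x` is the coordinate
  -- `g⁻¹ * t` of `x`.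
  let L' : Finset G := L₀ ∪ (K ×ˢ L₀).image fun p => p.1⁻¹ * p.2
  obtain ⟨M, T, hM, hM1, hMinv, hMT, hMM⟩ := exists_symmetric_finset (L' ∪ K)
  have hL'M : ∀ t ∈ L', t ∈ M := fun t ht => hM (Finset.mem_union_left _ ht)
  have hLL' : ∀ i, L i ⊆ L' := fun i t ht =>
    Finset.mem_union_left _ (Finset.mem_biUnion.2 ⟨i, Finset.mem_univ _, ht⟩)
  -- For `d` beyond this bound the variance term is at most `h / 2`; the other half of `h` is taken
  -- by the measure of `N`.
  refine ⟨T, ⌈2 * (∑ i, ((L i).card : ℝ) ^ 2) / h⌉₊ + 1, fun d hd σ V hV => ?_⟩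
  have hd0 : 0 < d := by omega
  have hd' : (0 : ℝ) < d := by exact_mod_cast hd0
  have hsum : (∑ i, ((L i).card : ℝ) ^ 2) / d ≤ h / 2 := by
    have h1 : 2 * (∑ i, ((L i).card : ℝ) ^ 2) / h ≤ d :=
      (Nat.le_ceil _).trans (by exact_mod_cast (Nat.le_succ _).trans hd)
    rw [div_le_iff₀ hh0] at h1
    rw [div_le_iff₀ hd']
    linarith
  obtain ⟨y, hy1, hy2⟩ := exists_labelling ν L hLL' S hS hN hd0 (σ := σ) (V := V) (h := h)
    (fun t ht => IsSoficAt.injOn hV (hMT (hMinv _ (hL'M t ht))) (by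
      rw [_root_.inv_inv]; exact hMT (hL'M t ht)))
    (fun v hv => (hV v hv).injOn_inv (fun s hs => hMT (hL'M s hs))
      (fun s hs => hMT (hMinv _ (hL'M s hs)))
      (fun s hs t ht => hMM _ (hL'M s hs) _ (hMinv _ (hL'M t ht))))
    (by
      have : (Measure.infinitePi fun _ : G => ν).real N ≤ h / 2 := hμN
      linarith)
  let x : Fin d → BernoulliSpace G Y := fun v => modelPoint L' σ v y
  have hxN : ∀ v, x v ∉ N → ∀ i, ∀ g ∈ insert 1 K,
      (g • x v ∈ cylinder (α := fun _ : G => Y) (L i) (S i) ↔ g • x v ∈ C i) := by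
    intro v hv i g hg
    simp only [N, Set.mem_iUnion, not_exists, Set.mem_preimage] at hv
    have := fun h => hv i g hg ((Set.mem_symmDiff (a := g • x v)).2 h)
    tauto
  have hh4 : h ≤ η / 4 := min_le_left _ _
  refine ⟨x, V.filter fun v => x v ∉ N, Finset.filter_subset _ _, ?_, ?_, fun i => ?_⟩
  · have : V \ (V.filter fun v => x v ∉ N) = V.filter fun v => x v ∈ N := by
      ext v
      simp only [Finset.mem_sdiff, Finset.mem_filter]
      tauto
    rw [this]
    refine hy1.trans ?_
    gcongr
    linarith
  · intro v hv g hg hv' i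
    obtain ⟨hvV, hvN⟩ := Finset.mem_filter.1 hv
    obtain ⟨hvV', hvN'⟩ := Finset.mem_filter.1 hv'
    have h1 := hxN _ hvN' i 1 (Finset.mem_insert_self _ _)
    rw [one_smul] at h1
    rw [← h1, ← hxN v hvN i g (Finset.mem_insert_of_mem hg)]
    refine modelPoint_smul (hV v hvV) (hMT (hM (Finset.mem_union_right _ hg))) (hLL' i)
      (fun t ht => hMT (hMinv _ (hL'M t ht))) (fun t ht => ?_) (S i) y
    refine Finset.mem_union_right _ (Finset.mem_image.2 ⟨(g, t), Finset.mem_product.2 ⟨hg, ?_⟩, rfl⟩)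
    exact Finset.mem_biUnion.2 ⟨i, Finset.mem_univ _, ht⟩
  · set Cy : Set (BernoulliSpace G Y) := cylinder (α := fun _ : G => Y) (L i) (S i) with hCy
    have hVd : (V.card : ℝ) ≤ d := by
      have := V.card_le_univ
      rw [Fintype.card_fin] at this
      exact_mod_cast this
    have h1 : |((V.filter fun v => x v ∈ Cy).card : ℝ) - (bernoulliMeasure G ν).real Cy * V.card|
        ≤ η / 2 * d := by
      refine abs_le_of_sq_le_sq (le_trans (hy2 i) ?_) (by positivity : (0 : ℝ) ≤ η / 2 * d)
      rw [mul_pow]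
      gcongr
      calc h ≤ η ^ 2 / 4 := min_le_right _ _
        _ = (η / 2) ^ 2 := by ring
    have h2 : |((V.filter fun v => x v ∈ C i).card : ℝ) - (V.filter fun v => x v ∈ Cy).card| ≤
        η / 4 * d := by
      have hbound : ∀ A B : Set (BernoulliSpace G Y), (∀ v, x v ∉ N → x v ∈ A → x v ∈ B) →
          ((V.filter fun v => x v ∈ A).card : ℝ) ≤ (V.filter fun v => x v ∈ B).card + η / 4 * d := by
        intro A B hAB
        have hsub : (V.filter fun v => x v ∈ A) ⊆
            (V.filter fun v => x v ∈ B) ∪ V.filter fun v => x v ∈ N := by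
          intro v hv
          obtain ⟨hvV, hvA⟩ := Finset.mem_filter.1 hv
          by_cases hvN : x v ∈ N
          · exact Finset.mem_union_right _ (Finset.mem_filter.2 ⟨hvV, hvN⟩)
          · exact Finset.mem_union_left _ (Finset.mem_filter.2 ⟨hvV, hAB v hvN hvA⟩)
        have h3 := (Finset.card_le_card hsub).trans (Finset.card_union_le _ _)
        have h4 : ((V.filter fun v => x v ∈ A).card : ℝ) ≤
            (V.filter fun v => x v ∈ B).card + (V.filter fun v => x v ∈ N).card := by
          exact_mod_cast h3
        have h5 : h * d ≤ η / 4 * d := by gcongr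
        have h6 : ((V.filter fun v => x v ∈ N).card : ℝ) ≤ h * d := hy1
        linarith
      have hiff : ∀ v, x v ∉ N → (x v ∈ Cy ↔ x v ∈ C i) := fun v hv => by
        have := hxN v hv i 1 (Finset.mem_insert_self _ _)
        rwa [one_smul] at this
      rw [abs_le]
      constructor
      · linarith [hbound Cy (C i) fun v hv => (hiff v hv).1]
      · linarith [hbound (C i) Cy fun v hv => (hiff v hv).2]
    have h3 : |(bernoulliMeasure G ν).real Cy - (bernoulliMeasure G ν).real (C i)| ≤ η / 4 := by
      have hCym : MeasurableSet Cy := (hS i).cylinder (α := fun _ : G => Y) (L i)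
      have h6 : h / 2 ≤ η / 4 := by linarith
      refine (abs_measureReal_sub_le_measureReal_symmDiff (μ := bernoulliMeasure G ν) (s := Cy)
        (t := C i) hCym.nullMeasurableSet (hC i).nullMeasurableSet).trans ?_
      refine le_trans (measureReal_mono (s₂ := N) ?_) (hμN.trans h6)
      intro z hz
      refine Set.mem_iUnion.2 ⟨i, Set.mem_iUnion₂.2 ⟨1, Finset.mem_insert_self _ _, ?_⟩⟩
      rw [Set.mem_preimage, one_smul]
      exact hz
    have h4 : |(bernoulliMeasure G ν).real Cy * V.card - (bernoulliMeasure G ν).real (C i) * V.card|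
        ≤ η / 4 * d := by
      rw [← sub_mul, abs_mul, Nat.abs_cast]
      gcongr
    -- Three errors are added: event to cylinder on the sample, concentration of the cylinder
    -- frequency, and cylinder to event in measure.
    calc _ = |(((V.filter fun v => x v ∈ C i).card : ℝ) - (V.filter fun v => x v ∈ Cy).card) +
          (((V.filter fun v => x v ∈ Cy).card : ℝ) - (bernoulliMeasure G ν).real Cy * V.card) +
          ((bernoulliMeasure G ν).real Cy * V.card -
            (bernoulliMeasure G ν).real (C i) * V.card)| := by
          congr 1
          ring
      _ ≤ η / 4 * d + η / 2 * d + η / 4 * d := by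
          refine (abs_add_le _ _).trans (add_le_add ((abs_add_le _ _).trans (add_le_add h2 h1)) h4)
      _ = η * d := by ring

end BernoulliModel

/-! ### From approximate homomorphisms of the group to almost free maps -/

open PMPGroupoid

open scoped Classical in
theorem card_off_diag_le {d : ℕ} {r : Matrix (Fin d) (Fin d) ℂ} (hr : r ∈ partialPermMatrices d)
    {δ : ℝ} (ht : ‖normTrace r - 1‖ < δ) :
    ((Finset.univ.filter fun v => r v v = 0).card : ℝ) ≤ δ * d := by
  rcases Nat.eq_zero_or_pos d with rfl | hd
  · simp
  have hd' : (0 : ℝ) < d := by exact_mod_cast hd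
  obtain ⟨f, rfl⟩ := exists_colMatrix hr
  rw [normTrace_colMatrix] at ht
  have h1 : (((Finset.univ.filter fun v => f v = some v).card : ℂ) / d - 1) =
      ((((Finset.univ.filter fun v => f v = some v).card : ℝ) / d - 1 : ℝ) : ℂ) := by
    push_cast
    rfl
  rw [h1, Complex.norm_real, Real.norm_eq_abs] at ht
  have h3 : 1 - δ < ((Finset.univ.filter fun v => f v = some v).card : ℝ) / d := by
    linarith [(abs_lt.1 ht).1]
  rw [lt_div_iff₀ hd'] at h3
  have h4 := Finset.card_filter_add_card_filter_not (s := Finset.univ) (fun v => f v = some v)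
  have h5 : (Finset.univ.filter fun v => colMatrix f v v = 0) =
      Finset.univ.filter fun v => ¬ f v = some v := by
    ext v
    simp [colMatrix_apply]
  rw [h5]
  rw [Finset.card_univ, Fintype.card_fin] at h4
  have h6 : ((Finset.univ.filter fun v => f v = some v).card : ℝ) +
      ((Finset.univ.filter fun v => ¬ f v = some v).card : ℝ) = d := by exact_mod_cast h4
  linarith

section Extraction

variable {G : Type*} [Group G]

/-- Each `f g` is defined at `v` because `f g⁻¹` after `f g` is `f 1`, which fixes `v`. The default
of `getD` therefore plays no role along the orbit of `v` and only makes the maps total. -/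
theorem isSoficAt_of_partial {d : ℕ} {T M T' : Finset G} (hTM : T ⊆ M)
    (hMinv : ∀ g ∈ M, g⁻¹ ∈ M) (hMT : M ⊆ T')
    (hTT : ∀ g ∈ T, ∀ h ∈ T, g * h ∈ M) {f : G → Fin d ≃. Fin d} {v : Fin d}
    (h1 : f 1 v = some v)
    (hmul : ∀ g ∈ M, ∀ h ∈ M, f (g * h) v = (f h v).bind (f g))
    (hfree : ∀ g ∈ T', g ≠ 1 → f g v ≠ some v) :
    (∀ g ∈ M, f g v = some ((f g v).getD v)) ∧
      IsSoficAt T (fun g w => (f g w).getD w) v := by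
  have hsome : ∀ g ∈ M, f g v = some ((f g v).getD v) := by
    intro g hg
    have := hmul g⁻¹ (hMinv g hg) g hg
    rw [inv_mul_cancel, h1] at this
    cases h : f g v with
    | none => simp [h] at this
    | some w => rfl
  refine ⟨hsome, by simp [h1], fun g hg h hh => ?_, fun g hg hg1 he => ?_⟩
  · have e1 := hsome _ (hTT g hg h hh)
    have e2 := hmul g (hTM hg) h (hTM hh)
    rw [hsome h (hTM hh), Option.bind_some] at e2
    rw [e2] at e1
    dsimp only
    rw [e1, Option.getD_some, e2]
  · have e1 := hsome g (hTM hg)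
    dsimp only at he
    rw [he] at e1
    exact hfree g (hMT (hTM hg)) hg1 e1

variable [Countable G] [MeasurableSpace G] [DiscreteMeasurableSpace G]

/-- An approximate homomorphism of the group algebra behaves like a free action of the group at
most points. -/
theorem exists_sofic_of_SA (T : Finset G) {κ : ℝ} (hκ : 0 < κ) :
    ∃ F : Set (groupGroupoid G).Op, (F.Finite ∧ F ⊆ (groupGroupoid G).partialIsometries) ∧
      ∃ δ : ℝ, 0 < δ ∧ ∀ d : ℕ, ∀ ψ ∈ (groupGroupoid G).SA F 2 δ d,
      ∃ (σ : G → Fin d → Fin d) (V : Finset (Fin d)), (∀ v ∈ V, IsSoficAt T σ v) ∧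
        ((Vᶜ).card : ℝ) ≤ κ * d ∧
        ∀ g ∈ T, ∀ a : (groupGroupoid G).linSpan, (a : (groupGroupoid G).Op) = groupTranslation G g →
          ψ a ∈ partialPermMatrices d ∧ ∀ v ∈ V, ∀ i, ψ a i v = if σ g v = i then 1 else 0 := by
  classical
  -- Two enlargements are needed: `M` is symmetric and contains all products from `T`, and `T'`
  -- contains all products from `M`.
  obtain ⟨M₁, T₁, hTM₁, -, -, hMT₁, hMM₁⟩ := exists_symmetric_finset T
  obtain ⟨M, T', hTM, hM1, hMinv, hMT, hMM⟩ := exists_symmetric_finset T₁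
  -- The constant counts the bad events, each of proportion at most `δ`: a failed product for a pair
  -- in `M`, a fixed point of a nontrivial element of `T'`, a point not fixed by the image of `1`.
  set c : ℝ := (M.card : ℝ) * M.card + T'.card + 1 with hc
  have hc0 : 0 < c := by positivity
  refine ⟨groupTranslation G '' T', ⟨T'.finite_toSet.image _, ?_⟩, min 1 (κ / c), by positivity,
    fun d ψ hψ => ?_⟩
  · rintro _ ⟨g, -, rfl⟩
    exact groupTranslation_mem g
  set δ := min 1 (κ / c) with hδ
  let lam : G → (groupGroupoid G).linSpan := fun g =>
    ⟨groupTranslation G g, Submodule.subset_span (groupTranslation_mem g)⟩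
  have hF : ∀ g ∈ T', (lam g : (groupGroupoid G).Op) ∈ groupTranslation G '' (T' : Set G) :=
    fun g hg => ⟨g, hg, rfl⟩
  have hmem : ∀ g ∈ T', ψ (lam g) ∈ partialPermMatrices d ∧
      ‖normTrace (ψ (lam g)) - (if g = 1 then 1 else 0)‖ < δ := fun g hg => by
    have := SA_apply_mem (by norm_num) hψ (hF g hg)
    rwa [show ((lam g : (groupGroupoid G).linSpan) : (groupGroupoid G).Op) = groupTranslation G g
      from rfl, trace_groupTranslation] at this
  have hf : ∀ g, ∃ f : Fin d ≃. Fin d, g ∈ T' → ψ (lam g) = colMatrix f := fun g => by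
    by_cases hg : g ∈ T'
    · obtain ⟨f, hf⟩ := exists_colMatrix (hmem g hg).1
      exact ⟨f, fun _ => hf⟩
    · exact ⟨⊥, fun h => (hg h).elim⟩
  choose f hf using hf
  let bad₁ : Finset (Fin d) := Finset.univ.filter fun v => ψ (lam 1) v v = 0
  let bad₂ : Finset (Fin d) := (M ×ˢ M).biUnion fun p => Finset.univ.filter fun v =>
    (ψ (lam (p.1 * p.2))).transpose v ≠ (ψ (lam p.1) * ψ (lam p.2)).transpose v
  let bad₃ : Finset (Fin d) := (T'.filter fun g => g ≠ 1).biUnion fun g =>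
    Finset.univ.filter fun v => ψ (lam g) v v ≠ 0
  have h1T : (1 : G) ∈ T' := hMT hM1
  have hb1 : (bad₁.card : ℝ) ≤ δ * d := by
    refine card_off_diag_le (hmem 1 h1T).1 ?_
    simpa using (hmem 1 h1T).2
  have hδ0 : 0 < δ := by positivity
  have hb2 : (bad₂.card : ℝ) ≤ M.card * M.card * (δ * d) := by
    have e1 : bad₂.card ≤ ∑ p ∈ M ×ˢ M,
        colDist (ψ (lam (p.1 * p.2))) (ψ (lam p.1) * ψ (lam p.2)) := Finset.card_biUnion_le
    have e2 : ∀ p ∈ M ×ˢ M,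
        (colDist (ψ (lam (p.1 * p.2))) (ψ (lam p.1) * ψ (lam p.2)) : ℝ) ≤ δ * d := by
      intro p hp
      obtain ⟨hp1, hp2⟩ := Finset.mem_product.1 hp
      refine (SA_mul le_rfl hψ (hF _ (hMT hp1)) (hF _ (hMT hp2)) (map_mul _ _ _)).1.trans ?_
      have : δ ^ 2 ≤ δ := by
        have h1 : δ ≤ 1 := min_le_left _ _
        nlinarith
      gcongr
    calc (bad₂.card : ℝ) ≤ ((∑ p ∈ M ×ˢ M,
          colDist (ψ (lam (p.1 * p.2))) (ψ (lam p.1) * ψ (lam p.2)) : ℕ) : ℝ) := by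
          exact_mod_cast e1
      _ ≤ ∑ p ∈ M ×ˢ M, δ * d := by
          rw [Nat.cast_sum]
          exact Finset.sum_le_sum e2
      _ = M.card * M.card * (δ * d) := by
          rw [Finset.sum_const, Finset.card_product, nsmul_eq_mul, Nat.cast_mul]
  have hb3 : (bad₃.card : ℝ) ≤ T'.card * (δ * d) := by
    have e1 : bad₃.card ≤ ∑ g ∈ T'.filter fun g => g ≠ 1,
        (Finset.univ.filter fun v => ψ (lam g) v v ≠ 0).card := Finset.card_biUnion_le
    calc (bad₃.card : ℝ) ≤ ((∑ g ∈ T'.filter fun g => g ≠ 1,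
          (Finset.univ.filter fun v => ψ (lam g) v v ≠ 0).card : ℕ) : ℝ) := by
          exact_mod_cast e1
      _ ≤ ∑ g ∈ T'.filter fun g => g ≠ 1, δ * d := by
          rw [Nat.cast_sum]
          refine Finset.sum_le_sum fun g hg => ?_
          obtain ⟨hg, hg1⟩ := Finset.mem_filter.1 hg
          have := (hmem g hg).2
          rw [if_neg hg1] at this
          refine (card_diag_le (hmem g hg).1 (t := 0) (δ := δ) (by simpa using this)).trans ?_
          rw [zero_add]
      _ ≤ T'.card * (δ * d) := by
          rw [Finset.sum_const, nsmul_eq_mul]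
          have : ((T'.filter fun g => g ≠ 1).card : ℝ) ≤ T'.card := by
            exact_mod_cast Finset.card_filter_le _ _
          gcongr
  have key : ∀ v, v ∉ bad₁ ∪ bad₂ ∪ bad₃ → (∀ g ∈ M, f g v = some ((f g v).getD v)) ∧
      IsSoficAt T (fun g w => (f g w).getD w) v := by
    intro v hv
    simp only [bad₁, bad₂, bad₃, Finset.mem_union, Finset.mem_filter, Finset.mem_univ, true_and,
      Finset.mem_biUnion, not_or, not_exists, not_and, not_not, Finset.mem_product] at hv
    obtain ⟨⟨h1, h2⟩, h3⟩ := hv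
    refine isSoficAt_of_partial ((hTM₁.trans hMT₁).trans hTM) hMinv hMT
      (fun g hg h hh => hTM (hMM₁ g (hTM₁ hg) h (hTM₁ hh))) ?_ ?_ ?_
    · rw [hf 1 h1T, colMatrix_apply] at h1
      by_contra hcon
      exact h1 (if_neg hcon)
    · intro g hg h hh
      have e := h2 (g, h) ⟨hg, hh⟩
      dsimp only at e
      rw [hf _ (hMM g hg h hh), hf g (hMT hg), hf h (hMT hh), colMatrix_mul] at e
      have e' : ∀ i, (f (g * h) v = some i ↔ ((f h).trans (f g)) v = some i) := fun i => by
        have := congrFun e i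
        simp only [Matrix.transpose_apply, colMatrix_apply] at this
        by_cases ha : f (g * h) v = some i <;> by_cases hb : ((f h).trans (f g)) v = some i <;>
          simp_all
      exact Option.ext fun i => e' i
    · intro g hg hg1 he
      have := h3 g ⟨hg, hg1⟩
      rw [hf g hg, colMatrix_apply, if_pos he] at this
      exact one_ne_zero this
  refine ⟨fun g w => (f g w).getD w, (bad₁ ∪ bad₂ ∪ bad₃)ᶜ,
    fun v hv => (key v (Finset.mem_compl.1 hv)).2, ?_, fun g hg a ha => ?_⟩
  · rw [compl_compl]
    have h1 : ((bad₁ ∪ bad₂ ∪ bad₃).card : ℝ) ≤ bad₁.card + bad₂.card + bad₃.card := by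
      exact_mod_cast (Finset.card_union_le _ _).trans
        (Nat.add_le_add_right (Finset.card_union_le _ _) _)
    have h2 : δ * c ≤ κ := by
      have : δ ≤ κ / c := min_le_right _ _
      rwa [le_div_iff₀ hc0] at this
    calc ((bad₁ ∪ bad₂ ∪ bad₃).card : ℝ)
        ≤ δ * d + M.card * M.card * (δ * d) + T'.card * (δ * d) := by linarith
      _ = (δ * c) * d := by rw [hc]; ring
      _ ≤ κ * d := by gcongr
  · obtain rfl : a = lam g := Subtype.ext ha
    have hgM : g ∈ M := hTM (hMT₁ (hTM₁ hg))
    refine ⟨(hmem g (hMT hgM)).1, fun v hv i => ?_⟩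
    have := (key v (Finset.mem_compl.1 hv)).1 g hgM
    rw [hf g (hMT hgM), colMatrix_apply, this]
    simp

end Extraction

open PMPGroupoid

/-! ### Matrices of bisections in a finite model -/

section ModelMatrix

/-- The set of ranges of the arrows of `B` with group element `g`. -/
def rangeFiberAt {G X : Type*} [Group G] [MulAction G X] (B : Set (G × X)) (g : G) : Set X :=
  {z | (g, g⁻¹ • z) ∈ B}

/-- A finite model of an action, given by points `x v` in the space for `v : Fin d`: on `Q₀` the
maps `σ g` behave like a free action, and the points `x v` are equivariant as far as the sets in `𝒞` can
tell. -/
structure IsActionModel {G X : Type*} [Group G] [MulAction G X] {d : ℕ} (K : Finset G)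
    (𝒞 : Set (Set X)) (σ : G → Fin d → Fin d) (x : Fin d → X) (Q₀ Q : Finset (Fin d)) : Prop where
  sofic : ∀ v ∈ Q₀, IsSoficAt K σ v
  injOn : ∀ g ∈ K, Set.InjOn (σ g) Q₀
  equivariant : ∀ v ∈ Q₀, ∀ h ∈ K, σ h v ∈ Q₀ → ∀ C ∈ 𝒞, (x (σ h v) ∈ C ↔ h • x v ∈ C)
  subset : Q ⊆ Q₀
  map_mem : ∀ v ∈ Q, ∀ h ∈ K, σ h v ∈ Q₀

open scoped Classical in
/-- The matrix of a set of arrows in a finite model of an action. -/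
def modelMatrix {G X : Type*} {d : ℕ} (K : Finset G) (σ : G → Fin d → Fin d) (x : Fin d → X)
    (Q : Finset (Fin d)) (B : Set (G × X)) : Matrix (Fin d) (Fin d) ℂ :=
  fun i v => if v ∈ Q ∧ ∃ g ∈ K, (g, x v) ∈ B ∧ σ g v = i then 1 else 0

section

variable {G X : Type*} {d : ℕ} {K : Finset G} {𝒞 : Set (Set X)} {σ : G → Fin d → Fin d}
  {x : Fin d → X} {Q₀ Q : Finset (Fin d)}

theorem modelMatrix_apply_of_forall_notMem {B : Set (G × X)} {v : Fin d}
    (h : v ∈ Q → ∀ g ∈ K, (g, x v) ∉ B) (i : Fin d) : modelMatrix K σ x Q B i v = 0 :=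
  if_neg fun ⟨hv, g, hg, hgB, _⟩ => h hv g hg hgB

theorem modelMatrix_slice_apply {g : G} (hg : g ∈ K) {v : Fin d} (hv : v ∈ Q) (i : Fin d) :
    modelMatrix K σ x Q (slice X g) i v = if σ g v = i then 1 else 0 := by
  unfold modelMatrix
  congr 1
  refine propext ⟨fun ⟨_, h, _, hhg, hi⟩ => ?_, fun hi => ⟨hv, g, hg, mem_slice.2 rfl, hi⟩⟩
  rwa [mem_slice.1 hhg] at hi

open scoped Classical in
-- By freeness only `g = 1` can return `v` to itself, so the diagonal counts the points whose unit
-- arrow lies in `B`.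
theorem IsActionModel.normTrace_modelMatrix [Group G] [MulAction G X]
    (hM : IsActionModel K 𝒞 σ x Q₀ Q) (h1 : (1 : G) ∈ K)
    (B : Set (G × X)) : normTrace (modelMatrix K σ x Q B) =
      ((Q.filter fun v => x v ∈ fiberAt B 1).card : ℂ) / d := by
  unfold normTrace Matrix.trace
  congr 1
  have : ∀ v, (modelMatrix K σ x Q B).diag v = if v ∈ Q ∧ x v ∈ fiberAt B 1 then 1 else 0 := by
    intro v
    rw [Matrix.diag_apply]
    unfold modelMatrix
    congr 1
    refine propext ⟨fun ⟨hv, g, hg, hgB, hgv⟩ => ⟨hv, ?_⟩,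
      fun ⟨hv, h⟩ => ⟨hv, 1, h1, h, (hM.sofic v (hM.subset hv)).1⟩⟩
    have hg1 : g = 1 := by
      by_contra hne
      exact (hM.sofic v (hM.subset hv)).2.2 g hg hne hgv
    rwa [hg1] at hgB
  simp only [this]
  rw [Finset.sum_boole]
  congr 2
  ext v
  simp

end

variable {G : Type*} [Group G] [Countable G] [MeasurableSpace G] [DiscreteMeasurableSpace G]
  {X : Type*} [MeasurableSpace X] [StandardBorelSpace X] [MulAction G X]
  [MeasurableConstSMul G X] {μ : Measure X} [IsProbabilityMeasure μ] [SMulInvariantMeasure G X μ]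

theorem eq_of_mem_bisection {B : Set (G × X)} (hB : (actionGroupoid G X μ).IsBisection B) {x : X}
    {g h : G} (hg : (g, x) ∈ B) (hh : (h, x) ∈ B) : g = h :=
  congrArg Prod.fst (hB.2.1 hg hh rfl)

theorem eq_of_mem_rangeFiberAt {B : Set (G × X)} (hB : (actionGroupoid G X μ).IsBisection B) {z : X}
    {g h : G} (hg : z ∈ rangeFiberAt B g) (hh : z ∈ rangeFiberAt B h) : g = h :=
  congrArg Prod.fst (hB.2.2 hg hh (by
    change g • g⁻¹ • z = h • h⁻¹ • z
    rw [smul_inv_smul, smul_inv_smul]))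

variable {d : ℕ} {K : Finset G} {𝒞 : Set (Set X)} {σ : G → Fin d → Fin d} {x : Fin d → X}
  {Q₀ Q : Finset (Fin d)}

open scoped Classical in
-- At most one arrow of `B` has source `x v`, so the sum has at most one nonzero term. The left side
-- is linear in the function, the right side is combinatorial.
theorem sum_indicator_eq_modelMatrix {B : Set (G × X)}
    (hB : (actionGroupoid G X μ).IsBisection B) (i v : Fin d) :
    (if v ∈ Q then ∑ g ∈ K, if σ g v = i then B.indicator (fun _ => (1 : ℂ)) (g, x v) else 0 else 0)
      = modelMatrix K σ x Q B i v := by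
  unfold modelMatrix
  by_cases hv : v ∈ Q
  · rw [if_pos hv]
    split_ifs with h
    · obtain ⟨-, g, hg, hgB, hgi⟩ := h
      rw [Finset.sum_eq_single_of_mem g hg]
      · rw [if_pos hgi, Set.indicator_of_mem hgB]
      · intro h _ hne
        rw [Set.indicator_of_notMem fun hh => hne (eq_of_mem_bisection hB hh hgB), ite_self]
    · refine Finset.sum_eq_zero fun g hg => ?_
      split_ifs with hgi
      · rw [Set.indicator_of_notMem fun hgB => h ⟨hv, g, hg, hgB, hgi⟩]
      · rfl
  · rw [if_neg hv, if_neg fun h => hv h.1]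

theorem modelMatrix_apply_of_mem {B : Set (G × X)} (hB : (actionGroupoid G X μ).IsBisection B)
    {g : G} (hg : g ∈ K) {v : Fin d} (hv : v ∈ Q) (hgB : (g, x v) ∈ B) (i : Fin d) :
    modelMatrix K σ x Q B i v = if σ g v = i then 1 else 0 := by
  unfold modelMatrix
  congr 1
  refine propext ⟨fun ⟨_, h, _, hhB, hi⟩ => ?_, fun hi => ⟨hv, g, hg, hgB, hi⟩⟩
  rwa [eq_of_mem_bisection hB hgB hhB]

/-- If `v` and `w` reach `i` through `g` and `h`, equivariance puts `x i` in the range fibres of `B`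
at both, so `g = h` because the range map is injective on `B`; then `v = w` since `σ g` is
injective. Membership in `I_d` is thus exact. -/
theorem IsActionModel.modelMatrix_mem (hM : IsActionModel K 𝒞 σ x Q₀ Q) {B : Set (G × X)}
    (hB : (actionGroupoid G X μ).IsBisection B) (h𝒞 : ∀ g ∈ K, rangeFiberAt B g ∈ 𝒞) :
    modelMatrix K σ x Q B ∈ partialPermMatrices d := by
  classical
  have key : ∀ v i, (v ∈ Q ∧ ∃ g ∈ K, (g, x v) ∈ B ∧ σ g v = i) →
      ∃ g ∈ K, v ∈ Q ∧ σ g v = i ∧ x i ∈ rangeFiberAt B g := by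
    rintro v _ ⟨hv, g, hg, hgB, rfl⟩
    refine ⟨g, hg, hv, rfl, (hM.equivariant v (hM.subset hv) g hg (hM.map_mem v hv g hg) _
      (h𝒞 g hg)).2 ?_⟩
    change (g, g⁻¹ • g • x v) ∈ B
    rwa [inv_smul_smul]
  let f : Fin d → Option (Fin d) := fun v =>
    if h : v ∈ Q ∧ ∃ g ∈ K, (g, x v) ∈ B then some (σ h.2.choose v) else none
  have hf : ∀ v i, f v = some i ↔ (v ∈ Q ∧ ∃ g ∈ K, (g, x v) ∈ B ∧ σ g v = i) := by
    intro v i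
    simp only [f]
    split_ifs with h
    · have hc := h.2.choose_spec
      rw [Option.some_inj]
      refine ⟨fun e => ⟨h.1, _, hc.1, hc.2, e⟩, fun ⟨_, g, _, hgB, e⟩ => ?_⟩
      rwa [eq_of_mem_bisection hB hc.2 hgB]
    · refine ⟨fun e => by simp at e, fun ⟨hv, g, hg, hgB, _⟩ => (h ⟨hv, g, hg, hgB⟩).elim⟩
  refine mem_partialPermMatrices_of_columns _ f (fun v w i hv hw => ?_) fun i v => ?_
  · obtain ⟨g, hg, hvQ, hgv, hgx⟩ := key v i ((hf v i).1 hv)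
    obtain ⟨h, hh, hwQ, hhw, hhx⟩ := key w i ((hf w i).1 hw)
    obtain rfl := eq_of_mem_rangeFiberAt hB hgx hhx
    exact hM.injOn g hg (hM.subset hvQ) (hM.subset hwQ) (hgv.trans hhw.symm)
  · unfold modelMatrix
    simp only [hf]

/-- The column follows the arrow `h` of `C` at `x v`, then the arrow `g` of `B` at `h • x v`.
Equivariance allows `x (σ h v)` in place of `h • x v`, and `h1`, `h2`, `h3` ensure that truncation
to `K` loses no arrow involved. -/
theorem IsActionModel.modelMatrix_setMul_apply (hM : IsActionModel K 𝒞 σ x Q₀ Q)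
    {B C : Set (G × X)} (hB : (actionGroupoid G X μ).IsBisection B)
    (hC : (actionGroupoid G X μ).IsBisection C) (h𝒞 : ∀ g ∈ K, fiberAt B g ∈ 𝒞) {v : Fin d}
    (hv : v ∈ Q) (hvQ : ∀ h ∈ K, σ h v ∈ Q) (h1 : ∀ h, (h, x v) ∈ C → h ∈ K)
    (h2 : ∀ h, (h, x v) ∈ (actionGroupoid G X μ).setMul B C → h ∈ K)
    (h3 : ∀ h, (h, x v) ∈ C → ∀ g, (g, h • x v) ∈ B → g ∈ K) (i : Fin d) :
    modelMatrix K σ x Q ((actionGroupoid G X μ).setMul B C) i v =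
      (modelMatrix K σ x Q B * modelMatrix K σ x Q C) i v := by
  have hBC := setMul_isBisection hB hC
  rw [Matrix.mul_apply]
  by_cases hCx : ∃ h, (h, x v) ∈ C
  · obtain ⟨h, hh⟩ := hCx
    have hhK := h1 h hh
    have hsum : ∑ j, modelMatrix K σ x Q B i j * modelMatrix K σ x Q C j v =
        modelMatrix K σ x Q B i (σ h v) := by
      simp only [modelMatrix_apply_of_mem hC hhK hv hh]
      simp
    rw [hsum]
    have hequi : ∀ g ∈ K, ((g, x (σ h v)) ∈ B ↔ (g, h • x v) ∈ B) := fun g hg =>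
      hM.equivariant v (hM.subset hv) h hhK (hM.map_mem v hv h hhK) _ (h𝒞 g hg)
    by_cases hBx : ∃ g, (g, h • x v) ∈ B
    · obtain ⟨g, hg⟩ := hBx
      have hgK := h3 h hh g hg
      have hgh : (g * h, x v) ∈ (actionGroupoid G X μ).setMul B C :=
        mem_setMul_action.2 ⟨g, h, rfl, hh, hg⟩
      rw [modelMatrix_apply_of_mem hBC (h2 _ hgh) hv hgh,
        modelMatrix_apply_of_mem hB hgK (hvQ h hhK) ((hequi g hgK).2 hg),
        (hM.sofic v (hM.subset hv)).2.1 g hgK h hhK]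
    · rw [modelMatrix_apply_of_forall_notMem, modelMatrix_apply_of_forall_notMem]
      · exact fun _ g hg hgB => hBx ⟨g, (hequi g hg).1 hgB⟩
      · intro _ k _ hkB
        obtain ⟨g, h', -, hh', hg⟩ := mem_setMul_action.1 hkB
        rw [eq_of_mem_bisection hC hh' hh] at hg
        exact hBx ⟨g, hg⟩
  · rw [modelMatrix_apply_of_forall_notMem, Finset.sum_eq_zero]
    · intro j _
      rw [modelMatrix_apply_of_forall_notMem (B := C) fun _ g _ hg => hCx ⟨g, hg⟩, mul_zero]
    · intro _ k _ hkB
      obtain ⟨_, h, -, hh, -⟩ := mem_setMul_action.1 hkB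
      exact hCx ⟨h, hh⟩

theorem IsActionModel.modelMatrix_units_apply (hM : IsActionModel K 𝒞 σ x Q₀ Q)
    (h1 : (1 : G) ∈ K) {v : Fin d} (hv : v ∈ Q) (i : Fin d) :
    modelMatrix K σ x Q (actionGroupoid G X μ).units i v = (1 : Matrix (Fin d) (Fin d) ℂ) i v := by
  classical
  rw [modelMatrix_apply_of_mem units_isBisection h1 hv (mem_units_action.2 rfl),
    (hM.sofic v (hM.subset hv)).1, Matrix.one_apply]
  simp only [eq_comm]

end ModelMatrix

/-! ### Actions carried by sofic approximations -/

open PMPGroupoid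

open scoped Classical in
/-- An action admits sofic models if every sofic approximation of the group carries points of the
space which are approximately equivariant and approximately equidistributed, as far as a given
finite family of measurable sets can tell. -/
def AdmitsSoficModels (G : Type*) [Group G] {X : Type*} [MeasurableSpace X] [MulAction G X]
    (μ : Measure X) : Prop :=
  ∀ 𝒞 : Set (Set X), 𝒞.Finite → (∀ C ∈ 𝒞, MeasurableSet C) → ∀ (K : Finset G) (η : ℝ), 0 < η →
    ∃ (T : Finset G) (d₀ : ℕ), ∀ d ≥ d₀, ∀ (σ : G → Fin d → Fin d) (V : Finset (Fin d)),
      (∀ v ∈ V, IsSoficAt T σ v) →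
      ∃ (x : Fin d → X) (V' : Finset (Fin d)), V' ⊆ V ∧ ((V \ V').card : ℝ) ≤ η * d ∧
        (∀ v ∈ V', ∀ h ∈ K, σ h v ∈ V' → ∀ C ∈ 𝒞, (x (σ h v) ∈ C ↔ h • x v ∈ C)) ∧
        ∀ C ∈ 𝒞, |((V.filter fun v => x v ∈ C).card : ℝ) - μ.real C * V.card| ≤ η * d

theorem bernoulli_admitsSoficModels {G : Type*} [Group G] {Y : Type*} [MeasurableSpace Y]
    (ν : Measure Y) [IsProbabilityMeasure ν] : AdmitsSoficModels G (bernoulliMeasure G ν) := by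
  intro 𝒞 hfin hmeas K η hη
  have := hfin.fintype
  obtain ⟨T, d₀, h⟩ := exists_bernoulli_model ν (fun C : 𝒞 => (C : Set (BernoulliSpace G Y)))
    (fun C => hmeas C C.2) K hη
  refine ⟨T, d₀, fun d hd σ V hV => ?_⟩
  obtain ⟨x, V', h1, h2, h3, h4⟩ := h d hd σ V hV
  exact ⟨x, V', h1, h2, fun v hv k hk hkv C hC => h3 v hv k hk hkv ⟨C, hC⟩, fun C hC => h4 ⟨C, hC⟩⟩

theorem IsSoficAt.mono {G : Type*} [Group G] {d : ℕ} {T T' : Finset G} (h : T ⊆ T')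
    {σ : G → Fin d → Fin d} {v : Fin d} (hv : IsSoficAt T' σ v) : IsSoficAt T σ v :=
  ⟨hv.1, fun g hg k hk => hv.2.1 g (h hg) k (h hk), fun g hg => hv.2.2 g (h hg)⟩

theorem measurableSet_rangeFiberAt {G X : Type*} [Group G] [MeasurableSpace G] [MeasurableSpace X]
    [MulAction G X] [MeasurableConstSMul G X] {B : Set (G × X)} (hB : MeasurableSet B) (g : G) :
    MeasurableSet (rangeFiberAt B g) :=
  measurable_const_smul g⁻¹ (measurableSet_fiberAt hB g)

/-- The set of sources of the arrows of `B` with range in `R`. -/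
def pullback {G X : Type*} [Group G] [MulAction G X] (B : Set (G × X)) (R : Set X) : Set X :=
  {x | ∃ h, (h, x) ∈ B ∧ h • x ∈ R}

theorem pullback_eq {G X : Type*} [Group G] [MulAction G X] (B : Set (G × X)) (R : Set X) :
    pullback B R = ⋃ h : G, fiberAt (B ∩ (fun p : G × X => p.1 • p.2) ⁻¹' R) h := by
  ext x
  rw [Set.mem_iUnion]
  rfl

/-! ### Truncation to finitely many group elements -/

section Tails

variable {G : Type*} [Group G] [Countable G] [MeasurableSpace G] [DiscreteMeasurableSpace G]
  {X : Type*} [MeasurableSpace X] [MulAction G X] [MeasurableConstSMul G X]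

theorem measurableSet_inter_rng {B : Set (G × X)} (hB : MeasurableSet B) {R : Set X}
    (hR : MeasurableSet R) : MeasurableSet (B ∩ (fun p : G × X => p.1 • p.2) ⁻¹' R) :=
  hB.inter ((measurable_from_prod_countable_right fun g => measurable_const_smul g :
    Measurable fun p : G × X => p.1 • p.2) hR)

theorem measurableSet_pullback {B : Set (G × X)} (hB : MeasurableSet B) {R : Set X}
    (hR : MeasurableSet R) : MeasurableSet (pullback B R) := by
  rw [pullback_eq]
  exact MeasurableSet.iUnion fun h => measurableSet_fiberAt (measurableSet_inter_rng hB hR) h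

variable [StandardBorelSpace X] {μ : Measure X} [IsProbabilityMeasure μ]
  [SMulInvariantMeasure G X μ]

/-- The arrows of `B` with range in `R` have one volume, computed by sources or by ranges; in terms
of ranges there is at most one arrow over each point of `R`. -/
theorem measure_pullback_le {B : Set (G × X)} (hB : (actionGroupoid G X μ).IsBisection B) {R : Set X}
    (hR : MeasurableSet R) : μ (pullback B R) ≤ μ R := by
  have hm := measurableSet_inter_rng hB.1 hR
  calc μ (pullback B R) ≤ ∑' h : G, μ (fiberAt (B ∩ (fun p : G × X => p.1 • p.2) ⁻¹' R) h) := by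
        rw [pullback_eq]
        exact measure_iUnion_le _
    _ = (actionGroupoid G X μ).vol (B ∩ (fun p : G × X => p.1 • p.2) ⁻¹' R) := (vol_action hm).symm
    _ = ∫⁻ z, (((actionGroupoid G X μ).rng ⁻¹' {z} ∩
          (B ∩ (fun p : G × X => p.1 • p.2) ⁻¹' R)).encard : ℝ≥0∞) ∂μ :=
        (actionGroupoid G X μ).vol_eq_rng _ hm
    _ ≤ ∫⁻ z, R.indicator 1 z ∂μ := by
        refine lintegral_mono fun z => ?_
        by_cases hz : z ∈ R
        · rw [Set.indicator_of_mem hz, Pi.one_apply, ← ENat.toENNReal_one, ENat.toENNReal_le,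
            Set.encard_le_one_iff]
          rintro a b ⟨ha, ha', -⟩ ⟨hb, hb', -⟩
          exact hB.2.2 ha' hb' (ha.trans hb.symm)
        · rw [Set.indicator_of_notMem hz, nonpos_iff_eq_zero, ENat.toENNReal_eq_zero,
            Set.encard_eq_zero]
          ext p
          simp only [Set.mem_inter_iff, Set.mem_empty_iff_false, iff_false, not_and]
          rintro hp - hpR
          exact hz ((show p.1 • p.2 = z from hp) ▸ hpR)
    _ = μ R := lintegral_indicator_one hR

/-- `R` collects the points with an arrow outside `K` in some `B`, and the points sent to such a
point by an arrow of some `C`. The second kind is small because pulling back along a bisection does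
not increase measure. -/
theorem exists_tail_set {ℬ : Set (Set (G × X))} (hfin : ℬ.Finite)
    (hℬ : ∀ B ∈ ℬ, (actionGroupoid G X μ).IsBisection B) (K₀ : Finset G) {θ : ℝ} (hθ : 0 < θ) :
    ∃ K : Finset G, K₀ ⊆ K ∧ ∃ R : Set X, MeasurableSet R ∧ μ.real R ≤ θ ∧
      ∀ x ∉ R, ∀ B ∈ ℬ, (∀ g, (g, x) ∈ B → g ∈ K) ∧
        ∀ C ∈ ℬ, ∀ h, (h, x) ∈ C → ∀ g, (g, h • x) ∈ B → g ∈ K := by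
  set c : ℕ := hfin.toFinset.card with hc
  -- There are `c` tails and `c * c` pullbacks of tails; the final `1` keeps the denominator
  -- positive.
  set τ : ℝ := θ / (c + c * c + 1) with hτ
  have hτ0 : 0 < τ := by positivity
  obtain ⟨K, hK, hKK₀⟩ : ∃ K : Finset G, (∀ B ∈ ℬ,
      μ (⋃ g ∈ (K : Set G)ᶜ, fiberAt B g) < ENNReal.ofReal τ) ∧ K₀ ⊆ K :=
    (((Filter.eventually_all_finite hfin).2 fun B hB =>
      eventually_measure_tail_lt (hℬ B hB) (by positivity)).and (eventually_ge_atTop K₀)).exists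
  let R₁ : Set X := ⋃ B ∈ hfin.toFinset, ⋃ g ∈ (K : Set G)ᶜ, fiberAt B g
  have hR₁ : MeasurableSet R₁ := Finset.measurableSet_biUnion _ fun B hB =>
    MeasurableSet.biUnion (Set.to_countable _) fun g _ =>
      measurableSet_fiberAt (hℬ B (hfin.mem_toFinset.1 hB)).1 g
  have hμR₁ : μ R₁ ≤ c * ENNReal.ofReal τ := by
    refine (measure_biUnion_finset_le _ _).trans ?_
    refine (Finset.sum_le_sum fun B hB => (hK B (hfin.mem_toFinset.1 hB)).le).trans (le_of_eq ?_)
    rw [Finset.sum_const, nsmul_eq_mul]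
  let R₂ : Set X := ⋃ C ∈ hfin.toFinset, pullback C R₁
  have hμR₂ : μ R₂ ≤ c * (c * ENNReal.ofReal τ) := by
    refine (measure_biUnion_finset_le _ _).trans ?_
    refine (Finset.sum_le_sum fun C hC =>
      (measure_pullback_le (hℬ C (hfin.mem_toFinset.1 hC)) hR₁).trans hμR₁).trans (le_of_eq ?_)
    rw [Finset.sum_const, nsmul_eq_mul]
  refine ⟨K, hKK₀, R₁ ∪ R₂, hR₁.union (Finset.measurableSet_biUnion _ fun C hC =>
    measurableSet_pullback (hℬ C (hfin.mem_toFinset.1 hC)).1 hR₁), ?_, fun x hx B hB => ?_⟩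
  · refine ENNReal.toReal_le_of_le_ofReal hθ.le (((measure_union_le _ _).trans
      (add_le_add hμR₁ hμR₂)).trans ?_)
    have : (c : ℝ≥0∞) * ENNReal.ofReal τ + c * (c * ENNReal.ofReal τ) =
        ENNReal.ofReal (c * τ + c * (c * τ)) := by
      rw [ENNReal.ofReal_add (by positivity) (by positivity), ENNReal.ofReal_mul (by positivity),
        ENNReal.ofReal_mul (by positivity), ENNReal.ofReal_mul (by positivity),
        ENNReal.ofReal_natCast]
    rw [this]
    refine ENNReal.ofReal_le_ofReal ?_
    calc c * τ + c * (c * τ) ≤ (c + c * c + 1) * τ := by nlinarith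
      _ = θ := by rw [hτ]; field_simp
  · have hmem : ∀ {y : X} {g : G}, (g, y) ∈ B → g ∉ K → y ∈ R₁ := fun {y g} hg hgK =>
      Set.mem_iUnion₂.2 ⟨B, hfin.mem_toFinset.2 hB, Set.mem_iUnion₂.2 ⟨g, hgK, hg⟩⟩
    rw [Set.mem_union, not_or] at hx
    refine ⟨fun g hg => ?_, fun C hC h hh g hg => ?_⟩
    · by_contra hgK
      exact hx.1 (hmem hg hgK)
    · by_contra hgK
      exact hx.2 (Set.mem_iUnion₂.2 ⟨C, hfin.mem_toFinset.2 hC, h, hh, hmem hg hgK⟩)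

end Tails

/-! ### Finite models for a finite family of bisections -/

section Models

open scoped Classical in
/-- The points all of whose translates lie in a given set are numerous. -/
theorem card_compl_core_le {G : Type*} {d : ℕ} (K : Finset G) {σ : G → Fin d → Fin d}
    {V Q : Finset (Fin d)} (hQV : Q ⊆ V) (hinj : ∀ g ∈ K, Set.InjOn (σ g) V) :
    ((Q.filter fun v => ∀ h ∈ K, σ h v ∈ Q)ᶜ).card ≤ (1 + K.card) * (Qᶜ).card := by
  have hsub : (Q.filter fun v => ∀ h ∈ K, σ h v ∈ Q)ᶜ ⊆
      Qᶜ ∪ K.biUnion fun h => Q.filter fun v => σ h v ∉ Q := by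
    intro v hv
    simp only [Finset.mem_compl, Finset.mem_filter, not_and, not_forall, Finset.mem_union,
      Finset.mem_biUnion] at hv ⊢
    by_cases hvQ : v ∈ Q
    · obtain ⟨h, hh, hhv⟩ := hv hvQ
      exact Or.inr ⟨h, hh, hvQ, hhv⟩
    · exact Or.inl hvQ
  refine (Finset.card_le_card hsub).trans ((Finset.card_union_le _ _).trans ?_)
  rw [add_mul, _root_.one_mul]
  refine Nat.add_le_add_left (Finset.card_biUnion_le_card_mul _ _ _ fun h hh => ?_) _
  refine Finset.card_le_card_of_injOn (σ h) (fun v hv => ?_) ?_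
  · exact Finset.mem_coe.2 (Finset.mem_compl.2 (Finset.mem_filter.1 hv).2)
  · exact (hinj h hh).mono fun v hv => hQV (Finset.mem_filter.1 hv).1

open scoped Classical in
theorem abs_card_filter_sub_le {d : ℕ} {V Q : Finset (Fin d)} (hQV : Q ⊆ V) (p : Fin d → Prop)
    {m η : ℝ} (hm0 : 0 ≤ m) (hm1 : m ≤ 1)
    (h : |((V.filter p).card : ℝ) - m * V.card| ≤ η) :
    |((Q.filter p).card : ℝ) - m * d| ≤ 2 * (Qᶜ).card + η := by
  have h1 : (V.filter p).card ≤ (Q.filter p).card + (Qᶜ).card := by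
    refine (Finset.card_le_card fun v hv => ?_).trans (Finset.card_union_le _ _)
    obtain ⟨-, hv⟩ := Finset.mem_filter.1 hv
    by_cases hvQ : v ∈ Q
    · exact Finset.mem_union_left _ (Finset.mem_filter.2 ⟨hvQ, hv⟩)
    · exact Finset.mem_union_right _ (Finset.mem_compl.2 hvQ)
  have h2 : (Q.filter p).card ≤ (V.filter p).card :=
    Finset.card_le_card (Finset.filter_subset_filter _ hQV)
  have h3 : d ≤ V.card + (Qᶜ).card := by
    have := Finset.card_add_card_compl V
    rw [Fintype.card_fin] at this
    have := Finset.card_le_card (Finset.compl_subset_compl.2 hQV)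
    omega
  have h4 : V.card ≤ d := by simpa using V.card_le_univ
  have h1' : ((V.filter p).card : ℝ) ≤ (Q.filter p).card + (Qᶜ).card := by exact_mod_cast h1
  have h2' : ((Q.filter p).card : ℝ) ≤ (V.filter p).card := by exact_mod_cast h2
  have h3' : (d : ℝ) ≤ V.card + (Qᶜ).card := by exact_mod_cast h3
  have h4' : (V.card : ℝ) ≤ d := by exact_mod_cast h4
  rw [abs_le] at h ⊢
  have h5 : m * d ≤ m * V.card + (Qᶜ).card := by nlinarith
  have h6 : m * V.card ≤ m * d := by gcongr
  constructor <;> linarith [h.1, h.2, Nat.cast_nonneg (α := ℝ) (Qᶜ).card]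

variable {G : Type*} [Group G] [Countable G] [MeasurableSpace G] [DiscreteMeasurableSpace G]
  {X : Type*} [MeasurableSpace X] [StandardBorelSpace X] [MulAction G X]
  [MeasurableConstSMul G X] {μ : Measure X} [IsProbabilityMeasure μ] [SMulInvariantMeasure G X μ]

open scoped Classical in
/-- Finite models of an action which are good enough for a given finite family of bisections. -/
theorem exists_action_model (hX : AdmitsSoficModels G μ) {ℬ : Set (Set (G × X))} (hfin : ℬ.Finite)
    (hℬ : ∀ B ∈ ℬ, (actionGroupoid G X μ).IsBisection B) {N : Set X} (hN : MeasurableSet N)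
    (hμN : μ N = 0) {K₀ : Finset G} (hK₀ : 1 ∈ K₀) {θ : ℝ} (hθ : 0 < θ) :
    ∃ K : Finset G, K₀ ⊆ K ∧ ∃ 𝒞 : Set (Set X),
      (∀ B ∈ ℬ, ∀ g ∈ K, fiberAt B g ∈ 𝒞 ∧ rangeFiberAt B g ∈ 𝒞) ∧
      ∃ T : Finset G, K ⊆ T ∧ ∃ κ : ℝ, 0 < κ ∧ ∃ d₀ : ℕ, ∀ d ≥ d₀,
      ∀ (σ : G → Fin d → Fin d) (V : Finset (Fin d)), (∀ v ∈ V, IsSoficAt T σ v) →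
      ((Vᶜ).card : ℝ) ≤ κ * d →
      ∃ (x : Fin d → X) (Q₀ Q bad : Finset (Fin d)), IsActionModel K 𝒞 σ x Q₀ Q ∧ Q₀ ⊆ V ∧
        (∀ v ∈ Q₀, x v ∉ N) ∧ ((Qᶜ).card : ℝ) ≤ θ * d ∧ (bad.card : ℝ) ≤ θ * d ∧
        (∀ v ∉ bad, v ∈ Q ∧ (∀ h ∈ K, σ h v ∈ Q) ∧ ∀ B ∈ ℬ, (∀ g, (g, x v) ∈ B → g ∈ K) ∧
          ∀ C ∈ ℬ, ∀ h, (h, x v) ∈ C → ∀ g, (g, h • x v) ∈ B → g ∈ K) ∧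
        ∀ B ∈ ℬ, |((Q.filter fun v => x v ∈ fiberAt B 1).card : ℝ) - μ.real (fiberAt B 1) * d| ≤
          θ * d := by
  obtain ⟨K, hK, R, hR, hμR, htail⟩ := exists_tail_set hfin hℬ K₀ (half_pos hθ)
  set k : ℝ := 1 + K.card with hk
  have hk1 : 1 ≤ k := by simp [hk]
  -- The complement of `Q₀` has at most `3 η d` points, and each of the two passages to a core costs
  -- a factor `k`. Comparing frequencies on `V` and `Q` doubles the loss and adds `η d`.
  set η : ℝ := θ / (2 * (6 * k ^ 2 + 1)) with hη
  have hη0 : 0 < η := by positivity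
  have hηθ : (6 * k ^ 2 + 1) * η = θ / 2 := by
    rw [hη]
    field_simp
  -- Including `N` and the tail `R` bounds the number of points falling into them; fibres over
  -- sources serve multiplicativity and trace, fibres over ranges the injectivity of columns.
  let 𝒞 : Set (Set X) := insert N (insert R (⋃ B ∈ ℬ, (fiberAt B '' K ∪ rangeFiberAt B '' K)))
  have h𝒞fin : 𝒞.Finite := ((hfin.biUnion fun B _ =>
    (K.finite_toSet.image _).union (K.finite_toSet.image _)).insert _).insert _
  have h𝒞 : ∀ B ∈ ℬ, ∀ g ∈ K, fiberAt B g ∈ 𝒞 ∧ rangeFiberAt B g ∈ 𝒞 := fun B hB g hg =>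
    ⟨Or.inr (Or.inr (Set.mem_iUnion₂.2 ⟨B, hB, Or.inl ⟨g, hg, rfl⟩⟩)),
      Or.inr (Or.inr (Set.mem_iUnion₂.2 ⟨B, hB, Or.inr ⟨g, hg, rfl⟩⟩))⟩
  have h𝒞meas : ∀ C ∈ 𝒞, MeasurableSet C := by
    rintro C (rfl | rfl | hC)
    · exact hN
    · exact hR
    · obtain ⟨B, hB, ⟨g, -, rfl⟩ | ⟨g, -, rfl⟩⟩ := Set.mem_iUnion₂.1 hC
      · exact measurableSet_fiberAt (hℬ B hB).1 g
      · exact measurableSet_rangeFiberAt (hℬ B hB).1 g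
  obtain ⟨T₀, d₀, hmodel⟩ := hX 𝒞 h𝒞fin h𝒞meas K η hη0
  obtain ⟨M, -, hM, -, hMinv, -, -⟩ := exists_symmetric_finset K
  refine ⟨K, hK, 𝒞, h𝒞, T₀ ∪ M, hM.trans Finset.subset_union_right, η, hη0, d₀,
    fun d hd σ V hV hVc => ?_⟩
  have hMT : ∀ g ∈ M, g ∈ T₀ ∪ M := fun g hg => Finset.mem_union_right _ hg
  obtain ⟨x, V', hV'V, hV'c, hequi, hfreq⟩ := hmodel d hd σ V
    fun v hv => (hV v hv).mono Finset.subset_union_left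
  have hinj : ∀ g ∈ K, Set.InjOn (σ g) V := fun g hg =>
    IsSoficAt.injOn hV (hMT g (hM hg)) (hMT _ (hMinv g (hM hg)))
  -- Equivariance is used between points of `Q₀`, matrices are supported on columns in `Q`, and two
  -- consecutive arrows are followed from `Q'`.
  let Q₀ : Finset (Fin d) := V'.filter fun v => x v ∉ N
  let Q : Finset (Fin d) := Q₀.filter fun v => ∀ h ∈ K, σ h v ∈ Q₀
  let Q' : Finset (Fin d) := Q.filter fun v => ∀ h ∈ K, σ h v ∈ Q
  have hQ₀V' : Q₀ ⊆ V' := Finset.filter_subset _ _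
  have hQ₀V : Q₀ ⊆ V := hQ₀V'.trans hV'V
  have hQQ₀ : Q ⊆ Q₀ := Finset.filter_subset _ _
  have hVd : (V.card : ℝ) ≤ d := by
    have := V.card_le_univ
    rw [Fintype.card_fin] at this
    exact_mod_cast this
  have hNc : ((V.filter fun v => x v ∈ N).card : ℝ) ≤ η * d := by
    have := hfreq N (Or.inl rfl)
    rw [Measure.real, hμN, ENNReal.toReal_zero, zero_mul, sub_zero, Nat.abs_cast] at this
    exact this
  have hRc : ((V.filter fun v => x v ∈ R).card : ℝ) ≤ (θ / 2 + η) * d := by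
    have h1 := (abs_le.1 (hfreq R (Or.inr (Or.inl rfl)))).2
    have h2 : μ.real R * V.card ≤ θ / 2 * d := by gcongr
    linarith
  have hQ₀c : ((Q₀ᶜ).card : ℝ) ≤ 3 * η * d := by
    have hsub : Q₀ᶜ ⊆ Vᶜ ∪ (V \ V') ∪ V.filter fun v => x v ∈ N := by
      intro v hv
      simp only [Q₀, Finset.mem_compl, Finset.mem_filter, not_and, not_not, Finset.mem_union,
        Finset.mem_sdiff] at hv ⊢
      tauto
    have h1 := (Finset.card_le_card hsub).trans ((Finset.card_union_le _ _).trans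
      (Nat.add_le_add_right (Finset.card_union_le _ _) _))
    have h2 : ((Q₀ᶜ).card : ℝ) ≤ (Vᶜ).card + (V \ V').card + (V.filter fun v => x v ∈ N).card := by
      exact_mod_cast h1
    linarith
  have hQc : ((Qᶜ).card : ℝ) ≤ k * (3 * η * d) := by
    have h1 : ((Qᶜ).card : ℝ) ≤ k * (Q₀ᶜ).card := by
      have h2 : (Qᶜ).card ≤ (1 + K.card) * (Q₀ᶜ).card := card_compl_core_le K hQ₀V hinj
      rw [hk]
      exact_mod_cast h2
    exact h1.trans (by gcongr)
  have hQ'c : ((Q'ᶜ).card : ℝ) ≤ k * (k * (3 * η * d)) := by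
    have h1 : ((Q'ᶜ).card : ℝ) ≤ k * (Qᶜ).card := by
      have h2 : (Q'ᶜ).card ≤ (1 + K.card) * (Qᶜ).card :=
        card_compl_core_le K (hQQ₀.trans hQ₀V) hinj
      rw [hk]
      exact_mod_cast h2
    exact h1.trans (by gcongr)
  have hηd : 0 ≤ η * d := by positivity
  have hkk : k * (η * d) ≤ k ^ 2 * (η * d) := by
    gcongr
    nlinarith
  have hηθd : 6 * (k ^ 2 * (η * d)) + η * d = θ / 2 * d := by
    rw [← hηθ]
    ring
  have hkηd : 0 ≤ k ^ 2 * (η * d) := by positivity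
  have hθd : 0 ≤ θ * d := by positivity
  refine ⟨x, Q₀, Q, Q'ᶜ ∪ V.filter fun v => x v ∈ R, ⟨?_, ?_, ?_, hQQ₀, ?_⟩, hQ₀V, ?_, ?_, ?_, ?_, ?_⟩
  · exact fun v hv => (hV v (hQ₀V hv)).mono (hM.trans Finset.subset_union_right)
  · exact fun g hg => (hinj g hg).mono hQ₀V
  · exact fun v hv h hh hhv C hC => hequi v (hQ₀V' hv) h hh (hQ₀V' hhv) C hC
  · exact fun v hv => (Finset.mem_filter.1 hv).2
  · exact fun v hv => (Finset.mem_filter.1 hv).2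
  · linarith
  · have h1 : (((Q'ᶜ ∪ V.filter fun v => x v ∈ R : Finset (Fin d)).card : ℕ) : ℝ) ≤
        (Q'ᶜ).card + (V.filter fun v => x v ∈ R).card := by
      exact_mod_cast Finset.card_union_le _ _
    linarith
  · intro v hv
    rw [Finset.mem_union, not_or, Finset.mem_compl, not_not] at hv
    obtain ⟨hvQ, hvQ'⟩ := Finset.mem_filter.1 hv.1
    refine ⟨hvQ, hvQ', htail (x v) fun hvR => hv.2 (Finset.mem_filter.2 ⟨hQ₀V (hQQ₀ hvQ), hvR⟩)⟩
  · intro B hB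
    have h1 := abs_card_filter_sub_le (hQQ₀.trans hQ₀V) (fun v => x v ∈ fiberAt B 1)
      measureReal_nonneg measureReal_le_one (hfreq _ (h𝒞 B hB 1 (hK hK₀)).1)
    linarith

end Models

/-! ### Linear representatives and sets of arrows of words -/

namespace PMPGroupoid

variable {A X : Type*} [MeasurableSpace A] [StandardBorelSpace A]
  [MeasurableSpace X] [StandardBorelSpace X] {𝒢 : PMPGroupoid A X}

/-- Square integrable functions have representatives that depend linearly on their classes. -/
theorem exists_linear_lift (𝒢 : PMPGroupoid A X) :
    ∃ L : 𝒢.L2 →ₗ[ℂ] (A → ℂ), ∀ ξ : 𝒢.L2, L ξ =ᵐ[𝒢.vol] ξ := by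
  -- A Hamel basis suffices: the lift needs no continuity, and agreement almost everywhere passes to
  -- finite linear combinations.
  let b := Module.Basis.ofVectorSpace ℂ 𝒢.L2
  refine ⟨b.constr ℂ fun i => (b i : A → ℂ), fun ξ => ?_⟩
  have hξ : ξ ∈ Submodule.span ℂ (Set.range b) := by
    rw [b.span_eq]
    trivial
  induction hξ using Submodule.span_induction with
  | mem ξ h =>
    obtain ⟨i, rfl⟩ := h
    rw [Module.Basis.constr_basis]
  | zero =>
    rw [map_zero]
    exact (Lp.coeFn_zero ℂ 2 𝒢.vol).symm
  | add ξ ζ _ _ h1 h2 =>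
    rw [map_add]
    exact (h1.add h2).trans (Lp.coeFn_add ξ ζ).symm
  | smul c ξ _ h =>
    rw [map_smul]
    exact (h.const_smul c).trans (Lp.coeFn_smul c ξ).symm

/-- The set of arrows of a word. -/
def wordSet (β : 𝒢.linSpan → Set A) (l : List 𝒢.linSpan) : Set A :=
  l.foldr (fun s C => 𝒢.setMul (β s) C) 𝒢.units

theorem wordSet_singleton (β : 𝒢.linSpan → Set A) (s : 𝒢.linSpan) : wordSet β [s] = β s :=
  setMul_units _

theorem wordSet_spec {β : 𝒢.linSpan → Set A} {S : Set 𝒢.Op}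
    (hβ : ∀ s : 𝒢.linSpan, (s : 𝒢.Op) ∈ S → 𝒢.IsBisection (β s) ∧ ∀ C ξ, 𝒢.IsBisection C →
      𝒢.IsIndicator C ξ → 𝒢.IsIndicator (𝒢.setMul (β s) C) ((s : 𝒢.Op) ξ))
    (l : List 𝒢.linSpan) (hl : ∀ s ∈ l, (s : 𝒢.Op) ∈ S) :
    𝒢.IsBisection (wordSet β l) ∧
      𝒢.IsIndicator (wordSet β l) ((l.map Subtype.val).prod 𝒢.unitVector) := by
  induction l with
  | nil => exact ⟨units_isBisection, isIndicator_unitVector⟩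
  | cons s l ih =>
    obtain ⟨h1, h2⟩ := ih fun t ht => hl t (List.mem_cons_of_mem _ ht)
    obtain ⟨h3, h4⟩ := hβ s (hl s List.mem_cons_self)
    refine ⟨setMul_isBisection h3 h1, ?_⟩
    rw [List.map_cons, List.prod_cons]
    exact h4 _ _ h1 h2

end PMPGroupoid

open PMPGroupoid

/-! ### The linear map of a finite model is an approximate homomorphism -/

section ModelMap

variable {G : Type*} [Group G] [Countable G] [MeasurableSpace G] [DiscreteMeasurableSpace G]
  {X : Type*} [MeasurableSpace X] [StandardBorelSpace X] [MulAction G X]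
  [MeasurableConstSMul G X] {μ : Measure X} [IsProbabilityMeasure μ] [SMulInvariantMeasure G X μ]

open scoped Classical in
/-- The linear map of a finite model of an action. -/
def modelMap (L : (actionGroupoid G X μ).L2 →ₗ[ℂ] (G × X → ℂ)) {d : ℕ} (K : Finset G)
    (σ : G → Fin d → Fin d) (x : Fin d → X) (Q : Finset (Fin d)) :
    (actionGroupoid G X μ).linSpan →ₗ[ℂ] Matrix (Fin d) (Fin d) ℂ where
  toFun a := Matrix.of fun i v => if v ∈ Q then ∑ g ∈ K, if σ g v = i then
    L ((a : (actionGroupoid G X μ).Op) (actionGroupoid G X μ).unitVector) (g, x v) else 0 else 0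
  map_add' a b := by
    ext i v
    rw [Matrix.add_apply]
    simp only [Matrix.of_apply]
    split_ifs with hv
    · rw [← Finset.sum_add_distrib]
      refine Finset.sum_congr rfl fun g _ => ?_
      split_ifs
      · rw [Submodule.coe_add, add_apply, map_add, Pi.add_apply]
      · rw [add_zero]
    · rw [add_zero]
  map_smul' c a := by
    ext i v
    rw [Matrix.smul_apply, RingHom.id_apply]
    simp only [Matrix.of_apply]
    split_ifs with hv
    · rw [Finset.smul_sum]
      refine Finset.sum_congr rfl fun g _ => ?_
      split_ifs
      · rw [Submodule.coe_smul, smul_apply, map_smul, Pi.smul_apply]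
      · rw [smul_zero]
    · rw [smul_zero]

theorem modelMap_eq_modelMatrix {L : (actionGroupoid G X μ).L2 →ₗ[ℂ] (G × X → ℂ)} {d : ℕ}
    {K : Finset G} {σ : G → Fin d → Fin d} {x : Fin d → X} {Q : Finset (Fin d)} {B : Set (G × X)}
    (hB : (actionGroupoid G X μ).IsBisection B) {a : (actionGroupoid G X μ).linSpan}
    (h : ∀ v ∈ Q, ∀ g, L ((a : (actionGroupoid G X μ).Op) (actionGroupoid G X μ).unitVector) (g, x v) =
      B.indicator (fun _ => 1) (g, x v)) :
    modelMap L K σ x Q a = modelMatrix K σ x Q B := by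
  classical
  ext i v
  rw [← sum_indicator_eq_modelMatrix hB]
  change (if v ∈ Q then _ else _) = _
  by_cases hv : v ∈ Q
  · simp only [if_pos hv, h v hv]
  · rw [if_neg hv, if_neg hv]

/-- The vectors are finitely many and `G` is countable, so one null set of points contains all
disagreements between the chosen representatives and the characteristic functions. -/
theorem exists_null_set {L : (actionGroupoid G X μ).L2 →ₗ[ℂ] (G × X → ℂ)}
    (hL : ∀ ξ : (actionGroupoid G X μ).L2, L ξ =ᵐ[(actionGroupoid G X μ).vol] ξ)
    {𝒲 : Set (Set (G × X) × (actionGroupoid G X μ).L2)} (hfin : 𝒲.Finite)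
    (h𝒲 : ∀ p ∈ 𝒲, (actionGroupoid G X μ).IsIndicator p.1 p.2) :
    ∃ N : Set X, MeasurableSet N ∧ μ N = 0 ∧ ∀ x ∉ N, ∀ p ∈ 𝒲, ∀ g,
      L p.2 (g, x) = p.1.indicator (fun _ => 1) (g, x) := by
  have h1 : ∀ᵐ x ∂μ, ∀ p ∈ 𝒲, ∀ g, L p.2 (g, x) = p.1.indicator (fun _ => 1) (g, x) := by
    refine (ae_ball_iff hfin.countable).2 fun p hp => ?_
    have h2 : ∀ᵐ z ∂(Measure.count.prod μ : Measure (G × X)),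
        L p.2 z = p.1.indicator (fun _ => 1) z := (hL p.2).trans (h𝒲 p hp)
    have h3 := Measure.ae_ae_of_ae_prod h2
    refine ae_all_iff.2 fun g => ?_
    rw [Measure.ae_count_iff] at h3
    exact h3 g
  refine ⟨toMeasurable μ {x | ¬ ∀ p ∈ 𝒲, ∀ g, L p.2 (g, x) = p.1.indicator (fun _ => 1) (g, x)},
    measurableSet_toMeasurable _ _, (measure_toMeasurable _).trans h1, fun x hx => ?_⟩
  by_contra hcon
  exact hx (subset_toMeasurable _ _ hcon)

theorem vol_real_units_inter {B : Set (G × X)} (hB : MeasurableSet B) :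
    (actionGroupoid G X μ).vol.real ((actionGroupoid G X μ).units ∩ B) = μ.real (fiberAt B 1) := by
  rw [Measure.real, Measure.real, vol_action ((actionGroupoid G X μ).measurableSet_units.inter hB),
    tsum_eq_single 1]
  · congr 2
    ext x
    exact ⟨fun h => h.2, fun h => ⟨mem_units_action.2 rfl, h⟩⟩
  · intro g hg
    have : {x : X | (g, x) ∈ (actionGroupoid G X μ).units ∩ B} = ∅ := by
      ext x
      simp only [Set.mem_ofPred_eq, Set.mem_inter_iff, mem_units_action, Set.mem_empty_iff_false,
        iff_false, not_and]
      exact fun h => (hg h).elim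
    rw [this, measure_empty]

theorem word_length_bound {n k b d : ℕ} {θ δ : ℝ} (hk : k ≤ n) (hd : 0 < d) (hb : (b : ℝ) ≤ θ * d)
    (hθ : 2 * (n + 1) * θ < δ ^ 2) {c : ℕ} (hc : c ≤ (k + 1) * b) : 2 * (c : ℝ) < δ ^ 2 * d := by
  have hd' : (0 : ℝ) < d := by exact_mod_cast hd
  have hk' : (k : ℝ) ≤ n := by exact_mod_cast hk
  have hc' : (c : ℝ) ≤ (k + 1) * b := by exact_mod_cast hc
  calc 2 * (c : ℝ) ≤ 2 * ((k + 1) * b) := by gcongr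
    _ ≤ 2 * ((n + 1) * (θ * d)) := by gcongr
    _ = 2 * (n + 1) * θ * d := by ring
    _ < δ ^ 2 * d := by gcongr

variable {F : Set (actionGroupoid G X μ).Op} {n d : ℕ}
  {φ : (actionGroupoid G X μ).linSpan →ₗ[ℂ] Matrix (Fin d) (Fin d) ℂ}
  {β : (actionGroupoid G X μ).linSpan → Set (G × X)} {ℬ : Set (Set (G × X))}
  {K : Finset G} {𝒞 : Set (Set X)} {σ : G → Fin d → Fin d} {x : Fin d → X}
  {Q₀ Q bad : Finset (Fin d)}

/-- Each letter adds at most one copy of `bad`, where multiplicativity can fail, and the empty word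
adds one more. -/
theorem colDist_word_le
    (hℬ : ∀ B ∈ ℬ, (actionGroupoid G X μ).IsBisection B)
    (hW : ∀ l : List (actionGroupoid G X μ).linSpan, l.length ≤ n → (∀ s ∈ l,
      (s : (actionGroupoid G X μ).Op) ∈ F ∪ ContinuousLinearMap.adjoint '' F) → wordSet β l ∈ ℬ)
    (hφ : ∀ s : (actionGroupoid G X μ).linSpan,
      (s : (actionGroupoid G X μ).Op) ∈ F ∪ ContinuousLinearMap.adjoint '' F →
      φ s = modelMatrix K σ x Q (β s))
    (hM : IsActionModel K 𝒞 σ x Q₀ Q) (h1 : (1 : G) ∈ K)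
    (h𝒞 : ∀ B ∈ ℬ, ∀ g ∈ K, fiberAt B g ∈ 𝒞)
    (hbad : ∀ v ∉ bad, v ∈ Q ∧ (∀ h ∈ K, σ h v ∈ Q) ∧ ∀ B ∈ ℬ, (∀ g, (g, x v) ∈ B → g ∈ K) ∧
      ∀ C ∈ ℬ, ∀ h, (h, x v) ∈ C → ∀ g, (g, h • x v) ∈ B → g ∈ K)
    (l : List (actionGroupoid G X μ).linSpan) (hln : l.length ≤ n) (hl : ∀ s ∈ l,
      (s : (actionGroupoid G X μ).Op) ∈ F ∪ ContinuousLinearMap.adjoint '' F) :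
    colDist (modelMatrix K σ x Q (wordSet β l)) (l.map φ).prod ≤ (l.length + 1) * bad.card := by
  induction l with
  | nil =>
    rw [List.map_nil, List.prod_nil, List.length_nil, zero_add, _root_.one_mul]
    exact colDist_le_card bad fun v hv i => hM.modelMatrix_units_apply h1 (hbad v hv).1 i
  | cons s l ih =>
    have hsF := hl s List.mem_cons_self
    have hl' : ∀ t ∈ l, (t : (actionGroupoid G X μ).Op) ∈ F ∪ ContinuousLinearMap.adjoint '' F :=
      fun t ht => hl t (List.mem_cons_of_mem _ ht)
    rw [List.length_cons] at hln ⊢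
    have hln' : l.length ≤ n := (Nat.le_succ _).trans hln
    have hsℬ : β s ∈ ℬ := by
      rw [← wordSet_singleton β s]
      exact hW [s] (le_trans (Nat.succ_le_succ (Nat.zero_le _)) hln) fun t ht => by
        rw [List.mem_singleton.1 ht]
        exact hsF
    have hlℬ := hW l hln' hl'
    have hslℬ := hW (s :: l) (by rw [List.length_cons]; exact hln) hl
    rw [List.map_cons, List.prod_cons, hφ s hsF]
    have e1 : colDist (modelMatrix K σ x Q (wordSet β (s :: l)))
        (modelMatrix K σ x Q (β s) * modelMatrix K σ x Q (wordSet β l)) ≤ bad.card := by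
      refine colDist_le_card bad fun v hv i => ?_
      obtain ⟨hv1, hv2, hv3⟩ := hbad v hv
      exact hM.modelMatrix_setMul_apply (hℬ _ hsℬ) (hℬ _ hlℬ) (h𝒞 _ hsℬ) hv1 hv2 (hv3 _ hlℬ).1
        (hv3 _ hslℬ).1 (fun h hh g hg => (hv3 _ hsℬ).2 _ hlℬ h hh g hg) i
    have e2 := (colDist_mul_left (modelMatrix K σ x Q (β s)) (modelMatrix K σ x Q (wordSet β l))
      (l.map φ).prod).trans (ih hln' hl')
    calc _ ≤ bad.card + (l.length + 1) * bad.card :=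
          (colDist_triangle _ _ _).trans (add_le_add e1 e2)
      _ = (l.length + 1 + 1) * bad.card := by ring

open scoped Classical in
-- The bound `θ < δ` handles the trace, a frequency; the bound `2 * (n + 1) * θ < δ ^ 2` handles
-- multiplicativity of words of length at most `n` after passing from columns to the `2`-norm.
theorem mem_SA_of_model {δ θ : ℝ} (hδ : 0 < δ) (hd : 0 < d) (hθδ : θ < δ)
    (hθ : 2 * (n + 1) * θ < δ ^ 2)
    (hβ : ∀ s : (actionGroupoid G X μ).linSpan,
      (s : (actionGroupoid G X μ).Op) ∈ F ∪ ContinuousLinearMap.adjoint '' F →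
      (actionGroupoid G X μ).IsBisection (β s) ∧ ∀ C ξ, (actionGroupoid G X μ).IsBisection C →
        (actionGroupoid G X μ).IsIndicator C ξ →
        (actionGroupoid G X μ).IsIndicator ((actionGroupoid G X μ).setMul (β s) C)
          ((s : (actionGroupoid G X μ).Op) ξ))
    (hℬ : ∀ B ∈ ℬ, (actionGroupoid G X μ).IsBisection B)
    (hW : ∀ l : List (actionGroupoid G X μ).linSpan, l.length ≤ n → (∀ s ∈ l,
      (s : (actionGroupoid G X μ).Op) ∈ F ∪ ContinuousLinearMap.adjoint '' F) → wordSet β l ∈ ℬ)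
    (hφ : ∀ l : List (actionGroupoid G X μ).linSpan, l.length ≤ n → (∀ s ∈ l,
      (s : (actionGroupoid G X μ).Op) ∈ F ∪ ContinuousLinearMap.adjoint '' F) →
      ∀ a : (actionGroupoid G X μ).linSpan,
        (a : (actionGroupoid G X μ).Op) = (l.map Subtype.val).prod →
        φ a = modelMatrix K σ x Q (wordSet β l))
    (hM : IsActionModel K 𝒞 σ x Q₀ Q) (h1 : (1 : G) ∈ K)
    (h𝒞 : ∀ B ∈ ℬ, ∀ g ∈ K, fiberAt B g ∈ 𝒞 ∧ rangeFiberAt B g ∈ 𝒞)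
    (hbadc : (bad.card : ℝ) ≤ θ * d)
    (hbad : ∀ v ∉ bad, v ∈ Q ∧ (∀ h ∈ K, σ h v ∈ Q) ∧ ∀ B ∈ ℬ, (∀ g, (g, x v) ∈ B → g ∈ K) ∧
      ∀ C ∈ ℬ, ∀ h, (h, x v) ∈ C → ∀ g, (g, h • x v) ∈ B → g ∈ K)
    (htr : ∀ B ∈ ℬ, |((Q.filter fun v => x v ∈ fiberAt B 1).card : ℝ) -
      μ.real (fiberAt B 1) * d| ≤ θ * d) :
    φ ∈ (actionGroupoid G X μ).SA F n δ d := by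
  intro l hne hln hl a ha
  have hn1 : 1 ≤ n := le_trans (List.length_pos_iff.2 hne) hln
  have hφs : ∀ s : (actionGroupoid G X μ).linSpan,
      (s : (actionGroupoid G X μ).Op) ∈ F ∪ ContinuousLinearMap.adjoint '' F →
      φ s = modelMatrix K σ x Q (β s) := fun s hs => by
    rw [← wordSet_singleton β s]
    refine hφ [s] hn1 (fun t ht => ?_) s ?_
    · rw [List.mem_singleton.1 ht]
      exact hs
    · rw [List.map_singleton, List.prod_singleton]
  have hlℬ := hW l hln hl
  have hmem : ∀ B ∈ ℬ, modelMatrix K σ x Q B ∈ partialPermMatrices d := fun B hB =>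
    hM.modelMatrix_mem (hℬ B hB) fun g hg => (h𝒞 B hB g hg).2
  have hprod : (l.map φ).prod ∈ partialPermMatrices d := by
    refine list_prod_mem_partialPermMatrices _ fun b hb => ?_
    obtain ⟨s, hs, rfl⟩ := List.mem_map.1 hb
    rw [hφs s (hl s hs), ← wordSet_singleton β s]
    refine hmem _ (hW [s] hn1 fun t ht => ?_)
    rw [List.mem_singleton.1 ht]
    exact hl s hs
  rw [hφ l hln hl a ha]
  refine ⟨norm2_lt_of_colDist (hmem _ hlℬ) hprod hδ hd (word_length_bound hln hd hbadc hθ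
    (colDist_word_le hℬ hW hφs hM h1 (fun B hB g hg => (h𝒞 B hB g hg).1) hbad l hln hl)),
    hmem _ hlℬ, ?_⟩
  obtain ⟨hbis, hind⟩ := wordSet_spec hβ l hl
  rw [trace_eq hbis (by rw [ha]; exact hind), vol_real_units_inter hbis.1,
    hM.normTrace_modelMatrix h1]
  have hd' : (0 : ℝ) < d := by exact_mod_cast hd
  have hdc : (d : ℂ) ≠ 0 := by exact_mod_cast hd.ne'
  have e1 : (((Q.filter fun v => x v ∈ fiberAt (wordSet β l) 1).card : ℂ) / d -
      ((μ.real (fiberAt (wordSet β l) 1) : ℝ) : ℂ)) =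
      (((((Q.filter fun v => x v ∈ fiberAt (wordSet β l) 1).card : ℝ) -
        μ.real (fiberAt (wordSet β l) 1) * d) / d : ℝ) : ℂ) := by
    push_cast
    rw [sub_div, mul_div_cancel_right₀ _ hdc]
  rw [e1, Complex.norm_real, Real.norm_eq_abs, abs_div, Nat.abs_cast, div_lt_iff₀ hd']
  refine (htr _ hlℬ).trans_lt ?_
  gcongr

end ModelMap

open PMPGroupoid

/-! ### The lower bound -/

section Lower

theorem zero_mem_partialPermMatrices {d : ℕ} :
    (0 : Matrix (Fin d) (Fin d) ℂ) ∈ partialPermMatrices d :=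
  mem_partialPermMatrices_of_columns 0 (fun _ => none) (by simp) (by simp)

theorem exists_word_tolerance (n : ℕ) {η δ : ℝ} (hη : 0 < η) (hδ : 0 < δ) :
    ∃ θ : ℝ, 0 < θ ∧ θ ≤ η ∧ θ < δ ∧ 2 * (n + 1) * θ < δ ^ 2 := by
  refine ⟨min η (min (δ / 2) (δ ^ 2 / (4 * (n + 1)))), by positivity, min_le_left _ _, ?_, ?_⟩
  · exact ((min_le_right _ _).trans (min_le_left _ _)).trans_lt (half_lt_self hδ)
  · have h : min η (min (δ / 2) (δ ^ 2 / (4 * (n + 1)))) ≤ δ ^ 2 / (4 * (n + 1)) :=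
      (min_le_right _ _).trans (min_le_right _ _)
    rw [le_div_iff₀ (by positivity)] at h
    have : 0 < δ ^ 2 := by positivity
    linarith

variable {G : Type*} [Group G] [Countable G] [MeasurableSpace G] [DiscreteMeasurableSpace G]
  {X : Type*} [MeasurableSpace X] [StandardBorelSpace X] [MulAction G X]
  [MeasurableConstSMul G X] {μ : Measure X} [IsProbabilityMeasure μ] [SMulInvariantMeasure G X μ]

theorem exists_finset_translations {E : Set (groupGroupoid G).Op} (hEfin : E.Finite)
    (hE : E ⊆ (groupGroupoid G).partialIsometries) :
    ∃ K₀ : Finset G, 1 ∈ K₀ ∧ ∀ T ∈ E, T = 0 ∨ ∃ g ∈ K₀, T = groupTranslation G g := by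
  classical
  have h : ∀ T : (groupGroupoid G).Op, ∃ g, T ∈ E → T = 0 ∨ T = groupTranslation G g := fun T => by
    by_cases hT : T ∈ E
    · rcases eq_zero_or_groupTranslation (hE hT) with h | ⟨g, h⟩
      · exact ⟨1, fun _ => Or.inl h⟩
      · exact ⟨g, fun _ => Or.inr h⟩
    · exact ⟨1, fun h => (hT h).elim⟩
  choose γ hγ using h
  refine ⟨insert 1 (hEfin.toFinset.image γ), Finset.mem_insert_self _ _, fun T hT => ?_⟩
  rcases hγ T hT with h | h
  · exact Or.inl h
  · exact Or.inr ⟨γ T, Finset.mem_insert_of_mem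
      (Finset.mem_image_of_mem _ (hEfin.mem_toFinset.2 hT)), h⟩

/-- Elements of `E` are zero or translations; so `ψ` on `E` is determined, up to Hamming balls of
radius `m`, by the values of `φ` on the translations in `K₀`. -/
theorem restrictCard_group_le {E : Set (groupGroupoid G).Op} (hEfin : E.Finite) {K₀ : Finset G}
    (hE : ∀ T ∈ E, T = 0 ∨ ∃ g ∈ K₀, T = groupTranslation G g) {F' : Set (groupGroupoid G).Op}
    {n' : ℕ} {δ' : ℝ} {F : Set (actionGroupoid G X μ).Op} {n : ℕ} {δ : ℝ} {d m : ℕ}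
    (h : ∀ ψ ∈ (groupGroupoid G).SA F' n' δ' d, ∃ φ ∈ (actionGroupoid G X μ).SA F n δ d,
      ∀ g ∈ K₀, ∀ (a : (groupGroupoid G).linSpan) (b : (actionGroupoid G X μ).linSpan),
      (a : (groupGroupoid G).Op) = groupTranslation G g →
      (b : (actionGroupoid G X μ).Op) = actionTranslation G X μ g →
      ψ a ∈ partialPermMatrices d ∧ colDist (ψ a) (φ b) ≤ m) :
    (groupGroupoid G).restrictCard E ((groupGroupoid G).SA F' n' δ' d) ≤
      (actionGroupoid G X μ).restrictCard (actionTranslation G X μ '' (K₀ : Set G))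
        ((actionGroupoid G X μ).SA F n δ d) *
      ((2 ^ d * (d + 1) ^ m) ^
        Nat.card {a : (groupGroupoid G).linSpan // (a : (groupGroupoid G).Op) ∈ E} : ℕ) := by
  have : Finite {a : (groupGroupoid G).linSpan // (a : (groupGroupoid G).Op) ∈ E} :=
    (hEfin.preimage Subtype.val_injective.injOn).to_subtype
  let idx : K₀ → {b : (actionGroupoid G X μ).linSpan //
      (b : (actionGroupoid G X μ).Op) ∈ actionTranslation G X μ '' (K₀ : Set G)} := fun g =>
    ⟨⟨actionTranslation G X μ g, Submodule.subset_span (actionTranslation_mem _)⟩, g, g.2, rfl⟩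
  have hcode : ∀ i : {a : (groupGroupoid G).linSpan // (a : (groupGroupoid G).Op) ∈ E},
      ∃ o : Option K₀, (o = none ∧ i.1 = 0) ∨
        ∃ g : K₀, o = some g ∧ (i.1 : (groupGroupoid G).Op) = groupTranslation G g := by
    rintro ⟨a, ha⟩
    rcases hE _ ha with h0 | ⟨g, hg, hag⟩
    · exact ⟨none, Or.inl ⟨rfl, Subtype.ext h0⟩⟩
    · exact ⟨some ⟨g, hg⟩, Or.inr ⟨_, rfl, hag⟩⟩
  choose o ho using hcode
  choose S hScard hS using fun c : Matrix (Fin d) (Fin d) ℂ => exists_finset_colDist_ball c m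
  refine encard_le_of_fibers _ _ (2 ^ d * (d + 1) ^ m)
    (Nat.one_le_iff_ne_zero.2 (by positivity)) (fun t i => S ((o i).elim 0 fun g => t (idx g)))
    (fun t i => hScard _) ?_
  rintro _ ⟨ψ, hψ, rfl⟩
  obtain ⟨φ, hφ, hφψ⟩ := h ψ hψ
  refine ⟨_, ⟨φ, hφ, rfl⟩, fun i => ?_⟩
  dsimp only
  rcases ho i with ⟨h1, h2⟩ | ⟨g, h1, h2⟩
  · rw [h1, h2, map_zero, Option.elim_none]
    exact hS 0 0 zero_mem_partialPermMatrices (by rw [colDist_self]; exact Nat.zero_le _)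
  · rw [h1, Option.elim_some]
    obtain ⟨h3, h4⟩ := hφψ g g.2 i.1 (idx g).1 h2 rfl
    exact hS _ _ h3 h4

theorem finite_words {A X : Type*} [MeasurableSpace A] [StandardBorelSpace A] [MeasurableSpace X]
    [StandardBorelSpace X] {𝒢 : PMPGroupoid A X} {S : Set 𝒢.Op} (hS : S.Finite) (n : ℕ) :
    {l : List 𝒢.linSpan | l.length ≤ n ∧ ∀ s ∈ l, (s : 𝒢.Op) ∈ S}.Finite := by
  have : Finite {s : 𝒢.linSpan // (s : 𝒢.Op) ∈ S} :=
    (hS.preimage Subtype.val_injective.injOn).to_subtype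
  refine ((List.finite_length_le {s : 𝒢.linSpan // (s : 𝒢.Op) ∈ S} n).image
    (List.map Subtype.val)).subset ?_
  rintro l ⟨hl, hlS⟩
  lift l to List {s : 𝒢.linSpan // (s : 𝒢.Op) ∈ S} using hlS
  exact ⟨l, by simpa using hl, rfl⟩

/-- Sofic approximations of the group lift to approximate homomorphisms of the action. -/
theorem exists_lift_of_SA (hX : AdmitsSoficModels G μ) {K₀ : Finset G} (hK₀ : 1 ∈ K₀)
    {F : Set (actionGroupoid G X μ).Op} (hFfin : F.Finite)
    (hF : F ⊆ (actionGroupoid G X μ).partialIsometries) (n : ℕ) {δ η : ℝ} (hδ : 0 < δ)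
    (hη : 0 < η) :
    ∃ F' : Set (groupGroupoid G).Op, (F'.Finite ∧ F' ⊆ (groupGroupoid G).partialIsometries) ∧
      ∃ δ' : ℝ, 0 < δ' ∧ ∀ᶠ d : ℕ in atTop, ∀ ψ ∈ (groupGroupoid G).SA F' 2 δ' d,
        ∃ φ ∈ (actionGroupoid G X μ).SA F n δ d,
        ∀ g ∈ K₀, ∀ (a : (groupGroupoid G).linSpan) (b : (actionGroupoid G X μ).linSpan),
        (a : (groupGroupoid G).Op) = groupTranslation G g →
        (b : (actionGroupoid G X μ).Op) = actionTranslation G X μ g →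
        ψ a ∈ partialPermMatrices d ∧ colDist (ψ a) (φ b) ≤ ⌊η * d⌋₊ := by
  obtain ⟨θ, hθ0, hθη, hθδ, hθn⟩ := exists_word_tolerance n hη hδ
  have hβ : ∀ s : (actionGroupoid G X μ).linSpan, ∃ B,
      (s : (actionGroupoid G X μ).Op) ∈ F ∪ ContinuousLinearMap.adjoint '' F →
      (actionGroupoid G X μ).IsBisection B ∧ ∀ C ξ, (actionGroupoid G X μ).IsBisection C →
        (actionGroupoid G X μ).IsIndicator C ξ →
        (actionGroupoid G X μ).IsIndicator ((actionGroupoid G X μ).setMul B C)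
          ((s : (actionGroupoid G X μ).Op) ξ) := fun s => by
    by_cases hs : (s : (actionGroupoid G X μ).Op) ∈ F ∪ ContinuousLinearMap.adjoint '' F
    · obtain ⟨B, hB⟩ := exists_bisection_action hF hs
      exact ⟨B, fun _ => hB⟩
    · exact ⟨∅, fun h => (hs h).elim⟩
  choose β hβ using hβ
  let W : Set (List (actionGroupoid G X μ).linSpan) := {l | l.length ≤ n ∧ ∀ s ∈ l,
    (s : (actionGroupoid G X μ).Op) ∈ F ∪ ContinuousLinearMap.adjoint '' F}
  have hWfin : W.Finite := finite_words (hFfin.union (hFfin.image _)) n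
  -- Words are needed for membership in `SA`; the translations by `K₀` are added because `φ` is
  -- compared with `ψ` there, even if they do not occur among the words.
  let 𝒲 : Set (Set (G × X) × (actionGroupoid G X μ).L2) :=
    (fun l => (wordSet β l, (l.map Subtype.val).prod (actionGroupoid G X μ).unitVector)) '' W ∪
    (fun g => (slice X g, actionTranslation G X μ g (actionGroupoid G X μ).unitVector)) '' K₀
  have h𝒲fin : 𝒲.Finite := (hWfin.image _).union (K₀.finite_toSet.image _)
  have h𝒲 : ∀ p ∈ 𝒲, (actionGroupoid G X μ).IsBisection p.1 ∧
      (actionGroupoid G X μ).IsIndicator p.1 p.2 := by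
    rintro _ (⟨l, hl, rfl⟩ | ⟨g, -, rfl⟩)
    · exact wordSet_spec hβ l hl.2
    · exact ⟨slice_isBisection g,
        (actionTranslation_spec g).isIndicator_unitVector (slice_isBisection g)⟩
  let ℬ : Set (Set (G × X)) := Prod.fst '' 𝒲
  have hℬ : ∀ B ∈ ℬ, (actionGroupoid G X μ).IsBisection B := by
    rintro _ ⟨p, hp, rfl⟩
    exact (h𝒲 p hp).1
  obtain ⟨L, hL⟩ := (actionGroupoid G X μ).exists_linear_lift
  obtain ⟨N, hN, hμN, hLN⟩ := exists_null_set hL h𝒲fin fun p hp => (h𝒲 p hp).2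
  obtain ⟨K, hK, 𝒞, h𝒞, T, hKT, κ, hκ, d₀, hmodel⟩ :=
    exists_action_model hX (h𝒲fin.image _) hℬ hN hμN hK₀ hθ0
  obtain ⟨F', hF', δ', hδ', hsofic⟩ := exists_sofic_of_SA T hκ
  refine ⟨F', hF', δ', hδ', ?_⟩
  filter_upwards [eventually_ge_atTop d₀, eventually_gt_atTop 0] with d hd hd0 ψ hψ
  obtain ⟨σ, V, hV, hVc, hσ⟩ := hsofic d ψ hψ
  obtain ⟨x, Q₀, Q, bad, hM, hQ₀V, hxN, hQc, hbadc, hbad, htr⟩ := hmodel d hd σ V hV hVc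
  have hmap : ∀ p ∈ 𝒲, ∀ a : (actionGroupoid G X μ).linSpan,
      (a : (actionGroupoid G X μ).Op) (actionGroupoid G X μ).unitVector = p.2 →
      modelMap L K σ x Q a = modelMatrix K σ x Q p.1 := fun p hp a ha =>
    modelMap_eq_modelMatrix (h𝒲 p hp).1 fun v hv g => by
      rw [ha]
      exact hLN (x v) (hxN v (hM.subset hv)) p hp g
  have hW : ∀ l ∈ W, (wordSet β l, (l.map Subtype.val).prod (actionGroupoid G X μ).unitVector) ∈ 𝒲 :=
    fun l hl => Or.inl ⟨l, hl, rfl⟩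
  have hφ : ∀ l ∈ W, ∀ a : (actionGroupoid G X μ).linSpan,
      (a : (actionGroupoid G X μ).Op) = (l.map Subtype.val).prod →
      modelMap L K σ x Q a = modelMatrix K σ x Q (wordSet β l) := fun l hl a ha =>
    hmap _ (hW l hl) a (by rw [ha])
  refine ⟨modelMap L K σ x Q, ?_, fun g hg a b ha hb => ?_⟩
  · exact mem_SA_of_model (φ := modelMap L K σ x Q) (β := β) (ℬ := ℬ) (K := K) (𝒞 := 𝒞) (σ := σ)
      (x := x) (Q₀ := Q₀) (Q := Q) (bad := bad) hδ hd0 hθδ hθn hβ hℬ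
      (fun l hln hl => ⟨_, hW l ⟨hln, hl⟩, rfl⟩)
      (fun l hln hl a ha => hφ l ⟨hln, hl⟩ a ha) hM (hK hK₀) h𝒞 hbadc hbad htr
  · have hgT : g ∈ T := hKT (hK hg)
    have h12 := hσ g hgT a ha
    have h1 := h12.1
    have h2 := h12.2
    refine ⟨h1, Nat.le_floor ?_⟩
    rw [hmap _ (Or.inr ⟨g, hg, rfl⟩) b (by rw [hb])]
    have h3 : colDist (ψ a) (modelMatrix K σ x Q (slice X g)) ≤ (Qᶜ).card := by
      refine colDist_le_card _ fun v hv i => ?_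
      rw [Finset.mem_compl, not_not] at hv
      rw [h2 v (hQ₀V (hM.subset hv)), modelMatrix_slice_apply (hK hg) hv]
    calc ((colDist (ψ a) (modelMatrix K σ x Q (slice X g)) : ℕ) : ℝ) ≤ (Qᶜ).card := by
          exact_mod_cast h3
      _ ≤ θ * d := hQc
      _ ≤ η * d := by gcongr

/-- Every approximate homomorphism of the group lifts to one of the action with nearly the same
values on `K₀`. Words of length two in the group suffice, since they already yield the maps `σ`. -/
theorem soficDim_group_le_action (hX : AdmitsSoficModels G μ) :
    (groupGroupoid G).soficDim ≤ (actionGroupoid G X μ).soficDim ∧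
    (groupGroupoid G).lowerSoficDim ≤ (actionGroupoid G X μ).lowerSoficDim := by
  refine soficDim_le_of_growth_le _ _ fun E hE ε hε => ?_
  obtain ⟨K₀, hK₀, hEK₀⟩ := exists_finset_translations hE.1 hE.2
  obtain ⟨η, hη0, hηε⟩ := exists_small_rate
    (Nat.card {a : (groupGroupoid G).linSpan // (a : (groupGroupoid G).Op) ∈ E}) hε
  refine ⟨actionTranslation G X μ '' K₀, ⟨K₀.finite_toSet.image _, ?_⟩, ?_⟩
  · rintro _ ⟨g, -, rfl⟩
    exact actionTranslation_mem g
  intro F hF n _ δ hδ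
  obtain ⟨F', hF', δ', hδ', h⟩ := exists_lift_of_SA hX hK₀ hF.1 hF.2 n hδ hη0
  refine ⟨F', hF', 2, one_le_two, δ', hδ', growth_le_add _ _ one_le_two hη0.le hηε ?_⟩
  filter_upwards [h] with d hd
  exact ⟨⌊η * d⌋₊, Nat.floor_le (mul_nonneg hη0.le d.cast_nonneg),
    restrictCard_group_le hE.1 hEK₀ hd⟩

end Lower

end SoficDim

end

/-- The Bernoulli action `G ↷ (Y, ν)^G` of a countable discrete group with a finite base has the
same sofic dimension and the same lower sofic dimension as the group `G`. -/
theorem mainTheorem10 {G : Type*} [Group G] [Countable G] [MeasurableSpace G]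
    [DiscreteMeasurableSpace G] {Y : Type*} [Finite Y] [MeasurableSpace Y]
    [MeasurableSingletonClass Y] (ν : MeasureTheory.Measure Y)
    [MeasureTheory.IsProbabilityMeasure ν] :
    (SoficDim.actionGroupoid G (SoficDim.BernoulliSpace G Y)
        (SoficDim.bernoulliMeasure G ν)).soficDim = (SoficDim.groupGroupoid G).soficDim ∧
    (SoficDim.actionGroupoid G (SoficDim.BernoulliSpace G Y)
        (SoficDim.bernoulliMeasure G ν)).lowerSoficDim =
      (SoficDim.groupGroupoid G).lowerSoficDim := by
  have h1 := SoficDim.soficDim_action_le_group (G := G) (X := SoficDim.BernoulliSpace G Y)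
    (μ := SoficDim.bernoulliMeasure G ν)
  have h2 := SoficDim.soficDim_group_le_action (SoficDim.bernoulli_admitsSoficModels (G := G) ν)
  exact ⟨le_antisymm h1.1 h2.1, le_antisymm h1.2 h2.2⟩
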